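/- Let $c>0$ and let $(k_n)_{n\ge 1}$ be positive integers with $k_n/n\to c$ as $n\to\infty$. For each $n$ let $Y_n\in\mathcal M_{k_n}(\mathbb C)$ be a fixed rank-one orthogonal projection and let $U_n$ be a Haar-distributed random unitary matrix in $\mathcal U(nk_n)$, acting on $\mathbb C^n\otimes\mathbb C^{k_n}$; all the $U_n$ are defined on one probability space, with arbitrary joint law. Let $$\Phi_n(X)=\mathrm{Tr}_{k_n}\big[U_n(X\otimes Y_n)U_n^*\big],\qquad \overline{\Phi}_n(X)=\mathrm{Tr}_{k_n}\big[\overline{U_n}(X\otimes \overline{Y_n})\overline{U_n}^{\,*}\big],\qquad X\in\mathcal M_n(\mathbb C),$$ where the bar denotes entrywise complex conjugation and $\mathrm{Tr}_{k_n}$ is the partial trace over $\mathbb C^{k_n}$. Let $E_n=\frac1n\sum_{i,j=1}^n|e_i\rangle\langle e_j|\otimes|e_i\rangle\langle e_j|$ be the Bell state, $Z_n=[\Phi_n\otimes\overline{\Phi}_n](E_n)\in\mathcal M_{n^2}(\mathbb C)$ and $Q_n=I-E_n$. For $r>0$ let $$\pi_r=\max(1-r,0)\,\delta_0+\frac{\sqrt{4r-(x-1-r)^2}}{2\pi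 x}\,\mathbf 1_{[1+r-2\sqrt r,\;1+r+2\sqrt r]}(x)\,dx$$ be the Marchenko–Pastur (free Poisson) law of parameter $r$. Then, almost surely, $c^2n^2Q_nZ_nQ_n$ converges in distribution to $\pi_{c^2}$ as $n\to\infty$. That is, almost surely, its empirical spectral distribution $\frac1{n^2}\sum_{i=1}^{n^2}\delta_{\lambda_i(c^2n^2Q_nZ_nQ_n)}$ converges weakly to $\pi_{c^2}$, and all its moments converge: for every integer $p\ge 0$, $$\frac1{n^2}\mathrm{Tr}\big[(c^2n^2Q_nZ_nQ_n)^p\big]\longrightarrow\int x^p\,d\pi_{c^2}(x).$$ -/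

import Mathlib

open MeasureTheory Filter Topology
open scoped Matrix Kronecker BoundedContinuousFunction

noncomputable section

namespace RandomChannel

/-- The Borel sigma-algebra on the unitary group. -/
instance unitaryMeasurableSpace {ι : Type*} [Fintype ι] [DecidableEq ι] :
    MeasurableSpace (Matrix.unitaryGroup ι ℂ) :=
  borel _

instance unitaryBorelSpace {ι : Type*} [Fintype ι] [DecidableEq ι] :
    BorelSpace (Matrix.unitaryGroup ι ℂ) :=
  ⟨rfl⟩

/-- The random unitary matrix `U` is distributed according to the Haar measure: it is measurable
and its law is a Haar measure. (When `P` is a probability measure, the law is then the normalized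
Haar measure.) -/
structure IsHaarUnitary {Ω : Type*} [MeasurableSpace Ω] {ι : Type*} [Fintype ι] [DecidableEq ι]
    (U : Ω → Matrix.unitaryGroup ι ℂ) (P : Measure Ω) : Prop where
  measurable : Measurable U
  isHaarMeasure : (P.map U).IsHaarMeasure

/-- The partial trace over the second tensor factor. -/
def partialTrace (m κ : Type*) [Fintype κ] :
    Matrix (m × κ) (m × κ) ℂ →ₗ[ℂ] Matrix m m ℂ where
  toFun M := Matrix.of fun a b => ∑ j, M (a, j) (b, j)
  map_add' M N := by
    ext a b
    simp [Finset.sum_add_distrib]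
  map_smul' r M := by
    ext a b
    simp [Finset.mul_sum]

/-- The channel `X ↦ Tr_κ [U (X ⊗ Y) U*]` with interaction `U` and state of the environment `Y`. -/
def channel {m κ : Type*} [Fintype m] [Fintype κ]
    (U : Matrix (m × κ) (m × κ) ℂ) (Y : Matrix κ κ ℂ) : Matrix m m ℂ →ₗ[ℂ] Matrix m m ℂ where
  toFun X := partialTrace m κ (U * (X ⊗ₖ Y) * Uᴴ)
  map_add' X X' := by
    rw [Matrix.add_kronecker, mul_add, add_mul, map_add]
  map_smul' r X := by
    rw [Matrix.smul_kronecker, Matrix.mul_smul, Matrix.smul_mul, map_smul, RingHom.id_apply]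

/-- The tensor product `Φ ⊗ Ψ` of two linear maps on matrices: the linear map determined by
`A ⊗ B ↦ Φ A ⊗ Ψ B`, see `tensorMap_kronecker`. -/
def tensorMap {m : Type*} [Fintype m] [DecidableEq m]
    (Φ Ψ : Matrix m m ℂ →ₗ[ℂ] Matrix m m ℂ) :
    Matrix (m × m) (m × m) ℂ →ₗ[ℂ] Matrix (m × m) (m × m) ℂ where
  toFun M := ∑ a, ∑ b, ∑ a', ∑ b',
    M (a, a') (b, b') • (Φ (Matrix.single a b 1) ⊗ₖ Ψ (Matrix.single a' b' 1))
  map_add' M N := by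
    simp only [Matrix.add_apply, add_smul, Finset.sum_add_distrib]
  map_smul' r M := by
    simp only [Matrix.smul_apply, smul_assoc, Finset.smul_sum, RingHom.id_apply]

theorem tensorMap_kronecker {m : Type*} [Fintype m] [DecidableEq m]
    (Φ Ψ : Matrix m m ℂ →ₗ[ℂ] Matrix m m ℂ) (A B : Matrix m m ℂ) :
    tensorMap Φ Ψ (A ⊗ₖ B) = Φ A ⊗ₖ Ψ B := by
  have key : ∀ (Θ : Matrix m m ℂ →ₗ[ℂ] Matrix m m ℂ) (C : Matrix m m ℂ),
      Θ C = ∑ a, ∑ b, C a b • Θ (Matrix.single a b 1) := by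
    intro Θ C
    conv_lhs => rw [Matrix.matrix_eq_sum_single C]
    simp only [map_sum]
    refine Finset.sum_congr rfl fun a _ => Finset.sum_congr rfl fun b _ => ?_
    rw [← map_smul, Matrix.smul_single, smul_eq_mul, mul_one]
  rw [key Φ A, key Ψ B]
  ext ⟨x, x'⟩ ⟨y, y'⟩
  simp only [tensorMap, LinearMap.coe_mk, AddHom.coe_mk, Matrix.sum_apply, Matrix.smul_apply,
    Matrix.kroneckerMap_apply, smul_eq_mul]
  simp only [Finset.sum_mul]
  simp only [Finset.mul_sum]
  refine Finset.sum_congr rfl fun a _ => Finset.sum_congr rfl fun b _ =>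
    Finset.sum_congr rfl fun a' _ => Finset.sum_congr rfl fun b' _ => ?_
  ring

/-- The maximally entangled (Bell) state
`E_n = (1/n) ∑_{i,j} |e_i⟩⟨e_j| ⊗ |e_i⟩⟨e_j|` on `ℂⁿ ⊗ ℂⁿ`. -/
def bell (n : ℕ) : Matrix (Fin n × Fin n) (Fin n × Fin n) ℂ :=
  (1 / (n : ℂ)) • ∑ i : Fin n, ∑ j : Fin n, Matrix.single i j 1 ⊗ₖ Matrix.single i j 1

/-- `Z = [Φ ⊗ Φ̄](E_n)`, where `Φ` is the channel given by `(U, Y)` and `Φ̄` is the complex conjugate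
channel, given by the entrywise conjugates of `U` and `Y`. -/
def outputZ {n k : ℕ} (U : Matrix.unitaryGroup (Fin n × Fin k) ℂ)
    (Y : Matrix (Fin k) (Fin k) ℂ) : Matrix (Fin n × Fin n) (Fin n × Fin n) ℂ :=
  tensorMap (channel U.1 Y) (channel (U.1.map star) (Y.map star)) (bell n)

/-- The matrix `c² n² Q Z Q` with `Q = I - E_n`. -/
def rescaledQZQ (c : ℝ) {n k : ℕ} (U : Matrix.unitaryGroup (Fin n × Fin k) ℂ)
    (Y : Matrix (Fin k) (Fin k) ℂ) : Matrix (Fin n × Fin n) (Fin n × Fin n) ℂ :=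
  ((c : ℂ) ^ 2 * (n : ℂ) ^ 2) • ((1 - bell n) * outputZ U Y * (1 - bell n))

open Classical in
/-- The empirical spectral distribution of a Hermitian matrix: the mean of the unit masses at its
eigenvalues, counted with multiplicity (and `0` if the matrix is not Hermitian). -/
def empiricalSpectralMeasure {ι : Type*} [Fintype ι] [DecidableEq ι] (A : Matrix ι ι ℂ) :
    Measure ℝ :=
  if hA : A.IsHermitian then
    (Fintype.card ι : ENNReal)⁻¹ • ∑ i, Measure.dirac (hA.eigenvalues i)
  else 0

/-- The Marchenko–Pastur (free Poisson) distribution of parameter `r`. -/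
def marchenkoPastur (r : ℝ) : Measure ℝ :=
  ENNReal.ofReal (max (1 - r) 0) • Measure.dirac 0 +
    volume.withDensity fun x => ENNReal.ofReal
      ((Set.Icc (1 + r - 2 * √r) (1 + r + 2 * √r)).indicator
        (fun x => √(4 * r - (x - 1 - r) ^ 2) / (2 * Real.pi * x)) x)

/-- Weak convergence of finite measures on the real line. -/
def ConvergesWeakly (μ : ℕ → Measure ℝ) (ν : Measure ℝ) : Prop :=
  ∀ f : ℝ →ᵇ ℝ, Tendsto (fun n => ∫ x, f x ∂(μ n)) atTop (𝓝 (∫ x, f x ∂ν))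

end RandomChannel

end

/-! Let P = U(1 ⊗ Y)U* and let R(P) be its realignment, the n² × k² matrix with entries
R(P)_{(a,a'),(l,l')} = P_{(a,l),(a',l')}. Since Y has rank one, Z = (1/n) R(P)R(P)* (`outputZ_eq`).
The columns of R(1) are multiples of the Bell vector, so I - E_n kills them and P may be replaced by
W = UDU* with D = 1 ⊗ Y - 1/k of trace zero (`rescaledQZQ_eq`). The compression by I - E_n is
harmless: it changes tr B^p, for B = c²n R(W)R(W)*, by at most p‖B‖^p, and ‖B‖^p ≤ (tr B^{2p})^{1/2}
= O(n) once the moments of B converge, which is negligible against n².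

The moments of B come from loop equations. By Haar invariance, the expected derivative of a product
of entries of W along [H, W] vanishes. With H a matrix unit, tr D = 0 and D² = aD + b, this
expresses a contraction of copies of W along a pair of permutations (α, β) by contractions along
(ατ, βτ), τ a transposition, with as many copies, one fewer or two fewer (`loop_equation`). The
product αβ⁻¹ never changes, and a contraction without copies equals n^{#α}k^{#β}, where # counts
orbits. Hence `orbitCount_add_le` bounds every contraction. With weight n^{3/2} per copy the three
coefficients have orders n^{-2}, n^{-1/2} and 1, so only double deletions reach the leading order.
In tr B^{q+1} they cut the cyclic word in two, and the limits satisfy m_{q+1} = ∑_t m_t m_{q-t},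
with the factor m_t replaced by c² at t = 0. Subleading contractions lose a full factor n²
(`orbitCount_add_two_le`), so covariances of normalized traces are O(n^{-2}). This factorizes the
means of products and, being summable, gives almost sure convergence whatever the joint law.

The quadratic recursion is matched with the Marchenko–Pastur moments through a linear one, obtained
from the algebraic generating function (`mpSeq_linear`) and from integration by parts against the
density (`semiMoment_linear`). Weak convergence follows because the limit has compact support. -/

namespace RandomChannel
open Equiv Equiv.Perm

/-! ### Orbit counts of permutations and the genus inequality. -/

section Orbits
variable {ι : Type*}

/-- The number of orbits (cycles, including fixed points) of a permutation. -/
noncomputable def orbitCount (α : Perm ι) : ℕ := Nat.card (Quotient (SameCycle.setoid α))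

theorem eq_of_sameCycle {X : Type*} {α : Perm ι} {f : ι → X} (hf : ∀ i, f (α i) = f i) {x y : ι}
    (h : α.SameCycle x y) : f x = f y := by
  obtain ⟨z, rfl⟩ := h
  have hpos : ∀ (q : ℕ) (x : ι), f ((α ^ q) x) = f x := by
    intro q
    induction q with
    | zero => simp
    | succ q ih => intro x; rw [pow_succ', mul_apply, hf, ih]
  cases z with
  | ofNat q => simpa using (hpos q x).symm
  | negSucc q =>
    have := hpos (q + 1) ((α ^ Int.negSucc q) x)
    rw [← this, zpow_negSucc, ← mul_apply, mul_inv_cancel, one_apply]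

/-- Functions constant along the orbits of `α` are functions on the set of orbits. -/
noncomputable def invariantEquiv (α : Perm ι) (X : Type*) :
    {f : ι → X // ∀ i, f (α i) = f i} ≃ (Quotient (SameCycle.setoid α) → X) where
  toFun f := Quotient.lift f.1 fun _ _ h => eq_of_sameCycle f.2 h
  invFun g := ⟨fun i => g (Quotient.mk _ i), fun i => congrArg g
    (Quotient.sound (s := SameCycle.setoid α) (SameCycle.refl α i).apply_left)⟩
  left_inv f := by ext; rfl
  right_inv g := by
    ext q
    induction q using Quotient.inductionOn
    rfl

theorem card_invariant [Finite ι] (α : Perm ι) (X : Type*) [Fintype X] :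
    Nat.card {f : ι → X // ∀ i, f (α i) = f i} = Fintype.card X ^ orbitCount α := by
  rw [Nat.card_congr (invariantEquiv α X), Nat.card_fun, Nat.card_eq_fintype_card (α := X),
    orbitCount]

/-- The functions invariant under a permutation, as a subspace. -/
def invariantSubspace (α : Perm ι) : Submodule ℚ (ι → ℚ) where
  carrier := {f | ∀ i, f (α i) = f i}
  add_mem' hf hg i := by simp [hf i, hg i]
  zero_mem' i := rfl
  smul_mem' c f hf i := by simp [hf i]

theorem finrank_invariantSubspace [Finite ι] (α : Perm ι) :
    Module.finrank ℚ (invariantSubspace α) = orbitCount α := by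
  classical
  have e : (invariantSubspace α) ≃ₗ[ℚ] (Quotient (SameCycle.setoid α) → ℚ) :=
    { invariantEquiv α ℚ with
      map_add' := fun f g => by
        ext q
        induction q using Quotient.inductionOn
        rfl
      map_smul' := fun c f => by
        ext q
        induction q using Quotient.inductionOn
        rfl }
  have : Fintype (Quotient (SameCycle.setoid α)) := Fintype.ofFinite _
  rw [e.finrank_eq, Module.finrank_fintype_fun_eq_card, orbitCount, Nat.card_eq_fintype_card]

theorem inf_invariantSubspace_le (α β : Perm ι) :
    invariantSubspace α ⊓ invariantSubspace β ≤ invariantSubspace (α * β⁻¹) := by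
  rintro f ⟨h1, h2⟩ i
  have h3 := h2 (β⁻¹ i)
  rw [← mul_apply β, mul_inv_cancel, one_apply] at h3
  rw [mul_apply, h1, h3]

/-- Orbit counts are dimensions of spaces of invariant functions. The sum of the two spaces lies in
ℚ^ι and their intersection is invariant under α * β⁻¹, so the dimension formula gives the bound. -/
theorem orbitCount_add_le [Fintype ι] (α β : Perm ι) :
    orbitCount α + orbitCount β ≤ Fintype.card ι + orbitCount (α * β⁻¹) := by
  have h1 := Submodule.finrank_sup_add_finrank_inf_eq (invariantSubspace α) (invariantSubspace β)
  have h2 := Submodule.finrank_mono (inf_invariantSubspace_le α β)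
  have h3 := Submodule.finrank_le (invariantSubspace α ⊔ invariantSubspace β)
  rw [Module.finrank_fintype_fun_eq_card] at h3
  simp only [finrank_invariantSubspace] at h1 h2
  omega

/-- The indicator of the cycle of z under α * β⁻¹ is invariant under α * β⁻¹ but not under α, so the
inclusion of invariant spaces is strict. -/
theorem orbitCount_add_lt [Fintype ι] (α β : Perm ι) (z : ι) (hz : ¬ (α * β⁻¹).SameCycle (α z) z) :
    orbitCount α + orbitCount β < Fintype.card ι + orbitCount (α * β⁻¹) := by
  have h1 := Submodule.finrank_sup_add_finrank_inf_eq (invariantSubspace α) (invariantSubspace β)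
  have h2 : invariantSubspace α ⊓ invariantSubspace β < invariantSubspace (α * β⁻¹) := by
    refine lt_of_le_of_ne (inf_invariantSubspace_le α β) fun h => hz ?_
    classical
    let f : ι → ℚ := fun i => if (α * β⁻¹).SameCycle i z then 1 else 0
    have hf : f ∈ invariantSubspace (α * β⁻¹) := fun i => by
      simp only [f, sameCycle_apply_left]
    rw [← h] at hf
    have := hf.1 z
    by_contra hc
    simp [f, hc, SameCycle.refl] at this
  have h2 := Submodule.finrank_lt_finrank_of_lt h2
  have h3 := Submodule.finrank_le (invariantSubspace α ⊔ invariantSubspace β)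
  rw [Module.finrank_fintype_fun_eq_card] at h3
  simp only [finrank_invariantSubspace] at h1 h2
  omega

/-- `cycleType` ignores fixed points while `orbitCount` counts them; this identity converts one into
the other and serves to compute signs. -/
theorem orbitCount_eq [Fintype ι] [DecidableEq ι] (α : Perm ι) :
    orbitCount α + α.support.card = α.cycleType.card + Fintype.card ι := by
  classical
  let f : ι → Perm ι ⊕ ι := fun i => if α i = i then Sum.inr i else Sum.inl (cycleOf α i)
  have hker : SameCycle.setoid α = Setoid.ker f := by
    ext x y
    change α.SameCycle x y ↔ f x = f y
    by_cases hx : α x = x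
    · have : α.SameCycle x y ↔ x = y := by
        exact ⟨fun h => h.eq_of_left hx, fun h => h ▸ SameCycle.refl _ _⟩
      rw [this]
      by_cases hy : α y = y
      · simp [f, hx, hy]
      · simp only [f, hx, hy, if_true, if_false, reduceCtorEq, iff_false]
        rintro rfl
        exact hy hx
    · by_cases hy : α y = y
      · simp only [f, hx, hy, if_true, if_false, reduceCtorEq, iff_false]
        intro h
        have := h.symm.eq_of_left hy
        subst this
        exact hx hy
      · simp only [f, hx, hy, if_false, Sum.inl.injEq]
        exact sameCycle_iff_cycleOf_eq_of_mem_support (mem_support.2 hx) (mem_support.2 hy)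
  have hrange : Set.range f = ↑(α.cycleFactorsFinset.disjSum (Finset.univ.filter fun i => α i = i)) := by
    ext s
    simp only [Set.mem_range, Finset.mem_coe, Finset.mem_disjSum, Finset.mem_filter,
      Finset.mem_univ, true_and]
    constructor
    · rintro ⟨i, rfl⟩
      by_cases hi : α i = i
      · exact Or.inr ⟨i, hi, by simp [f, hi]⟩
      · exact Or.inl ⟨cycleOf α i, cycleOf_mem_cycleFactorsFinset_iff.2 (mem_support.2 hi),
          by simp [f, hi]⟩
    · rintro (⟨σ, hσ, rfl⟩ | ⟨i, hi, rfl⟩)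
      · obtain ⟨i, hi⟩ := (mem_cycleFactorsFinset_iff.1 hσ).1.nonempty_support
        have h1 := cycle_is_cycleOf hi hσ
        have h2 : α i ≠ i := mem_support.1 (mem_cycleFactorsFinset_support_le hσ hi)
        exact ⟨i, by simp [f, h2, h1]⟩
      · exact ⟨i, by simp [f, hi]⟩
  rw [orbitCount, hker, Nat.card_congr (Setoid.quotientKerEquivRange f), hrange,
    Nat.card_eq_card_toFinset, Finset.toFinset_coe, Finset.card_disjSum, cycleType_def,
    Multiset.card_map]
  have : α.support.card = (Finset.univ.filter fun i => ¬ α i = i).card := by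
    congr 1
  have h2 := Finset.card_filter_add_card_filter_not (s := (Finset.univ : Finset ι)) (fun i => α i = i)
  rw [Finset.card_univ] at h2
  simp only [Finset.card_val] at *
  omega

theorem sign_eq_orbitCount [Fintype ι] [DecidableEq ι] (α : Perm ι) : sign α = (-1) ^ (Fintype.card ι + orbitCount α) := by
  have h := orbitCount_eq α
  rw [sign_of_cycleType, sum_cycleType]
  have : Even (Fintype.card ι + orbitCount α + (α.support.card + α.cycleType.card)) := by
    refine ⟨Fintype.card ι + α.cycleType.card, by omega⟩
  rcases Nat.even_or_odd (Fintype.card ι + orbitCount α) with h1 | h1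
  · have h2 := (Nat.even_add.1 this).1 h1
    rw [h1.neg_one_pow, h2.neg_one_pow]
  · have h2 : Odd (α.support.card + α.cycleType.card) := by
      rw [← Nat.not_even_iff_odd] at h1 ⊢
      rwa [Nat.even_add.1 this] at h1
    rw [h1.neg_one_pow, h2.neg_one_pow]

/-- Signs fix the parity of the two sides, so a strict inequality improves by two. This extra unit
is what turns covariance bounds into summable ones. -/
theorem orbitCount_add_two_le [Fintype ι] [DecidableEq ι] (α β : Perm ι) (z : ι) (hz : ¬ (α * β⁻¹).SameCycle (α z) z) :
    orbitCount α + orbitCount β + 2 ≤ Fintype.card ι + orbitCount (α * β⁻¹) := by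
  have h1 := orbitCount_add_lt α β z hz
  have h2 : sign (α * β⁻¹) = sign α * sign β := by simp
  rw [sign_eq_orbitCount, sign_eq_orbitCount α, sign_eq_orbitCount β, ← pow_add] at h2
  by_contra hc
  have h3 : Fintype.card ι + orbitCount (α * β⁻¹) = orbitCount α + orbitCount β + 1 := by omega
  rw [h3, pow_succ, show Fintype.card ι + orbitCount α + (Fintype.card ι + orbitCount β) =
    orbitCount α + orbitCount β + 2 * Fintype.card ι by ring, pow_add _ _ (2 * _), pow_mul] at h2
  rcases neg_one_pow_eq_or ℤˣ (orbitCount α + orbitCount β) with h | h <;> rw [h] at h2 <;>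
    simp at h2

end Orbits
end RandomChannel

namespace RandomChannel
open Equiv Equiv.Perm

/-! ### Products of matrix entries and their derivatives along commutators. -/

section EntryProd
variable {ι d : Type*} [Fintype ι] [DecidableEq ι] [DecidableEq d]

/-- The product of the entries `(r i, c i)` of `Q` for `i ∈ S`, and of `1` for `i ∉ S`. -/
def entryProd (S : Finset ι) (Q : Matrix d d ℂ) (r c : ι → d) : ℂ :=
  ∏ i, (if i ∈ S then Q else 1) (r i) (c i)

theorem entryProd_eq_mul_erase (S : Finset ι) (Q : Matrix d d ℂ) (r c : ι → d) (x : ι) :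
    entryProd S Q r c = (if x ∈ S then Q else 1) (r x) (c x) *
      ∏ j ∈ Finset.univ.erase x, (if j ∈ S then Q else 1) (r j) (c j) :=
  (Finset.mul_prod_erase _ _ (Finset.mem_univ x)).symm

theorem entryProd_eq_mul_mul_erase (S : Finset ι) (Q : Matrix d d ℂ) (r c : ι → d) {x i : ι}
    (hi : i ≠ x) :
    entryProd S Q r c = (if x ∈ S then Q else 1) (r x) (c x) *
      ((if i ∈ S then Q else 1) (r i) (c i) *
      ∏ j ∈ (Finset.univ.erase x).erase i, (if j ∈ S then Q else 1) (r j) (c j)) := by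
  rw [entryProd_eq_mul_erase S Q r c x, Finset.mul_prod_erase
    (a := i) (s := Finset.univ.erase x) (f := fun j => (if j ∈ S then Q else 1) (r j) (c j))]
  simp [hi]

theorem continuous_entryProd (S : Finset ι) (r c : ι → d) :
    Continuous fun Q : Matrix d d ℂ => entryProd S Q r c := by
  refine continuous_finsetProd _ fun i _ => ?_
  split_ifs
  · exact continuous_id.matrix_elem _ _
  · exact continuous_const

variable [Fintype d]

/-- The derivative of `entryProd S Q r c` along the commutator `[H, Q]`. -/
def commDeriv (S : Finset ι) (Q H : Matrix d d ℂ) (r c : ι → d) : ℂ :=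
  ∑ i ∈ S, (H * Q - Q * H) (r i) (c i) *
    ∏ j ∈ Finset.univ.erase i, (if j ∈ S then Q else 1) (r j) (c j)

theorem commDeriv_add (S : Finset ι) (Q H H' : Matrix d d ℂ) (r c : ι → d) :
    commDeriv S Q (H + H') r c = commDeriv S Q H r c + commDeriv S Q H' r c := by
  simp only [commDeriv, ← Finset.sum_add_distrib, ← add_mul]
  refine Finset.sum_congr rfl fun i _ => ?_
  rw [← Matrix.add_apply]
  congr 1
  rw [add_mul, mul_add, add_sub_add_comm]

theorem commDeriv_smul (S : Finset ι) (Q H : Matrix d d ℂ) (z : ℂ) (r c : ι → d) :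
    commDeriv S Q (z • H) r c = z * commDeriv S Q H r c := by
  simp only [commDeriv, Finset.mul_sum]
  refine Finset.sum_congr rfl fun i _ => ?_
  rw [← mul_assoc]
  congr 1
  simp [mul_sub]

theorem single_comm_apply (Q : Matrix d d ℂ) (u w a b : d) :
    (Matrix.single u w 1 * Q - Q * Matrix.single u w 1 : Matrix d d ℂ) a b =
      (if u = a then Q w b else 0) - (if w = b then Q a u else 0) := by
  rw [Matrix.sub_apply, Matrix.mul_apply, Matrix.mul_apply]
  congr 1
  · rw [Finset.sum_eq_single w]
    · by_cases h : u = a <;> simp [h]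
    · intro y _ hy
      simp [hy.symm]
    · simp
  · rw [Finset.sum_eq_single u]
    · by_cases h : w = b <;> simp [h]
    · intro y _ hy
      simp [hy.symm]
    · simp

/-- Summing the commutator derivative over matrix units `E_{u w}`, with the row index at `x` equal
to `u`, where `w` is the original row index. -/
theorem sum_commDeriv (S : Finset ι) (Q : Matrix d d ℂ) (a b : ℂ) (hQ : Q * Q = a • Q + b • 1)
    (htr : Q.trace = 0) (r c : ι → d) {x : ι} (hx : x ∈ S) :
    ∑ u, commDeriv S Q (Matrix.single u (r x) 1) (Function.update r x u) c =
      Fintype.card d * entryProd S Q r c - ∑ i ∈ S.erase x,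
        (-entryProd S Q r (c ∘ swap x i) + a * entryProd (S.erase x) Q r (c ∘ swap x i)
          + b * entryProd ((S.erase x).erase i) Q r (c ∘ swap x i)) := by
  simp only [commDeriv, single_comm_apply]
  rw [Finset.sum_comm, ← Finset.add_sum_erase S _ hx, sub_eq_add_neg, ← Finset.sum_neg_distrib]
  congr 1
  · have h1 : ∀ u, ∏ j ∈ Finset.univ.erase x,
        (if j ∈ S then Q else 1) (Function.update r x u j) (c j) =
        ∏ j ∈ Finset.univ.erase x, (if j ∈ S then Q else 1) (r j) (c j) := fun u =>
      Finset.prod_congr rfl fun j hj => by rw [Function.update_of_ne (Finset.ne_of_mem_erase hj)]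
    simp only [h1, ← Finset.sum_mul, Function.update_self, if_true]
    rw [entryProd_eq_mul_erase S Q r c x, if_pos hx, ← mul_assoc]
    congr 1
    rw [Finset.sum_sub_distrib]
    -- In the factor at x itself, the QH half of the commutator sums to the trace of Q, which
    -- vanishes; the HQ half does not depend on u and yields the dimension.
    have h2 : ∑ u, (if r x = c x then Q u u else 0) = 0 := by
      split_ifs
      · exact htr
      · simp
    rw [h2]
    simp
  · refine Finset.sum_congr rfl fun i hi => ?_
    have hix : i ≠ x := Finset.ne_of_mem_erase hi
    have hiS : i ∈ S := Finset.mem_of_mem_erase hi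
    set R := ∏ j ∈ (Finset.univ.erase x).erase i, (if j ∈ S then Q else 1) (r j) (c j) with hR
    have h1 : ∀ u, ∏ j ∈ Finset.univ.erase i,
        (if j ∈ S then Q else 1) (Function.update r x u j) (c j) = Q u (c x) * R := fun u => by
      rw [← Finset.mul_prod_erase (Finset.univ.erase i) _ (Finset.mem_erase.2
        ⟨hix.symm, Finset.mem_univ x⟩), if_pos hx, Function.update_self, hR, Finset.erase_right_comm]
      congr 1
      refine Finset.prod_congr rfl fun j hj => ?_
      rw [Function.update_of_ne (Finset.ne_of_mem_erase (Finset.mem_of_mem_erase hj))]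
    have h3 : ∀ T : Finset ι, (∀ j, j ≠ x → j ≠ i → (j ∈ T ↔ j ∈ S)) →
        entryProd T Q r (c ∘ swap x i) = (if x ∈ T then Q else 1) (r x) (c i) *
        ((if i ∈ T then Q else 1) (r i) (c x) * R) := fun T hT => by
      rw [entryProd_eq_mul_mul_erase T Q r _ hix, hR]
      simp only [Function.comp_apply, swap_apply_left, swap_apply_right]
      congr 2
      refine Finset.prod_congr rfl fun j hj => ?_
      have h4 := Finset.ne_of_mem_erase (Finset.mem_of_mem_erase hj)
      have h5 := Finset.ne_of_mem_erase hj
      rw [swap_apply_of_ne_of_ne h4 h5]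
      simp only [hT j h4 h5]
    rw [h3 S (fun _ _ _ => Iff.rfl), h3 (S.erase x) (fun j h _ => by simp [h]),
      h3 ((S.erase x).erase i) (fun j h h' => by simp [h, h'])]
    simp only [h1, Function.update_of_ne hix, hx, hiS, hix, if_true, Finset.mem_erase, ne_eq,
      not_true_eq_false, and_false, if_false, and_true, not_false_eq_true]
    -- In the factor at i, the HQ half exchanges the columns of x and i. The QH half closes the sum
    -- over u into an entry of Q², where `hQ` lowers the degree by one or two.
    have h6 : ∑ u, ((if u = r i then Q (r x) (c i) else 0) -
        (if r x = c i then Q (r i) u else 0)) * (Q u (c x) * R) =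
        (Q (r i) (c x) * Q (r x) (c i) - (if r x = c i then (Q * Q) (r i) (c x) else 0)) * R := by
      simp only [← mul_assoc, ← Finset.sum_mul, sub_mul, Finset.sum_sub_distrib]
      congr 2
      · simp only [ite_mul, zero_mul, Finset.sum_ite_eq', Finset.mem_univ, if_true]
        ring
      · split_ifs
        · rw [Matrix.mul_apply]
        · simp
    rw [h6, hQ]
    simp only [Matrix.add_apply, Matrix.smul_apply, smul_eq_mul, Matrix.one_apply]
    split_ifs <;> ring

theorem commDeriv_eq_sum (S : Finset ι) (Q H : Matrix d d ℂ) (r c : ι → d) :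
    commDeriv S Q H r c = ∑ i, (∏ j ∈ Finset.univ.erase i, (if j ∈ S then Q else 1) (r j) (c j)) •
      (if i ∈ S then (H * Q - Q * H) (r i) (c i) else 0) := by
  simp only [commDeriv, smul_eq_mul, mul_ite, mul_zero, Finset.sum_ite_mem, Finset.univ_inter]
  exact Finset.sum_congr rfl fun i _ => mul_comm _ _

end EntryProd

/-! ### Integration by parts for the Haar measure on the unitary group. -/

section Unitary
variable {ι d : Type*} [Fintype ι] [DecidableEq ι] [Fintype d] [DecidableEq d]

instance compactSpace_unitaryGroup : CompactSpace (Matrix.unitaryGroup d ℂ) := by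
  rw [← isCompact_univ_iff, Topology.IsInducing.subtypeVal.isCompact_iff, Set.image_univ,
    Subtype.range_coe]
  refine IsCompact.of_isClosed_subset (s := Set.univ.pi fun _ : d => Set.univ.pi fun _ : d =>
    Metric.closedBall (0 : ℂ) 1) ?_ ?_ ?_
  · exact isCompact_univ_pi fun _ => isCompact_univ_pi fun _ => isCompact_closedBall _ _
  · exact isClosed_unitary (R := Matrix d d ℂ)
  · intro U hU i _ j _
    simpa using entry_norm_bound_of_unitary hU i j

theorem continuous_unitary_val : Continuous fun U : Matrix.unitaryGroup d ℂ => U.1 :=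
  continuous_subtype_val

theorem continuous_conj (D : Matrix d d ℂ) :
    Continuous fun U : Matrix.unitaryGroup d ℂ => U.1 * D * (U.1)ᴴ :=
  (continuous_unitary_val.matrix_mul continuous_const).matrix_mul
    continuous_unitary_val.matrix_conjTranspose

theorem continuous_commDeriv (S : Finset ι) (H : Matrix d d ℂ) (r c : ι → d) :
    Continuous fun Q : Matrix d d ℂ => commDeriv S Q H r c := by
  refine continuous_finsetSum _ fun i _ => Continuous.mul ?_ ?_
  · exact ((continuous_const.matrix_mul continuous_id).sub
      (continuous_id.matrix_mul continuous_const)).matrix_elem _ _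
  · refine continuous_finsetProd _ fun i _ => ?_
    split_ifs
    · exact continuous_id.matrix_elem _ _
    · exact continuous_const

theorem integrable_of_continuous {μ : Measure (Matrix.unitaryGroup d ℂ)} [IsFiniteMeasure μ]
    {f : Matrix.unitaryGroup d ℂ → ℂ} (hf : Continuous f) : Integrable f μ :=
  hf.integrable_of_hasCompactSupport (HasCompactSupport.of_compactSpace f)

open scoped Matrix.Norms.L2Operator in
theorem hasDerivAt_conj_exp (H Q : Matrix d d ℂ) (hH : Hᴴ = -H) (t : ℝ) :
    HasDerivAt (fun s : ℝ => NormedSpace.exp (s • H) * Q * (NormedSpace.exp (s • H))ᴴ)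
      (H * (NormedSpace.exp (t • H) * Q * (NormedSpace.exp (t • H))ᴴ) -
        (NormedSpace.exp (t • H) * Q * (NormedSpace.exp (t • H))ᴴ) * H) t := by
  have h1 := hasDerivAt_exp_smul_const' (𝕂 := ℝ) H t
  have h2 := h1.star
  have h3 := (h1.mul_const Q).mul h2
  refine h3.congr_deriv ?_
  simp only [star_mul, Matrix.star_eq_conjTranspose, hH]
  noncomm_ring

open scoped Matrix.Norms.L2Operator in
theorem hasDerivAt_entryProd_conj (S : Finset ι) (r c : ι → d) (H Q : Matrix d d ℂ)
    (hH : Hᴴ = -H) (t : ℝ) :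
    HasDerivAt (fun s : ℝ =>
      entryProd S (NormedSpace.exp (s • H) * Q * (NormedSpace.exp (s • H))ᴴ) r c)
      (commDeriv S (NormedSpace.exp (t • H) * Q * (NormedSpace.exp (t • H))ᴴ) H r c) t := by
  rw [commDeriv_eq_sum]
  unfold entryProd
  refine HasDerivAt.fun_finsetProd fun i _ => ?_
  by_cases hi : i ∈ S
  · simp only [hi, if_true]
    have h := hasDerivAt_conj_exp H Q hH t
    exact ((Matrix.entryLinearMap ℝ ℂ (r i) (c i)).toContinuousLinearMap).hasFDerivAt.comp_hasDerivAt
      t h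
  · simp only [hi, if_false]
    exact hasDerivAt_const _ _

/-- For skew-Hermitian H the matrices exp(tH) are unitary. Left translation by them does not change
the integral of the entry product, and `commDeriv` is the derivative at t = 0 under the integral;
compactness provides the dominating constant. -/
theorem integral_commDeriv_of_skew {μ : Measure (Matrix.unitaryGroup d ℂ)} [IsFiniteMeasure μ]
    [μ.IsMulLeftInvariant] (S : Finset ι) (r c : ι → d) (H D : Matrix d d ℂ) (hH : Hᴴ = -H) :
    ∫ U, commDeriv S (U.1 * D * (U.1)ᴴ) H r c ∂μ = 0 := by
  have hmem : ∀ t : ℝ, NormedSpace.exp (t • H) ∈ Matrix.unitaryGroup d ℂ := by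
    open scoped Matrix.Norms.L2Operator in
    intro t
    let _ : NormedAlgebra ℚ (Matrix d d ℂ) := NormedAlgebra.restrictScalars ℚ ℂ (Matrix d d ℂ)
    refine NormedSpace.exp_mem_unitary_of_mem_skewAdjoint ?_
    rw [skewAdjoint.mem_iff, Matrix.star_eq_conjTranspose, Matrix.conjTranspose_smul, hH]
    simp
  let V : ℝ → Matrix.unitaryGroup d ℂ := fun t => ⟨_, hmem t⟩
  have hV : ∀ t (U : Matrix.unitaryGroup d ℂ), (V t * U).1 * D * ((V t * U).1)ᴴ =
      NormedSpace.exp (t • H) * (U.1 * D * (U.1)ᴴ) * (NormedSpace.exp (t • H))ᴴ := by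
    intro t U
    simp only [V, Submonoid.coe_mul, Matrix.conjTranspose_mul]
    noncomm_ring
  have hcont : Continuous fun U : Matrix.unitaryGroup d ℂ =>
      commDeriv S (U.1 * D * (U.1)ᴴ) H r c := (continuous_commDeriv S H r c).comp (continuous_conj D)
  obtain ⟨C, hC⟩ := (isCompact_range hcont).isBounded.exists_norm_le
  have hcont2 : Continuous fun U : Matrix.unitaryGroup d ℂ =>
      entryProd S (U.1 * D * (U.1)ᴴ) r c := (continuous_entryProd S r c).comp (continuous_conj D)
  have key := hasDerivAt_integral_of_dominated_loc_of_deriv_le (μ := μ) (𝕜 := ℝ) (x₀ := 0)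
    (F := fun t U => entryProd S ((V t * U).1 * D * ((V t * U).1)ᴴ) r c)
    (F' := fun t U => commDeriv S ((V t * U).1 * D * ((V t * U).1)ᴴ) H r c)
    (s := Set.univ) (bound := fun _ => C) Filter.univ_mem
    (Filter.Eventually.of_forall fun t =>
      (hcont2.comp (continuous_const_mul (V t))).aestronglyMeasurable)
    (integrable_of_continuous (hcont2.comp (continuous_const_mul (V 0))))
    (hcont.comp (continuous_const_mul (V 0))).aestronglyMeasurable
    (Filter.Eventually.of_forall fun U t _ => hC _ ⟨V t * U, rfl⟩)
    (integrable_const C)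
    (Filter.Eventually.of_forall fun U t _ => by
      simp only [hV]
      exact hasDerivAt_entryProd_conj S r c H _ hH t)
  have h1 := key.2
  simp only [integral_mul_left_eq_self
    (fun U : Matrix.unitaryGroup d ℂ => entryProd S (U.1 * D * (U.1)ᴴ) r c)] at h1
  have h2 := integral_mul_left_eq_self (μ := μ)
    (fun U : Matrix.unitaryGroup d ℂ => commDeriv S (U.1 * D * (U.1)ᴴ) H r c) (V 0)
  rw [← h2]
  exact h1.unique (hasDerivAt_const _ _)

theorem integral_neg_add_mul_add_mul {Θ : Type*} [MeasurableSpace Θ] {μ : Measure Θ}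
    {f g h : Θ → ℂ} (hf : Integrable f μ) (hg : Integrable g μ) (hh : Integrable h μ) (a b : ℂ) :
    ∫ U, (-f U + a * g U + b * h U) ∂μ = -(∫ U, f U ∂μ) + a * ∫ U, g U ∂μ + b * ∫ U, h U ∂μ := by
  rw [integral_add (f := fun U => -f U + a * g U) (hf.neg.add (hg.const_mul a)) (hh.const_mul b),
    integral_add (f := fun U => -f U) hf.neg (hg.const_mul a), integral_neg, integral_const_mul,
    integral_const_mul]

/-- Invariance of the Haar measure under conjugation, infinitesimally. -/
theorem integral_commDeriv {μ : Measure (Matrix.unitaryGroup d ℂ)} [IsFiniteMeasure μ]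
    [μ.IsMulLeftInvariant] (S : Finset ι) (r c : ι → d) (H D : Matrix d d ℂ) :
    ∫ U, commDeriv S (U.1 * D * (U.1)ᴴ) H r c ∂μ = 0 := by
  have hcont : ∀ K : Matrix d d ℂ, Integrable (fun U : Matrix.unitaryGroup d ℂ =>
      commDeriv S (U.1 * D * (U.1)ᴴ) K r c) μ := fun K =>
    integrable_of_continuous ((continuous_commDeriv S K r c).comp (continuous_conj D))
  -- `commDeriv` is complex linear in H, and every matrix is a complex combination of two
  -- skew-Hermitian ones.
  have hdec : H = (1 / 2 : ℂ) • (H - Hᴴ) + (-Complex.I) • ((Complex.I / 2) • (H + Hᴴ)) := by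
    rw [smul_smul, show -Complex.I * (Complex.I / 2) = 1 / 2 by
      rw [mul_div_assoc', neg_mul, Complex.I_mul_I, neg_neg], ← smul_add, sub_add_add_cancel,
      ← two_smul ℂ H, smul_smul]
    norm_num
  have h1 := integral_commDeriv_of_skew (μ := μ) S r c ((1 / 2 : ℂ) • (H - Hᴴ)) D (by
    rw [Matrix.conjTranspose_smul, Matrix.conjTranspose_sub, Matrix.conjTranspose_conjTranspose,
      ← smul_neg, neg_sub]
    congr 1
    simp)
  have h2 := integral_commDeriv_of_skew (μ := μ) S r c ((Complex.I / 2) • (H + Hᴴ)) D (by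
    rw [Matrix.conjTranspose_smul, Matrix.conjTranspose_add, Matrix.conjTranspose_conjTranspose,
      ← neg_smul, add_comm]
    congr 1
    simp [neg_div])
  rw [hdec]
  simp only [commDeriv_add, commDeriv_smul _ _ _ (-Complex.I)]
  rw [integral_add (hcont _) ((hcont _).const_mul _), integral_const_mul, h1, h2, mul_zero,
    add_zero]

/-- This is the integral of `sum_commDeriv`, whose left side has mean zero. The quadratic relation
and the vanishing trace pass from D to its unitary conjugates. -/
theorem loop_equation_entry {μ : Measure (Matrix.unitaryGroup d ℂ)} [IsFiniteMeasure μ]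
    [μ.IsMulLeftInvariant] (S : Finset ι) (D : Matrix d d ℂ) (a b : ℂ)
    (hD : D * D = a • D + b • 1) (htr : D.trace = 0) (r c : ι → d) {x : ι} (hx : x ∈ S) :
    Fintype.card d * ∫ U, entryProd S (U.1 * D * (U.1)ᴴ) r c ∂μ = ∑ i ∈ S.erase x,
      (-(∫ U, entryProd S (U.1 * D * (U.1)ᴴ) r (c ∘ swap x i) ∂μ)
        + a * ∫ U, entryProd (S.erase x) (U.1 * D * (U.1)ᴴ) r (c ∘ swap x i) ∂μ
        + b * ∫ U, entryProd ((S.erase x).erase i) (U.1 * D * (U.1)ᴴ) r (c ∘ swap x i) ∂μ) := by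
  have hint : ∀ T (r c : ι → d), Integrable (fun U : Matrix.unitaryGroup d ℂ =>
      entryProd T (U.1 * D * (U.1)ᴴ) r c) μ := fun T r c =>
    integrable_of_continuous ((continuous_entryProd T r c).comp (continuous_conj D))
  have hdet := fun U : Matrix.unitaryGroup d ℂ => by
    have hU : (U.1)ᴴ * U.1 = 1 := Matrix.mem_unitaryGroup_iff'.1 U.2
    have hU' : U.1 * (U.1)ᴴ = 1 := Matrix.mem_unitaryGroup_iff.1 U.2
    exact sum_commDeriv S (U.1 * D * (U.1)ᴴ) a b (by
      rw [show U.1 * D * (U.1)ᴴ * (U.1 * D * (U.1)ᴴ) = U.1 * D * ((U.1)ᴴ * U.1) * D * (U.1)ᴴ by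
        noncomm_ring, hU, mul_one, mul_assoc U.1 D D, hD, mul_add, add_mul, Matrix.mul_smul,
        Matrix.smul_mul, Matrix.mul_smul, Matrix.smul_mul, mul_one, hU'])
      (by rw [Matrix.trace_mul_comm, ← mul_assoc, hU, one_mul, htr]) r c hx
  have h1 : ∫ U : Matrix.unitaryGroup d ℂ, ∑ u, commDeriv S (U.1 * D * (U.1)ᴴ)
      (Matrix.single u (r x) 1) (Function.update r x u) c ∂μ = 0 := by
    rw [integral_finsetSum]
    · exact Finset.sum_eq_zero fun u _ => integral_commDeriv S _ c _ D
    · exact fun u _ => integrable_of_continuous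
        ((continuous_commDeriv S _ _ c).comp (continuous_conj D))
  simp only [hdet] at h1
  have hterm : ∀ i, Integrable (fun U : Matrix.unitaryGroup d ℂ =>
      -entryProd S (U.1 * D * (U.1)ᴴ) r (c ∘ swap x i)
        + a * entryProd (S.erase x) (U.1 * D * (U.1)ᴴ) r (c ∘ swap x i)
        + b * entryProd ((S.erase x).erase i) (U.1 * D * (U.1)ᴴ) r (c ∘ swap x i)) μ := fun i =>
    ((hint _ _ _).neg.add ((hint _ _ _).const_mul a)).add ((hint _ _ _).const_mul b)
  rw [integral_sub ((hint _ _ _).const_mul _) (integrable_finsetSum _ fun i _ => hterm i),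
    integral_const_mul, sub_eq_zero] at h1
  rw [h1, integral_finsetSum _ fun i _ => hterm i]
  refine Finset.sum_congr rfl fun i _ => ?_
  exact integral_neg_add_mul_add_mul (hint _ _ _) (hint _ _ _) (hint _ _ _) a b

end Unitary

/-! ### Contractions of tensor powers along pairs of permutations. -/

section Net
variable {ι m κ : Type*} [Fintype ι] [DecidableEq ι] [Fintype m] [DecidableEq m] [Fintype κ]
  [DecidableEq κ]

/-- The column multi-index obtained from the row multi-index `z` by permuting the first components
with `α` and the second ones with `β`. -/
def permCol (α β : Perm ι) (z : ι → m × κ) : ι → m × κ := fun i => ((z (α i)).1, (z (β i)).2)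

/-- The contraction of the tensor product of copies of `Q` (at the points of `S`) and of the
identity (elsewhere), along the permutations `α` (first components) and `β` (second components). -/
def net (S : Finset ι) (α β : Perm ι) (Q : Matrix (m × κ) (m × κ) ℂ) : ℂ :=
  ∑ z : ι → m × κ, entryProd S Q z (permCol α β z)

/-- Exchanging the columns of x and i multiplies α and β on the right by the same transposition.
Therefore α * β⁻¹ is conserved by the recursion. -/
theorem loop_equation {μ : Measure (Matrix.unitaryGroup (m × κ) ℂ)} [IsFiniteMeasure μ]
    [μ.IsMulLeftInvariant] (S : Finset ι) (D : Matrix (m × κ) (m × κ) ℂ) (a b : ℂ)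
    (hD : D * D = a • D + b • 1) (htr : D.trace = 0) (α β : Perm ι) {x : ι} (hx : x ∈ S) :
    Fintype.card (m × κ) * ∫ U, net S α β (U.1 * D * (U.1)ᴴ) ∂μ = ∑ i ∈ S.erase x,
      (-(∫ U, net S (α * swap x i) (β * swap x i) (U.1 * D * (U.1)ᴴ) ∂μ)
        + a * ∫ U, net (S.erase x) (α * swap x i) (β * swap x i) (U.1 * D * (U.1)ᴴ) ∂μ
        + b * ∫ U, net ((S.erase x).erase i) (α * swap x i) (β * swap x i)
          (U.1 * D * (U.1)ᴴ) ∂μ) := by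
  have hint : ∀ T (r c : ι → m × κ), Integrable (fun U : Matrix.unitaryGroup (m × κ) ℂ =>
      entryProd T (U.1 * D * (U.1)ᴴ) r c) μ := fun T r c =>
    integrable_of_continuous ((continuous_entryProd T r c).comp (continuous_conj D))
  simp only [net]
  simp only [integral_finsetSum _ fun (z : ι → m × κ) _ => hint _ z _]
  rw [Finset.mul_sum]
  simp only [loop_equation_entry (μ := μ) S D a b hD htr _ _ hx]
  rw [Finset.sum_comm]
  refine Finset.sum_congr rfl fun i _ => ?_
  rw [Finset.sum_add_distrib, Finset.sum_add_distrib, Finset.sum_neg_distrib, Finset.mul_sum,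
    Finset.mul_sum]
  rfl

/-- With identity factors only, the multi-indices that contribute have first components constant
along the cycles of α and second components constant along those of β. -/
theorem net_empty (α β : Perm ι) (Q : Matrix (m × κ) (m × κ) ℂ) :
    net ∅ α β Q =
      ((Fintype.card m : ℂ) ^ orbitCount α) * (Fintype.card κ : ℂ) ^ orbitCount β := by
  classical
  have h1 : ∀ z : ι → m × κ, entryProd ∅ Q z (permCol α β z) =
      if (∀ i, (z (α i)).1 = (z i).1) ∧ ∀ i, (z (β i)).2 = (z i).2 then 1 else 0 := fun z => by
    simp only [entryProd, Finset.notMem_empty, if_false, Matrix.one_apply]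
    rw [Finset.prod_ite_zero, Finset.prod_const_one]
    congr 1
    simp only [Finset.mem_univ, true_imp_iff, permCol, Prod.ext_iff, forall_and, eq_iff_iff]
    exact and_congr (forall_congr' fun i => eq_comm) (forall_congr' fun i => eq_comm)
  simp only [net, h1]
  rw [Finset.sum_boole, ← Nat.cast_pow, ← Nat.cast_pow, ← Nat.cast_mul, ← card_invariant α m,
    ← card_invariant β κ, ← Nat.card_prod, ← Fintype.card_subtype, ← Nat.card_eq_fintype_card]
  refine congrArg _ (Nat.card_congr
    { toFun := fun z => (⟨fun i => (z.1 i).1, z.2.1⟩, ⟨fun i => (z.1 i).2, z.2.2⟩)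
      invFun := fun p => ⟨fun i => (p.1.1 i, p.2.1 i), p.1.2, p.2.2⟩
      left_inv := fun z => rfl
      right_inv := fun p => rfl })

end Net

section NetSum
variable {ι ι' m κ : Type*} [Fintype ι] [DecidableEq ι] [Fintype ι'] [DecidableEq ι'] [Fintype m]
  [DecidableEq m] [Fintype κ] [DecidableEq κ]

/-- Products of traces become single contractions, so the same loop equation also governs
covariances. -/
theorem net_disjSum (S : Finset ι) (S' : Finset ι') (α β : Perm ι) (α' β' : Perm ι')
    (Q : Matrix (m × κ) (m × κ) ℂ) :
    net (S.disjSum S') (Perm.sumCongr α α') (Perm.sumCongr β β') Q = net S α β Q * net S' α' β' Q := by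
  rw [net, net, net, Finset.sum_mul_sum, ← Fintype.sum_prod_type',
    ← (Equiv.sumArrowEquivProdArrow ι ι' (m × κ)).symm.sum_comp]
  refine Finset.sum_congr rfl fun z _ => ?_
  simp only [entryProd, Fintype.prod_sum_type]
  congr 1 <;> exact Finset.prod_congr rfl fun i _ => by
    simp [permCol, Equiv.sumArrowEquivProdArrow]

end NetSum
end RandomChannel

namespace RandomChannel
open Equiv Equiv.Perm Asymptotics

/-! ### A priori bounds from approximate loop equations. -/

section Absorb
variable {ι : Type*} [Fintype ι] [DecidableEq ι]

/-- An upper bound for the solutions of an approximate loop equation in terms of its initial values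
and remainders. -/
theorem isBigO_of_loop (G : ℕ → Finset ι → Perm ι → Perm ι → ℂ)
    (R : ℕ → Finset ι → ι → Perm ι → Perm ι → ℂ) (e u v : ℕ → ℂ)
    (he : Tendsto e atTop (𝓝 0)) (hu : u =O[atTop] fun _ => (1 : ℝ))
    (hv : v =O[atTop] fun _ => (1 : ℝ))
    (hG : ∀ᶠ n in atTop, ∀ S α β, ∀ x ∈ S, G n S α β = ∑ i ∈ S.erase x,
      (-(e n * G n S (α * swap x i) (β * swap x i))
        + u n * G n (S.erase x) (α * swap x i) (β * swap x i)
        + v n * G n ((S.erase x).erase i) (α * swap x i) (β * swap x i)) + R n S x α β)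
    (h : ℕ → ℝ) (S₀ : Finset ι) (α β : Perm ι)
    (hbase : ∀ σ : Perm ι, (∀ z ∉ S₀, σ z = z) → (fun n => G n ∅ (α * σ) (β * σ)) =O[atTop] h)
    (hR : ∀ σ : Perm ι, (∀ z ∉ S₀, σ z = z) → ∀ S ⊆ S₀, ∀ x ∈ S,
      (fun n => R n S x (α * σ) (β * σ)) =O[atTop] h)
    (S : Finset ι) (hS : S ⊆ S₀) (σ : Perm ι) (hσ : ∀ z ∉ S₀, σ z = z) :
    (fun n => G n S (α * σ) (β * σ)) =O[atTop] h := by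
  classical
  induction hc : S.card using Nat.strong_induction_on generalizing S σ with
  | _ N ih =>
  rcases S.eq_empty_or_nonempty with rfl | ⟨x, hx⟩
  · exact hbase σ hσ
  have hswap : ∀ i ∈ S.erase x, ∀ z ∉ S₀, swap x i z = z := fun i hi z hz =>
    swap_apply_of_ne_of_ne (fun hzx => hz (hzx ▸ hS hx))
      (fun hzi => hz (hzi ▸ hS (Finset.mem_of_mem_erase hi)))
  let T : Finset (Perm ι) := Finset.univ.filter fun σ => ∀ z ∉ S₀, σ z = z
  have hT : ∀ σ, σ ∈ T ↔ ∀ z ∉ S₀, σ z = z := fun σ => by simp [T]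
  have hTs : ∀ σ ∈ T, ∀ i ∈ S.erase x, σ * swap x i ∈ T := fun σ hσ i hi => by
    rw [hT] at hσ ⊢
    intro z hz
    rw [mul_apply, hswap i hi z hz, hσ z hz]
  -- The terms with coefficient e keep the set S, so the induction on its size does not reach them.
  -- Summed over all σ supported in `S₀`, a family stable under the transpositions used, they
  -- contribute at most half of A for large n and are absorbed.
  let A : ℕ → ℝ := fun n => ∑ σ ∈ T, ‖G n S (α * σ) (β * σ)‖
  let L : ℕ → Perm ι → ℂ := fun n σ => ∑ i ∈ S.erase x,
    (u n * G n (S.erase x) (α * (σ * swap x i)) (β * (σ * swap x i))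
      + v n * G n ((S.erase x).erase i) (α * (σ * swap x i)) (β * (σ * swap x i)))
      + R n S x (α * σ) (β * σ)
  have hcard : (S.erase x).card < N := by
    rw [← hc]
    exact Finset.card_erase_lt_of_mem hx
  have hL : ∀ σ ∈ T, (fun n => L n σ) =O[atTop] h := fun σ hσ => by
    refine IsBigO.add (IsBigO.fun_sum fun i hi => ?_) (hR σ ((hT σ).1 hσ) S hS x hx)
    have h1 := ih _ hcard (S.erase x) ((Finset.erase_subset _ _).trans hS) (σ * swap x i)
      ((hT _).1 (hTs σ hσ i hi)) rfl
    have h2 := ih _ ((Finset.card_le_card (Finset.erase_subset i _)).trans_lt hcard)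
      ((S.erase x).erase i) (((Finset.erase_subset _ _).trans (Finset.erase_subset _ _)).trans hS)
      (σ * swap x i) ((hT _).1 (hTs σ hσ i hi)) rfl
    simpa using (hu.mul h1).add (hv.mul h2)
  have hLsum : (fun n => ∑ σ ∈ T, ‖L n σ‖) =O[atTop] h :=
    IsBigO.fun_sum fun σ hσ => (hL σ hσ).norm_left
  have hA : ∀ᶠ n in atTop, A n ≤ 2 * ∑ σ ∈ T, ‖L n σ‖ := by
    have he' : Tendsto (fun n => (T.card * (S.erase x).card : ℝ) * ‖e n‖) atTop (𝓝 0) := by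
      simpa using he.norm.const_mul (T.card * (S.erase x).card : ℝ)
    filter_upwards [hG, he'.eventually (gt_mem_nhds (show (0 : ℝ) < 1 / 2 by norm_num))]
      with n hn hen
    have hA0 : 0 ≤ A n := Finset.sum_nonneg fun _ _ => norm_nonneg _
    have h1 : ∀ σ ∈ T, ‖G n S (α * σ) (β * σ)‖ ≤
        (S.erase x).card * (‖e n‖ * A n) + ‖L n σ‖ := fun σ hσ => by
      have h2 : G n S (α * σ) (β * σ) =
          ∑ i ∈ S.erase x, (-(e n * G n S (α * (σ * swap x i)) (β * (σ * swap x i)))) + L n σ := by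
        rw [hn S _ _ x hx]
        simp only [L, mul_assoc, add_assoc, Finset.sum_add_distrib]
      rw [h2]
      refine (norm_add_le _ _).trans (add_le_add_left ?_ _)
      refine (norm_sum_le _ _).trans ?_
      rw [← nsmul_eq_mul]
      refine Finset.sum_le_card_nsmul _ _ _ fun i hi => ?_
      rw [norm_neg, norm_mul]
      refine mul_le_mul_of_nonneg_left ?_ (norm_nonneg _)
      exact Finset.single_le_sum (f := fun σ => ‖G n S (α * σ) (β * σ)‖)
        (fun _ _ => norm_nonneg _) (hTs σ hσ i hi)
    have h3 : A n ≤ (T.card * (S.erase x).card : ℝ) * ‖e n‖ * A n + ∑ σ ∈ T, ‖L n σ‖ := by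
      refine (Finset.sum_le_sum h1).trans ?_
      rw [Finset.sum_add_distrib, Finset.sum_const, nsmul_eq_mul]
      apply le_of_eq
      ring
    nlinarith
  have hAO : A =O[atTop] h := by
    refine IsBigO.trans (IsBigO.of_bound 2 ?_) hLsum
    filter_upwards [hA] with n hn
    rw [Real.norm_of_nonneg (Finset.sum_nonneg fun _ _ => norm_nonneg _),
      Real.norm_of_nonneg (Finset.sum_nonneg fun _ _ => norm_nonneg _)]
    exact hn
  refine IsBigO.trans (IsBigO.of_bound 1 (Eventually.of_forall fun n => ?_)) hAO
  rw [one_mul, Real.norm_of_nonneg (Finset.sum_nonneg fun _ _ => norm_nonneg _)]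
  exact Finset.single_le_sum (f := fun σ => ‖G n S (α * σ) (β * σ)‖)
        (fun _ _ => norm_nonneg _) ((hT σ).2 hσ)

end Absorb

/-- Conjugates by Haar unitaries of centered multiples of projections, in growing dimension. -/
structure HaarModel (c : ℝ) (k : ℕ → ℕ)
    (μ : (n : ℕ) → Measure (Matrix.unitaryGroup (Fin n × Fin (k n)) ℂ))
    (D : (n : ℕ) → Matrix (Fin n × Fin (k n)) (Fin n × Fin (k n)) ℂ) : Prop where
  pos : 0 < c
  tendsto : Tendsto (fun n => (k n : ℝ) / (n : ℝ)) atTop (𝓝 c)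
  isProbability : ∀ n, IsProbabilityMeasure (μ n)
  invariant : ∀ n, (μ n).IsMulLeftInvariant
  mul_self : ∀ n, D n * D n = (1 - 2 / (k n : ℂ)) • D n + (1 / (k n : ℂ) - 1 / (k n : ℂ) ^ 2) • 1
  trace_eq : ∀ n, (D n).trace = 0
  isHermitian : ∀ n, (D n).IsHermitian

/-! ### Order of magnitude of the rescaled contractions. -/

section Model
variable {c : ℝ} {k : ℕ → ℕ}
  {μ : (n : ℕ) → Measure (Matrix.unitaryGroup (Fin n × Fin (k n)) ℂ)}
  {D : (n : ℕ) → Matrix (Fin n × Fin (k n)) (Fin n × Fin (k n)) ℂ}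

/-- The coefficient of the loop equation which preserves the degree. -/
noncomputable def coefE (k : ℕ → ℕ) (n : ℕ) : ℂ := 1 / ((n : ℂ) * k n)

/-- The rescaled coefficient of the loop equation which lowers the degree by one. -/
noncomputable def coefU (k : ℕ → ℕ) (n : ℕ) : ℂ :=
  (1 - 2 / (k n : ℂ)) * ((√(n : ℝ) : ℝ) : ℂ) ^ 3 / ((n : ℂ) * k n)

/-- The rescaled coefficient of the loop equation which lowers the degree by two. -/
noncomputable def coefV (k : ℕ → ℕ) (n : ℕ) : ℂ :=
  (1 / (k n : ℂ) - 1 / (k n : ℂ) ^ 2) * ((√(n : ℝ) : ℝ) : ℂ) ^ 6 / ((n : ℂ) * k n)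

/-- The rescaled expectation of a contraction. -/
noncomputable def scaledNet (μ : (n : ℕ) → Measure (Matrix.unitaryGroup (Fin n × Fin (k n)) ℂ))
    (D : (n : ℕ) → Matrix (Fin n × Fin (k n)) (Fin n × Fin (k n)) ℂ)
    {ι : Type*} [Fintype ι] [DecidableEq ι] (n : ℕ) (S : Finset ι) (α β : Perm ι) : ℂ :=
  ((√(n : ℝ) : ℝ) : ℂ) ^ (3 * S.card) * ∫ U, net S α β (U.1 * D n * (U.1)ᴴ) ∂(μ n)

theorem sqrt_natCast_sq (n : ℕ) : (((√(n : ℝ) : ℝ) : ℂ)) ^ 2 = n := by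
  rw [← Complex.ofReal_pow, Real.sq_sqrt (Nat.cast_nonneg n), Complex.ofReal_natCast]

theorem isBigO_ofReal (f : ℕ → ℝ) : (fun n => (f n : ℂ)) =O[atTop] f :=
  IsBigO.of_bound 1 (Eventually.of_forall fun n => by simp)

namespace HaarModel

theorem tendsto_inv (M : HaarModel c k μ D) :
    Tendsto (fun n : ℕ => (n : ℂ) / (k n : ℂ)) atTop (𝓝 ((c : ℂ)⁻¹)) := by
  have h := (M.tendsto.inv₀ M.pos.ne')
  have h2 := (Complex.continuous_ofReal.tendsto (c⁻¹)).comp h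
  rw [Complex.ofReal_inv] at h2
  refine h2.congr fun n => ?_
  simp

theorem tendsto_k (M : HaarModel c k μ D) : Tendsto (fun n => (k n : ℝ)) atTop atTop := by
  have h := M.tendsto.pos_mul_atTop M.pos tendsto_natCast_atTop_atTop
  refine h.congr' ?_
  filter_upwards [eventually_gt_atTop 0] with n hn
  have : (n : ℝ) ≠ 0 := by positivity
  field_simp

theorem eventually_pos (M : HaarModel c k μ D) : ∀ᶠ n in atTop, 0 < n ∧ 0 < k n := by
  filter_upwards [eventually_gt_atTop 0, M.tendsto_k.eventually_gt_atTop 0] with n h1 h2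
  exact ⟨h1, by exact_mod_cast h2⟩

theorem tendsto_one_div_k (M : HaarModel c k μ D) :
    Tendsto (fun n => 1 / (k n : ℂ)) atTop (𝓝 0) := by
  have h2 := (Complex.continuous_ofReal.tendsto 0).comp M.tendsto_k.inv_tendsto_atTop
  rw [Complex.ofReal_zero] at h2
  refine h2.congr fun n => ?_
  simp

theorem isBigO_k (M : HaarModel c k μ D) : (fun n => (k n : ℂ)) =O[atTop] fun n => (n : ℝ) := by
  have h := M.tendsto.isBigO_one ℝ
  have h2 := h.mul (isBigO_refl (fun n : ℕ => (n : ℝ)) atTop)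
  simp only [one_mul] at h2
  have h3 : (fun n => (k n : ℝ)) =O[atTop] fun n => (n : ℝ) := by
    refine IsBigO.congr' h2 ?_ EventuallyEq.rfl
    filter_upwards [eventually_gt_atTop 0] with n hn
    have : (n : ℝ) ≠ 0 := by positivity
    field_simp
  simpa using (isBigO_ofReal fun n => (k n : ℝ)).trans h3

theorem isBigO_coefE (M : HaarModel c k μ D) :
    coefE k =O[atTop] fun n => ((n : ℝ) ^ 2)⁻¹ := by
  have h := (M.tendsto_inv.isBigO_one ℝ).mul
    (isBigO_ofReal fun n : ℕ => ((n : ℝ) ^ 2)⁻¹)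
  refine (h.congr' ?_ ?_)
  · filter_upwards [M.eventually_pos] with n hn
    have h1 : (n : ℂ) ≠ 0 := by exact_mod_cast hn.1.ne'
    have h2 : (k n : ℂ) ≠ 0 := by exact_mod_cast hn.2.ne'
    simp only [coefE]
    push_cast
    field_simp
  · exact Eventually.of_forall fun n => one_mul _

theorem tendsto_coefE (M : HaarModel c k μ D) : Tendsto (coefE k) atTop (𝓝 0) := by
  refine M.isBigO_coefE.trans_tendsto ?_
  exact ((tendsto_pow_atTop two_ne_zero).comp tendsto_natCast_atTop_atTop).inv_tendsto_atTop

theorem isBigO_coefU (M : HaarModel c k μ D) :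
    coefU k =O[atTop] fun n => (√(n : ℝ))⁻¹ := by
  have h0 : Tendsto (fun n => (1 - 2 * (1 / (k n : ℂ))) * ((n : ℂ) / k n)) atTop
      (𝓝 ((1 - 2 * 0) * (c : ℂ)⁻¹)) :=
    (tendsto_const_nhds.sub (M.tendsto_one_div_k.const_mul 2)).mul M.tendsto_inv
  have h := (h0.isBigO_one ℝ).mul
    (isBigO_ofReal fun n : ℕ => (√(n : ℝ))⁻¹)
  refine (h.congr' ?_ ?_)
  · filter_upwards [M.eventually_pos] with n hn
    have h1 : (n : ℂ) ≠ 0 := by exact_mod_cast hn.1.ne'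
    have h2 : (k n : ℂ) ≠ 0 := by exact_mod_cast hn.2.ne'
    have h3 : ((√(n : ℝ) : ℝ) : ℂ) ≠ 0 := by
      exact_mod_cast (Real.sqrt_pos.2 (by exact_mod_cast hn.1)).ne'
    have h4 : ((√(n : ℝ) : ℝ) : ℂ) ^ 3 = n * n * (((√(n : ℝ) : ℝ) : ℂ))⁻¹ := by
      rw [← sqrt_natCast_sq]
      field_simp
    simp only [coefU]
    rw [h4]
    push_cast
    field_simp
  · exact Eventually.of_forall fun n => one_mul _

theorem tendsto_coefV (M : HaarModel c k μ D) :
    Tendsto (coefV k) atTop (𝓝 (((c : ℂ) ^ 2)⁻¹)) := by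
  have h0 : Tendsto (fun n => (1 - (1 / (k n : ℂ))) * ((n : ℂ) / k n) ^ 2) atTop
      (𝓝 ((1 - 0) * (c : ℂ)⁻¹ ^ 2)) :=
    (tendsto_const_nhds.sub M.tendsto_one_div_k).mul (M.tendsto_inv.pow 2)
  rw [sub_zero, one_mul, inv_pow] at h0
  refine h0.congr' ?_
  filter_upwards [M.eventually_pos] with n hn
  have h1 : (n : ℂ) ≠ 0 := by exact_mod_cast hn.1.ne'
  have h2 : (k n : ℂ) ≠ 0 := by exact_mod_cast hn.2.ne'
  have h4 : ((√(n : ℝ) : ℝ) : ℂ) ^ 6 = n ^ 3 := by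
    rw [← sqrt_natCast_sq]
    ring
  simp only [coefV]
  rw [h4]
  field_simp

theorem isBigO_sqrt_inv : (fun n : ℕ => (√(n : ℝ))⁻¹) =O[atTop] fun _ => (1 : ℝ) :=
  ((Real.tendsto_sqrt_atTop.comp tendsto_natCast_atTop_atTop).inv_tendsto_atTop).isBigO_one ℝ

variable {ι : Type*} [Fintype ι] [DecidableEq ι]

/-- The weight n^{3/2} per copy is chosen so that the coefficient of the double deletion, b n³/(nk)
with b ~ 1/k, has the finite nonzero limit 1/c². The other two coefficients then tend to zero. -/
theorem scaledNet_loop (M : HaarModel c k μ D) :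
    ∀ᶠ n in atTop, ∀ (S : Finset ι) (α β : Perm ι), ∀ x ∈ S,
      scaledNet μ D n S α β = ∑ i ∈ S.erase x,
      (-(coefE k n * scaledNet μ D n S (α * swap x i) (β * swap x i))
        + coefU k n * scaledNet μ D n (S.erase x) (α * swap x i) (β * swap x i)
        + coefV k n * scaledNet μ D n ((S.erase x).erase i) (α * swap x i) (β * swap x i)) := by
  filter_upwards [M.eventually_pos] with n hn S α β x hx
  have := M.isProbability n
  have := M.invariant n
  have h := loop_equation (μ := μ n) S (D n) _ _ (M.mul_self n) (M.trace_eq n) α β hx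
  have h1 : (n : ℂ) ≠ 0 := by exact_mod_cast hn.1.ne'
  have h2 : (k n : ℂ) ≠ 0 := by exact_mod_cast hn.2.ne'
  have h3 : (Fintype.card (Fin n × Fin (k n)) : ℂ) = (n : ℂ) * k n := by simp
  rw [h3] at h
  have h4 : ∫ U, net S α β (U.1 * D n * (U.1)ᴴ) ∂(μ n) = coefE k n * ((n : ℂ) * k n *
      ∫ U, net S α β (U.1 * D n * (U.1)ᴴ) ∂(μ n)) := by
    rw [coefE]
    field_simp
  rw [scaledNet, h4, h, Finset.mul_sum, Finset.mul_sum]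
  refine Finset.sum_congr rfl fun i hi => ?_
  have h5 : 3 * S.card = 3 * (S.erase x).card + 3 := by
    rw [← Finset.card_erase_add_one hx]
    ring
  have h6 : 3 * S.card = 3 * ((S.erase x).erase i).card + 6 := by
    rw [h5, ← Finset.card_erase_add_one hi]
    ring
  simp only [scaledNet]
  rw [mul_add, mul_add, mul_add, mul_add]
  congr 1
  · congr 1
    · ring
    · rw [h5, coefU, coefE, pow_add]
      ring
  · rw [h6, coefV, coefE, pow_add]
    ring

theorem isBigO_scaledNet_empty (M : HaarModel c k μ D) (α β : Perm ι) {g : ℕ}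
    (hg : orbitCount α + orbitCount β ≤ g) :
    (fun n => scaledNet μ D n ∅ α β) =O[atTop] fun n => (n : ℝ) ^ g := by
  have h1 : ∀ n, scaledNet μ D n ∅ α β = (n : ℂ) ^ orbitCount α * (k n : ℂ) ^ orbitCount β := by
    intro n
    have := M.isProbability n
    simp [scaledNet, net_empty]
  simp only [h1]
  have h2 : (fun n : ℕ => (n : ℂ)) =O[atTop] fun n => (n : ℝ) :=
    IsBigO.of_bound 1 (Eventually.of_forall fun n => by simp)
  have h3 := (h2.pow (orbitCount α)).mul (M.isBigO_k.pow (orbitCount β))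
  refine h3.trans (IsBigO.of_bound 1 ?_)
  filter_upwards [eventually_ge_atTop 1] with n hn
  rw [← pow_add, one_mul, norm_pow, norm_pow]
  exact pow_le_pow_right₀ (by simpa using hn) hg

/-- Iterating the loop equation down to the empty set multiplies α and β only by permutations moving
points of S, so the worst of these final values bounds the contraction. -/
theorem isBigO_scaledNet (M : HaarModel c k μ D) (S : Finset ι) (α β : Perm ι) {g : ℕ}
    (hg : ∀ σ : Perm ι, (∀ z ∉ S, σ z = z) → orbitCount (α * σ) + orbitCount (β * σ) ≤ g) :
    (fun n => scaledNet μ D n S α β) =O[atTop] fun n => (n : ℝ) ^ g := by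
  have h := isBigO_of_loop (fun n S α β => scaledNet μ D n S α β) (fun _ _ _ _ _ => 0) (coefE k)
    (coefU k) (coefV k) M.tendsto_coefE (M.isBigO_coefU.trans isBigO_sqrt_inv)
    (M.tendsto_coefV.isBigO_one ℝ) (by simpa only [add_zero] using M.scaledNet_loop)
    (fun n => (n : ℝ) ^ g) S α β (fun σ hσ => M.isBigO_scaledNet_empty _ _ (hg σ hσ))
    (fun σ hσ S hS x hx => isBigO_zero _ _) S subset_rfl 1 (fun _ _ => rfl)
  simpa only [mul_one] using h

theorem isBigO_scaledNet_of_le (M : HaarModel c k μ D) (S : Finset ι) (α β : Perm ι) {g : ℕ}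
    (hg : Fintype.card ι + orbitCount (α * β⁻¹) ≤ g) :
    (fun n => scaledNet μ D n S α β) =O[atTop] fun n => (n : ℝ) ^ g := by
  refine M.isBigO_scaledNet S α β fun σ _ => le_trans (orbitCount_add_le _ _) ?_
  rwa [mul_inv_rev, mul_assoc, mul_inv_cancel_left]

/-- A deleted point z is fixed by every later σ, so the obstruction at z persists down to the empty
contraction and gains a factor n^{-2} there. -/
theorem isBigO_scaledNet_of_not_sameCycle (M : HaarModel c k μ D) (S : Finset ι) (α β : Perm ι)
    {g : ℕ} (hg : Fintype.card ι + orbitCount (α * β⁻¹) ≤ g + 2) (z : ι) (hz : z ∉ S)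
    (hz' : ¬ (α * β⁻¹).SameCycle (α z) z) :
    (fun n => scaledNet μ D n S α β) =O[atTop] fun n => (n : ℝ) ^ g := by
  refine M.isBigO_scaledNet S α β fun σ hσ => ?_
  have h1 : α * σ * (β * σ)⁻¹ = α * β⁻¹ := by rw [mul_inv_rev, mul_assoc, mul_inv_cancel_left]
  have h2 := orbitCount_add_two_le (α * σ) (β * σ) z (by rwa [h1, mul_apply, hσ z hz])
  rw [h1] at h2
  omega

end HaarModel
end Model
end RandomChannel

namespace RandomChannel
open Equiv Equiv.Perm Asymptotics

/-! ### Covariances of contractions. -/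

section Covariance

theorem disjSum_erase_inl {ι ι' : Type*} [DecidableEq ι] [DecidableEq ι'] (S : Finset ι)
    (S' : Finset ι') (x : ι) : (S.disjSum S').erase (Sum.inl x) = (S.erase x).disjSum S' := by
  ext y
  cases y <;> simp

theorem sumCongr_mul_swap_inl {ι ι' : Type*} [DecidableEq ι] [DecidableEq ι'] (α : Perm ι)
    (α' : Perm ι') (x i : ι) : Perm.sumCongr α α' * swap (Sum.inl x) (Sum.inl i) =
      Perm.sumCongr (α * swap x i) α' := by
  rw [← sumCongr_swap_one, sumCongr_mul, mul_one]

theorem not_sameCycle_sumCongr {ι ι' : Type*} (α : Perm ι) (α' : Perm ι') (x : ι) (y : ι') :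
    ¬ (Perm.sumCongr α α').SameCycle (Sum.inr y) (Sum.inl x) := fun h => by
  have := eq_of_sameCycle (f := Sum.isLeft) (fun i => by cases i <;> rfl) h
  simp at this

variable {c : ℝ} {k : ℕ → ℕ}
  {μ : (n : ℕ) → Measure (Matrix.unitaryGroup (Fin n × Fin (k n)) ℂ)}
  {D : (n : ℕ) → Matrix (Fin n × Fin (k n)) (Fin n × Fin (k n)) ℂ}
  {ι ι' : Type*} [Fintype ι] [DecidableEq ι] [Fintype ι'] [DecidableEq ι']

/-- The covariance of two contractions, up to scaling. -/
noncomputable def scaledCov (μ : (n : ℕ) → Measure (Matrix.unitaryGroup (Fin n × Fin (k n)) ℂ))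
    (D : (n : ℕ) → Matrix (Fin n × Fin (k n)) (Fin n × Fin (k n)) ℂ)
    (S' : Finset ι') (α' β' : Perm ι') (n : ℕ) (S : Finset ι) (α β : Perm ι) : ℂ :=
  scaledNet μ D n (S.disjSum S') (Perm.sumCongr α α') (Perm.sumCongr β β') -
    scaledNet μ D n S α β * scaledNet μ D n S' α' β'

/-- The terms of the loop equation which connect the two contractions. -/
noncomputable def crossTerm (μ : (n : ℕ) → Measure (Matrix.unitaryGroup (Fin n × Fin (k n)) ℂ))
    (D : (n : ℕ) → Matrix (Fin n × Fin (k n)) (Fin n × Fin (k n)) ℂ)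
    (S' : Finset ι') (α' β' : Perm ι') (n : ℕ) (S : Finset ι) (x : ι) (α β : Perm ι) : ℂ :=
  ∑ i ∈ S',
    (-(coefE k n * scaledNet μ D n (S.disjSum S')
      (Perm.sumCongr α α' * swap (Sum.inl x) (Sum.inr i))
      (Perm.sumCongr β β' * swap (Sum.inl x) (Sum.inr i)))
    + coefU k n * scaledNet μ D n ((S.erase x).disjSum S')
      (Perm.sumCongr α α' * swap (Sum.inl x) (Sum.inr i))
      (Perm.sumCongr β β' * swap (Sum.inl x) (Sum.inr i))
    + coefV k n * scaledNet μ D n (((S.erase x).disjSum S').erase (Sum.inr i))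
      (Perm.sumCongr α α' * swap (Sum.inl x) (Sum.inr i))
      (Perm.sumCongr β β' * swap (Sum.inl x) (Sum.inr i)))

/-- The loop equation of the joint contraction is applied at a point x of the first block. Partners
in the first block reproduce the loop equation of the covariance; partners in the second form the
remainder. -/
theorem HaarModel.scaledCov_loop (M : HaarModel c k μ D) (S' : Finset ι') (α' β' : Perm ι') :
    ∀ᶠ n in atTop, ∀ (S : Finset ι) (α β : Perm ι), ∀ x ∈ S,
      scaledCov μ D S' α' β' n S α β = ∑ i ∈ S.erase x,
      (-(coefE k n * scaledCov μ D S' α' β' n S (α * swap x i) (β * swap x i))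
        + coefU k n * scaledCov μ D S' α' β' n (S.erase x) (α * swap x i) (β * swap x i)
        + coefV k n * scaledCov μ D S' α' β' n ((S.erase x).erase i) (α * swap x i)
          (β * swap x i))
      + crossTerm μ D S' α' β' n S x α β := by
  filter_upwards [M.scaledNet_loop (ι := ι), M.scaledNet_loop (ι := ι ⊕ ι')] with n h1 h2 S α β x hx
  have h3 := h2 (S.disjSum S') (Perm.sumCongr α α') (Perm.sumCongr β β') (Sum.inl x) (by simpa using hx)
  rw [disjSum_erase_inl, Finset.sum_disjSum] at h3
  simp only [disjSum_erase_inl, sumCongr_mul_swap_inl] at h3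
  rw [scaledCov, h3, h1 S α β x hx, crossTerm, add_sub_right_comm]
  congr 1
  rw [Finset.sum_mul, ← Finset.sum_sub_distrib]
  refine Finset.sum_congr rfl fun i _ => ?_
  simp only [scaledCov]
  ring

theorem scaledCov_empty (hμ : ∀ n, IsProbabilityMeasure (μ n)) (S' : Finset ι') (α' β' : Perm ι')
    (n : ℕ) (α β : Perm ι) : scaledCov μ D S' α' β' n ∅ α β = 0 := by
  have := hμ n
  rw [scaledCov, scaledNet, scaledNet, scaledNet]
  simp only [net_disjSum, net_empty, Finset.card_disjSum, Finset.card_empty, integral_const,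
    integral_const_mul]
  simp
  ring

/-- The initial values vanish, since an empty contraction is deterministic. It remains to bound the
cross terms: a transposition joining the blocks sends x into the other block, where no cycle of the
conserved permutation returns to x. -/
theorem HaarModel.isBigO_scaledCov (M : HaarModel c k μ D) (S : Finset ι) (S' : Finset ι')
    (α β : Perm ι) (α' β' : Perm ι') {g : ℕ}
    (hg : Fintype.card ι + Fintype.card ι' +
      orbitCount (Perm.sumCongr (α * β⁻¹) (α' * β'⁻¹)) ≤ g + 2) :
    (fun n => scaledCov μ D S' α' β' n S α β) =O[atTop] fun n => (n : ℝ) ^ g := by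
  have h := isBigO_of_loop (scaledCov μ D S' α' β') (crossTerm μ D S' α' β') (coefE k)
    (coefU k) (coefV k) M.tendsto_coefE (M.isBigO_coefU.trans isBigO_sqrt_inv)
    (M.tendsto_coefV.isBigO_one ℝ) (M.scaledCov_loop S' α' β')
    (fun n => (n : ℝ) ^ g) S α β (fun σ hσ => ?_) ?_ S subset_rfl 1 (fun _ _ => rfl)
  · simpa only [mul_one] using h
  · simp only [scaledCov_empty M.isProbability]
    exact isBigO_zero _ _
  intro σ _ T hT x hx
  refine IsBigO.fun_sum fun i hi => ?_
  have hγ : ∀ τ, Perm.sumCongr (α * σ) α' * τ * (Perm.sumCongr (β * σ) β' * τ)⁻¹ =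
      Perm.sumCongr (α * β⁻¹) (α' * β'⁻¹) := fun τ => by
    rw [mul_inv_rev, mul_assoc, mul_inv_cancel_left, sumCongr_inv, sumCongr_mul, mul_inv_rev,
      mul_assoc, mul_inv_cancel_left]
  have h1 : ∀ (T : Finset (ι ⊕ ι')), Sum.inl x ∉ T →
      (fun n => scaledNet μ D n T (Perm.sumCongr (α * σ) α' * swap (Sum.inl x) (Sum.inr i))
      (Perm.sumCongr (β * σ) β' * swap (Sum.inl x) (Sum.inr i))) =O[atTop] fun n => (n : ℝ) ^ g := by
    intro T hT
    refine M.isBigO_scaledNet_of_not_sameCycle T _ _ ?_ (Sum.inl x) hT ?_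
    · rwa [hγ, Fintype.card_sum]
    · rw [hγ, mul_apply, swap_apply_left]
      exact not_sameCycle_sumCongr _ _ _ _
  -- No point is deleted here, so the contraction gains nothing; the missing n^{-2} comes from
  -- `coefE`.
  have h2 := M.isBigO_scaledNet_of_le (T.disjSum S')
    (Perm.sumCongr (α * σ) α' * swap (Sum.inl x) (Sum.inr i))
    (Perm.sumCongr (β * σ) β' * swap (Sum.inl x) (Sum.inr i)) (g := g + 2)
    (by rwa [hγ, Fintype.card_sum])
  have h3 : (fun n => coefE k n * scaledNet μ D n (T.disjSum S')
      (Perm.sumCongr (α * σ) α' * swap (Sum.inl x) (Sum.inr i))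
      (Perm.sumCongr (β * σ) β' * swap (Sum.inl x) (Sum.inr i))) =O[atTop]
      fun n => (n : ℝ) ^ g := by
    refine (M.isBigO_coefE.mul h2).congr' EventuallyEq.rfl ?_
    filter_upwards [eventually_gt_atTop 0] with n hn
    have : (n : ℝ) ≠ 0 := by positivity
    field_simp
    ring
  have h4 := ((M.isBigO_coefU.trans isBigO_sqrt_inv).mul (h1 ((T.erase x).disjSum S') (by simp)))
  have h5 := ((M.tendsto_coefV.isBigO_one ℝ).mul
    (h1 (((T.erase x).disjSum S').erase (Sum.inr i)) (by simp)))
  simp only [one_mul] at h4 h5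
  exact (h3.neg_left.add h4).add h5

end Covariance
end RandomChannel

namespace RandomChannel
open Equiv Equiv.Perm Asymptotics

/-! ### Traces of powers of realigned matrices as contractions. -/

section MatrixChain
variable {I : Type*} [Fintype I] [DecidableEq I]

/-- The ordered product `f 0 * f 1 * ⋯ * f (q - 1)`. -/
def orderedProd {R : Type*} [Monoid R] (f : ℕ → R) : ℕ → R
  | 0 => 1
  | q + 1 => orderedProd f q * f q

theorem orderedProd_add {R : Type*} [Monoid R] (f : ℕ → R) (a b : ℕ) :
    orderedProd f (a + b) = orderedProd f a * orderedProd (fun s => f (a + s)) b := by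
  induction b with
  | zero => simp [orderedProd]
  | succ b ih => rw [← add_assoc, orderedProd, orderedProd, ih, mul_assoc]

theorem orderedProd_const {R : Type*} [Monoid R] (f : ℕ → R) (x : R) (q : ℕ)
    (h : ∀ s < q, f s = x) : orderedProd f q = x ^ q := by
  induction q with
  | zero => simp [orderedProd]
  | succ q ih =>
    rw [orderedProd, ih fun s hs => h s (by omega), h q (by omega), pow_succ]

theorem orderedProd_apply (f : ℕ → Matrix I I ℂ) (q : ℕ) (a b : I) :
    orderedProd f (q + 1) a b = ∑ A : Fin q → I, ∏ s : Fin (q + 1),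
      f s (Fin.cons (α := fun _ => I) a A s) (Fin.snoc (α := fun _ => I) A b s) := by
  induction q generalizing b with
  | zero => simp [orderedProd, Fin.snoc]
  | succ q ih =>
    rw [orderedProd, Matrix.mul_apply, ← (Fin.snocEquiv fun _ => I).sum_comp,
      Fintype.sum_prod_type]
    refine Finset.sum_congr rfl fun e _ => ?_
    rw [ih, Finset.sum_mul]
    refine Finset.sum_congr rfl fun A _ => ?_
    rw [Fin.prod_univ_castSucc (n := q + 1)]
    simp only [Fin.snocEquiv, Equiv.coe_fn_mk]
    congr 1
    · refine Finset.prod_congr rfl fun s _ => ?_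
      rw [Fin.cons_snoc_eq_snoc_cons]
      simp
    · rw [Fin.cons_snoc_eq_snoc_cons]
      simp

theorem trace_orderedProd (f : ℕ → Matrix I I ℂ) (q : ℕ) :
    (orderedProd f (q + 1)).trace =
      ∑ A : Fin (q + 1) → I, ∏ s : Fin (q + 1), f s (A s) (A (s + 1)) := by
  rw [Matrix.trace, ← (Fin.consEquiv fun _ => I).sum_comp, Fintype.sum_prod_type]
  refine Finset.sum_congr rfl fun a _ => ?_
  rw [Matrix.diag_apply, orderedProd_apply]
  refine Finset.sum_congr rfl fun A _ => Finset.prod_congr rfl fun s _ => ?_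
  simp only [Fin.consEquiv, Equiv.coe_fn_mk]
  congr 1
  refine Fin.lastCases ?_ (fun i => ?_) s
  · rw [Fin.snoc_last, Fin.last_add_one, Fin.cons_zero]
  · rw [Fin.snoc_castSucc, Fin.coeSucc_eq_succ, Fin.cons_succ]

/-- The sum of E_{uv} C E_{vu} over u and v is tr(C) times the identity: this is how a pair of
deleted factors splits one trace into two. -/
theorem sum_trace_single_mul {K : Type*} [Fintype K] [DecidableEq K] (C : Matrix K K ℂ)
    (G : Matrix I I ℂ) :
    ∑ u : I, ∑ v : K, (Matrix.single u v (1 : ℂ) * C * Matrix.single v u (1 : ℂ) * G).trace = C.trace * G.trace := by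
  have h : ∀ u v, (Matrix.single u v (1 : ℂ) * C * Matrix.single v u (1 : ℂ) * G).trace = C v v * G u u := by
    intro u v
    rw [Matrix.single_mul_mul_single, Matrix.trace_mul_comm]
    simp [Matrix.trace_mul_single, mul_comm]
  simp only [h, ← Finset.sum_mul, ← Finset.mul_sum]
  rfl

end MatrixChain

section Chain
variable {J m κ : Type*}

/-- The involution of `J × Bool` which exchanges `(s, true)` and `(ρ s, false)`. -/
def chainPerm (ρ : Perm J) : Perm (J × Bool) where
  toFun x := if x.2 then (ρ x.1, false) else (ρ.symm x.1, true)
  invFun x := if x.2 then (ρ x.1, false) else (ρ.symm x.1, true)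
  left_inv x := by rcases x with ⟨s, _ | _⟩ <;> simp
  right_inv x := by rcases x with ⟨s, _ | _⟩ <;> simp

theorem chainPerm_false (ρ : Perm J) (s : J) : chainPerm ρ (s, false) = (ρ.symm s, true) := rfl

/-- The realignment of a matrix on a tensor product. -/
def realign (Q : Matrix (m × κ) (m × κ) ℂ) : Matrix (m × m) (κ × κ) ℂ :=
  Matrix.of fun a l => Q (a.1, l.1) (a.2, l.2)

/-- The realignment of the adjoint, as the adjoint of a realignment. -/
def realignAdj (Q : Matrix (m × κ) (m × κ) ℂ) : Matrix (κ × κ) (m × m) ℂ :=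
  Matrix.of fun l a => Q (a.2, l.2) (a.1, l.1)

theorem realign_conjTranspose {Q : Matrix (m × κ) (m × κ) ℂ} (hQ : Q.IsHermitian) :
    (realign Q)ᴴ = realignAdj Q := by
  ext l a
  simp only [Matrix.conjTranspose_apply, realign, realignAdj, Matrix.of_apply]
  exact hQ.apply _ _

/-- Reindexing of the multi-indices of a chain by the indices of the realigned matrices. -/
def chainIndex (ρ : Perm J) : (J → m × m) × (J → κ × κ) ≃ (J × Bool → m × κ) where
  toFun p x := if x.2 then ((p.1 (ρ x.1)).2, (p.2 x.1).2) else ((p.1 x.1).1, (p.2 x.1).1)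
  invFun z := (fun s => ((z (s, false)).1, (z (ρ.symm s, true)).1),
    fun s => ((z (s, false)).2, (z (s, true)).2))
  left_inv p := by simp
  right_inv z := by
    ext ⟨s, _ | _⟩ <;> simp

theorem permCol_chainIndex_false (ρ : Perm J) (p : (J → m × m) × (J → κ × κ)) (s : J) :
    permCol (chainPerm ρ) (chainPerm 1) (chainIndex ρ p) (s, false) =
      ((p.1 s).2, (p.2 s).2) := by
  simp [permCol, chainIndex, chainPerm]
  rfl

theorem permCol_chainIndex_true (ρ : Perm J) (p : (J → m × m) × (J → κ × κ)) (s : J) :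
    permCol (chainPerm ρ) (chainPerm 1) (chainIndex ρ p) (s, true) =
      ((p.1 (ρ s)).1, (p.2 s).1) := by
  simp [permCol, chainIndex, chainPerm]

variable [Fintype J] [DecidableEq J] [Fintype m] [DecidableEq m] [Fintype κ]
  [DecidableEq κ]

theorem sum_prod_mul_apply (ρ : Perm J) {I K : Type*} [Fintype I] [Fintype K]
    (X : J → Matrix I K ℂ) (Y : J → Matrix K I ℂ) :
    ∑ p : (J → I) × (J → K), ∏ s, X s (p.1 s) (p.2 s) * Y s (p.2 s) (p.1 (ρ s)) =
      ∑ A : J → I, ∏ s, (X s * Y s) (A s) (A (ρ s)) := by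
  rw [Fintype.sum_prod_type]
  refine Finset.sum_congr rfl fun A _ => ?_
  simp only [Matrix.mul_apply]
  rw [Finset.prod_univ_sum, Fintype.piFinset_univ]

/-- The indexing makes the factor at (s, false) an entry of `realign Q` in position (A_s, L_s), and
the factor at (s, true) an entry of `realignAdj Q` in position (L_s, A_{ρ s}). -/
theorem net_chain_univ (ρ : Perm J) (Q : Matrix (m × κ) (m × κ) ℂ) :
    net Finset.univ (chainPerm ρ) (chainPerm 1) Q =
      ∑ A : J → m × m, ∏ s, (realign Q * realignAdj Q) (A s) (A (ρ s)) := by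
  rw [← sum_prod_mul_apply, net, ← (chainIndex ρ).sum_comp]
  refine Finset.sum_congr rfl fun p _ => ?_
  rw [entryProd, Fintype.prod_prod_type]
  refine Finset.prod_congr rfl fun s _ => ?_
  rw [Fintype.prod_bool, permCol_chainIndex_false, permCol_chainIndex_true, mul_comm]
  simp [realign, realignAdj, chainIndex]

theorem net_chain_erase (ρ : Perm J) (Q : Matrix (m × κ) (m × κ) ℂ) (s₀ t : J) :
    net ((Finset.univ.erase (s₀, false)).erase (t, true))
      (chainPerm ρ * swap (s₀, false) (t, true)) (chainPerm 1 * swap (s₀, false) (t, true)) Q =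
      ∑ u, ∑ v, ∑ A : J → m × m, ∏ s, ((if s = s₀ then Matrix.single u v 1 else realign Q) *
        (if s = t then Matrix.single v u 1 else realignAdj Q)) (A s) (A (ρ s)) := by
  simp only [← sum_prod_mul_apply]
  rw [Finset.sum_congr rfl fun u _ => Finset.sum_comm, Finset.sum_comm, net,
    ← (chainIndex ρ).sum_comp]
  refine Finset.sum_congr rfl fun p _ => ?_
  have h1 : ∀ u v, ∏ s, (if s = s₀ then Matrix.single u v 1 else realign Q) (p.1 s) (p.2 s) *
      (if s = t then Matrix.single v u 1 else realignAdj Q) (p.2 s) (p.1 (ρ s)) =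
      (Matrix.single u v (1 : ℂ) (p.1 s₀) (p.2 s₀) *
        Matrix.single v u (1 : ℂ) (p.2 t) (p.1 (ρ t))) *
      ((∏ s ∈ Finset.univ.erase s₀, realign Q (p.1 s) (p.2 s)) *
      ∏ s ∈ Finset.univ.erase t, realignAdj Q (p.2 s) (p.1 (ρ s))) := by
    intro u v
    rw [Finset.prod_mul_distrib, ← Finset.mul_prod_erase Finset.univ _ (Finset.mem_univ s₀),
      ← Finset.mul_prod_erase Finset.univ (fun s => (if s = t then Matrix.single v u 1 else
        realignAdj Q) (p.2 s) (p.1 (ρ s))) (Finset.mem_univ t), if_pos rfl, if_pos rfl,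
      mul_mul_mul_comm]
    congr 2 <;> refine Finset.prod_congr rfl fun s hs => ?_ <;>
      rw [if_neg (Finset.ne_of_mem_erase hs)]
  simp only [h1, ← Finset.sum_mul]
  -- After the exchange of columns, the two deleted factors impose A_{s₀} = A_{ρ t} and L_{s₀} =
  -- L_t. The matrix units, summed over u and v, impose exactly the same.
  have h2 : ∑ u, ∑ v, Matrix.single u v (1 : ℂ) (p.1 s₀) (p.2 s₀) *
        Matrix.single v u (1 : ℂ) (p.2 t) (p.1 (ρ t)) =
      if p.1 s₀ = p.1 (ρ t) ∧ p.2 s₀ = p.2 t then 1 else 0 := by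
    rw [Finset.sum_eq_single (p.1 s₀), Finset.sum_eq_single (p.2 s₀)]
    · simp [Matrix.single_apply, and_comm]
    · intro v _ hv
      simp [Matrix.single_apply, hv]
    · simp
    · intro u _ hu
      simp [Matrix.single_apply, hu]
    · simp
  have hne : ((s₀, false) : J × Bool) ≠ (t, true) := by simp
  rw [h2, entryProd_eq_mul_mul_erase _ _ _ _ hne.symm, ← mul_assoc]
  have hcol : permCol (chainPerm ρ * swap (s₀, false) (t, true))
      (chainPerm 1 * swap (s₀, false) (t, true)) (chainIndex ρ p) =
      permCol (chainPerm ρ) (chainPerm 1) (chainIndex ρ p) ∘ swap (s₀, false) (t, true) := rfl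
  rw [hcol]
  congr 1
  · simp only [Function.comp_apply, swap_apply_left, swap_apply_right, permCol_chainIndex_false,
      permCol_chainIndex_true]
    simp [Matrix.one_apply, chainIndex, Prod.ext_iff]
    split_ifs <;> simp_all
  · have h3 : (Finset.univ.erase ((s₀, false) : J × Bool)).erase (t, true) =
        (Finset.univ.erase s₀).map (Function.Embedding.sectL J false) ∪
        (Finset.univ.erase t).map (Function.Embedding.sectL J true) := by
      ext ⟨s, _ | _⟩ <;> simp [eq_comm]
    rw [h3, Finset.prod_union, Finset.prod_map, Finset.prod_map]
    · congr 1 <;> refine Finset.prod_congr rfl fun s hs => ?_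
      all_goals
        have hs := Finset.ne_of_mem_erase hs
        rw [if_pos (by simp [hs])]
        simp only [Function.Embedding.sectL_apply, Function.comp_apply]
        rw [swap_apply_of_ne_of_ne (by simp [hs]) (by simp [hs])]
        first | rw [permCol_chainIndex_false] | rw [permCol_chainIndex_true]
        simp [realign, realignAdj, chainIndex]
    · rw [Finset.disjoint_left]
      rintro ⟨s, _ | _⟩ <;> simp

/-- The cyclic shift. -/
def shift (q : ℕ) : Perm (Fin (q + 1)) := Equiv.addRight 1

theorem net_shift_univ (q : ℕ) (Q : Matrix (m × κ) (m × κ) ℂ) :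
    net Finset.univ (chainPerm (shift q)) (chainPerm 1) Q =
      ((realign Q * realignAdj Q) ^ (q + 1)).trace := by
  rw [net_chain_univ, ← orderedProd_const (fun _ => realign Q * realignAdj Q) _ (q + 1)
    (fun _ _ => rfl), trace_orderedProd]
  rfl

theorem mul_pow_mul_eq {R : Type*} {I K : Type*} [Fintype I] [Fintype K] [DecidableEq I]
    [DecidableEq K] [Semiring R] (X : Matrix I K R) (Y : Matrix K I R) (j : ℕ) :
    Y * (X * Y) ^ j * X = (Y * X) ^ (j + 1) := by
  induction j with
  | zero => simp
  | succ j ih => rw [pow_succ _ (j + 1), ← ih, pow_succ]; simp only [Matrix.mul_assoc]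

/-- Deleting the factor at (0, false) and the one at (t, true) cuts the cyclic word into an inner
piece, which starts with the adjoint, and an outer piece made of the remaining q - t pairs. -/
theorem net_shift_erase (q : ℕ) (Q : Matrix (m × κ) (m × κ) ℂ) (t : Fin (q + 1)) :
    net ((Finset.univ.erase (0, false)).erase (t, true))
      (chainPerm (shift q) * swap (0, false) (t, true)) (chainPerm 1 * swap (0, false) (t, true)) Q =
      ((realignAdj Q * realign Q) ^ (t : ℕ)).trace *
        ((realign Q * realignAdj Q) ^ (q - t)).trace := by
  rw [net_chain_erase, ← sum_trace_single_mul]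
  refine Finset.sum_congr rfl fun u _ => Finset.sum_congr rfl fun v _ => ?_
  let f : ℕ → Matrix (m × m) (m × m) ℂ := fun s =>
    (if s = 0 then Matrix.single u v 1 else realign Q) *
      (if s = (t : ℕ) then Matrix.single v u 1 else realignAdj Q)
  have h1 := trace_orderedProd f q
  have h2 : ∑ A : Fin (q + 1) → m × m, ∏ s : Fin (q + 1),
      ((if s = 0 then Matrix.single u v 1 else realign Q) *
        (if s = t then Matrix.single v u 1 else realignAdj Q) : Matrix (m × m) (m × m) ℂ)
        (A s) (A (shift q s)) =
      ∑ A : Fin (q + 1) → m × m, ∏ s : Fin (q + 1), f s (A s) (A (s + 1)) := by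
    refine Finset.sum_congr rfl fun A _ => Finset.prod_congr rfl fun s _ => ?_
    simp only [f, Fin.val_eq_zero_iff, Fin.val_inj]
    rfl
  rw [h2, ← h1]
  congr 1
  obtain ⟨t, ht⟩ := t
  have h3 : q + 1 = (t + 1) + (q - t) := by omega
  simp only at *
  rw [h3, orderedProd_add]
  congr 1
  · cases t with
    | zero => simp [orderedProd, f]
    | succ t =>
      rw [orderedProd, add_comm t 1, orderedProd_add, orderedProd_const (fun s => f (1 + s))
        (realign Q * realignAdj Q) t]
      · simp only [orderedProd, f, one_mul]
        rw [if_pos trivial, if_neg (by omega), if_neg (by omega), if_pos (by omega),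
          add_comm 1 t, ← mul_pow_mul_eq]
        simp only [Matrix.mul_assoc]
      · intro s hs
        simp only [f]
        rw [if_neg (by omega), if_neg (by omega)]
  · refine orderedProd_const _ _ _ fun s hs => ?_
    simp only [f]
    rw [if_neg (by omega), if_neg (by omega)]

end Chain
end RandomChannel

namespace RandomChannel
open Equiv Equiv.Perm Asymptotics

/-! ### Orbits attached to cyclic words. -/

section ShiftOrbits

theorem orbitCount_le_card {ι B : Type*} [Finite ι] [Fintype B] (σ : Perm ι) (f : ι → B)
    (h : ∀ x y, f x = f y → σ.SameCycle x y) : orbitCount σ ≤ Fintype.card B := by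
  rw [orbitCount, ← Nat.card_eq_fintype_card]
  refine Nat.card_le_card_of_injective
    (fun q : Quotient (SameCycle.setoid σ) => f q.out) fun q q' hq => ?_
  rw [← Quotient.out_eq q, ← Quotient.out_eq q']
  exact Quotient.sound (s := SameCycle.setoid σ) (h _ _ hq)

theorem chain_mul_false {J : Type*} (ρ : Perm J) (s : J) :
    (chainPerm ρ * (chainPerm 1)⁻¹ : Perm (J × Bool)) (s, false) = (ρ s, false) := rfl

theorem chain_mul_true {J : Type*} (ρ : Perm J) (s : J) :
    (chainPerm ρ * (chainPerm 1)⁻¹ : Perm (J × Bool)) (s, true) = (ρ.symm s, true) := rfl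

theorem not_sameCycle_chain {J : Type*} (ρ : Perm J) (s t : J) :
    ¬ (chainPerm ρ * (chainPerm 1)⁻¹).SameCycle (s, true) (t, false) := fun h => by
  have := eq_of_sameCycle (f := Prod.snd) (fun i => by rcases i with ⟨i, _ | _⟩ <;> rfl) h
  simp at this

theorem sameCycle_shift (q : ℕ) (s : Fin (q + 1)) (b : Bool) :
    (chainPerm (shift q) * (chainPerm 1)⁻¹).SameCycle (0, b) (s, b) := by
  have hs : Fin.ofNat (q + 1) s.val = s := by
    ext
    simp
  rw [← hs]
  generalize s.val = j
  have hstep : ∀ j : ℕ, Fin.ofNat (q + 1) (j + 1) = shift q (Fin.ofNat (q + 1) j) := fun j => by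
    ext
    simp [shift, Fin.val_add, Nat.add_mod]
  cases b with
  | false =>
    refine ⟨j, ?_⟩
    rw [zpow_natCast]
    induction j with
    | zero => simp
    | succ j ih => rw [pow_succ', mul_apply, ih, chain_mul_false, hstep]
  | true =>
    refine SameCycle.symm ⟨j, ?_⟩
    rw [zpow_natCast]
    induction j with
    | zero => simp
    | succ j ih =>
      rw [pow_succ, mul_apply, chain_mul_true, hstep, Equiv.symm_apply_apply, ih]

/-- The permutation acts as the shift on one copy of the cycle and as its inverse on the other. This
yields the leading exponent 2(q + 1) + 2 = 2q + 4. -/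
theorem orbitCount_shift_le (q : ℕ) :
    orbitCount (chainPerm (shift q) * (chainPerm 1)⁻¹) ≤ 2 := by
  refine orbitCount_le_card _ Prod.snd ?_
  rintro ⟨x, b⟩ ⟨y, b'⟩ h
  obtain rfl : b = b' := h
  exact (sameCycle_shift q x b).symm.trans (sameCycle_shift q y b)

theorem SameCycle.sumCongr_inl {ι ι' : Type*} (α : Perm ι) (α' : Perm ι') {x y : ι}
    (h : α.SameCycle x y) : (Perm.sumCongr α α').SameCycle (Sum.inl x) (Sum.inl y) := by
  obtain ⟨j, rfl⟩ := h
  refine ⟨j, ?_⟩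
  have : Perm.sumCongr α α' ^ j = Perm.sumCongr (α ^ j) (α' ^ j) :=
    ((sumCongrHom ι ι').map_zpow (α, α') j).symm
  rw [this]
  rfl

theorem SameCycle.sumCongr_inr {ι ι' : Type*} (α : Perm ι) (α' : Perm ι') {x y : ι'}
    (h : α'.SameCycle x y) : (Perm.sumCongr α α').SameCycle (Sum.inr x) (Sum.inr y) := by
  obtain ⟨j, rfl⟩ := h
  refine ⟨j, ?_⟩
  have : Perm.sumCongr α α' ^ j = Perm.sumCongr (α ^ j) (α' ^ j) :=
    ((sumCongrHom ι ι').map_zpow (α, α') j).symm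
  rw [this]
  rfl

theorem orbitCount_sumCongr_shift_le (q q' : ℕ) :
    orbitCount (Perm.sumCongr (chainPerm (shift q) * (chainPerm 1)⁻¹)
      (chainPerm (shift q') * (chainPerm 1)⁻¹)) ≤ 4 := by
  refine orbitCount_le_card _ (Sum.map Prod.snd Prod.snd) ?_
  rintro (⟨x, b⟩ | ⟨x, b⟩) (⟨y, b'⟩ | ⟨y, b'⟩) h
  · obtain rfl : b = b' := by simpa using h
    exact SameCycle.sumCongr_inl _ _ ((sameCycle_shift q x b).symm.trans (sameCycle_shift q y b))
  · simp at h
  · simp at h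
  · obtain rfl : b = b' := by simpa using h
    exact SameCycle.sumCongr_inr _ _ ((sameCycle_shift q' x b).symm.trans (sameCycle_shift q' y b))

end ShiftOrbits

/-! ### Means, variances and almost sure limits of the normalized traces. -/

section Moments
variable {c : ℝ} {k : ℕ → ℕ}
  {μ : (n : ℕ) → Measure (Matrix.unitaryGroup (Fin n × Fin (k n)) ℂ)}
  {D : (n : ℕ) → Matrix (Fin n × Fin (k n)) (Fin n × Fin (k n)) ℂ}

/-- In the loop equation at (0, false), only the double deletions of (0, false) and some (t, true)
have leading order. The other coefficients are O(n^{-1/2}), and deleting (0, false) with (t, false)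
loses n^{-2}, as the image of (0, false) then lies in the other copy of the cycle. -/
theorem HaarModel.isBigO_shift_remainder (M : HaarModel c k μ D) (q : ℕ) :
    (fun n => scaledNet μ D n Finset.univ (chainPerm (shift q)) (chainPerm 1) -
      ∑ t : Fin (q + 1), coefV k n * scaledNet μ D n
        ((Finset.univ.erase (0, false)).erase (t, true))
        (chainPerm (shift q) * swap (0, false) (t, true))
        (chainPerm 1 * swap (0, false) (t, true))) =O[atTop]
      fun n => (√(n : ℝ))⁻¹ * (n : ℝ) ^ (2 * q + 4) := by
  let g : ℕ → Fin (q + 1) × Bool → ℂ := fun n i =>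
    -(coefE k n * scaledNet μ D n Finset.univ (chainPerm (shift q) * swap (0, false) i)
        (chainPerm 1 * swap (0, false) i))
      + coefU k n * scaledNet μ D n (Finset.univ.erase (0, false))
        (chainPerm (shift q) * swap (0, false) i) (chainPerm 1 * swap (0, false) i)
  let g' : ℕ → Fin (q + 1) × Bool → ℂ := fun n i =>
    coefV k n * scaledNet μ D n ((Finset.univ.erase (0, false)).erase i)
        (chainPerm (shift q) * swap (0, false) i) (chainPerm 1 * swap (0, false) i)
  have hsplit : ∀ f : Fin (q + 1) × Bool → ℂ, ∑ i ∈ Finset.univ.erase (0, false), f i =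
      ∑ t, f (t, true) + ∑ t ∈ Finset.univ.erase 0, f (t, false) := fun f => by
    have h1 := Finset.add_sum_erase Finset.univ f (Finset.mem_univ ((0 : Fin (q + 1)), false))
    have h2 := Finset.add_sum_erase Finset.univ (fun t => f (t, false))
      (Finset.mem_univ (0 : Fin (q + 1)))
    rw [Fintype.sum_prod_type] at h1
    simp only [Fintype.sum_bool, Finset.sum_add_distrib] at h1
    rw [← h2] at h1
    linear_combination h1
  have hγ : ∀ τ, chainPerm (shift q) * τ * (chainPerm 1 * τ)⁻¹ =
      chainPerm (shift q) * (chainPerm 1)⁻¹ := fun τ => by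
    rw [mul_inv_rev, mul_assoc, mul_inv_cancel_left]
  have hcard : Fintype.card (Fin (q + 1) × Bool) +
      orbitCount (chainPerm (shift q) * (chainPerm 1)⁻¹) ≤ 2 * q + 4 := by
    have := orbitCount_shift_le q
    simp only [Fintype.card_prod, Fintype.card_fin, Fintype.card_bool]
    omega
  have hsq : (fun n : ℕ => ((n : ℝ) ^ 2)⁻¹) =O[atTop] fun n => (√(n : ℝ))⁻¹ := by
    refine IsBigO.of_bound 1 ?_
    filter_upwards [eventually_ge_atTop 1] with n hn
    have hn' : (1 : ℝ) ≤ n := by exact_mod_cast hn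
    rw [one_mul, Real.norm_of_nonneg (by positivity), Real.norm_of_nonneg (by positivity)]
    refine inv_anti₀ (Real.sqrt_pos.2 (by linarith)) ?_
    rw [Real.sqrt_le_left (by positivity)]
    nlinarith [sq_nonneg ((n : ℝ)^2 - n), mul_nonneg (by linarith : (0:ℝ) ≤ n - 1) (sq_nonneg (n:ℝ)), sq_nonneg ((n:ℝ)^2)]
  have hg : ∀ i, (fun n => g n i) =O[atTop] fun n => (√(n : ℝ))⁻¹ * (n : ℝ) ^ (2 * q + 4) := by
    intro i
    have h1 := M.isBigO_scaledNet_of_le Finset.univ (chainPerm (shift q) * swap (0, false) i)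
      (chainPerm 1 * swap (0, false) i) (g := 2 * q + 4) (by rwa [hγ])
    have h2 := M.isBigO_scaledNet_of_le (Finset.univ.erase (0, false))
      (chainPerm (shift q) * swap (0, false) i)
      (chainPerm 1 * swap (0, false) i) (g := 2 * q + 4) (by rwa [hγ])
    exact ((M.isBigO_coefE.trans hsq).mul h1).neg_left.add (M.isBigO_coefU.mul h2)
  have hg' : ∀ t, (fun n => g' n (t, false)) =O[atTop]
      fun n => (√(n : ℝ))⁻¹ * (n : ℝ) ^ (2 * q + 4) := by
    intro t
    have h1 := M.isBigO_scaledNet_of_not_sameCycle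
      ((Finset.univ.erase (0, false)).erase (t, false))
      (chainPerm (shift q) * swap (0, false) (t, false))
      (chainPerm 1 * swap (0, false) (t, false)) (g := 2 * q + 2)
      (by rw [hγ]; exact hcard) (0, false) (by simp)
      (by
        rw [hγ, mul_apply, swap_apply_left, chainPerm_false]
        exact not_sameCycle_chain _ _ _)
    refine ((M.tendsto_coefV.isBigO_one ℝ).mul h1).trans ?_
    have h2 := hsq.mul (isBigO_refl (fun n : ℕ => (n : ℝ) ^ (2 * q + 4)) atTop)
    refine h2.congr' ?_ EventuallyEq.rfl
    filter_upwards [eventually_gt_atTop 0] with n hn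
    have : (n : ℝ) ≠ 0 := by positivity
    field_simp
    ring
  have hmain : (fun n => (∑ t, g n (t, true)) + ∑ t ∈ Finset.univ.erase 0,
      (g n (t, false) + g' n (t, false))) =O[atTop]
      fun n => (√(n : ℝ))⁻¹ * (n : ℝ) ^ (2 * q + 4) :=
    (IsBigO.fun_sum fun t _ => hg (t, true)).add
      (IsBigO.fun_sum fun t _ => (hg (t, false)).add (hg' t))
  refine hmain.congr' ?_ EventuallyEq.rfl
  filter_upwards [M.scaledNet_loop (ι := Fin (q + 1) × Bool)] with n hn
  rw [hn Finset.univ _ _ (0, false) (Finset.mem_univ _), hsplit, Finset.sum_add_distrib,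
    Finset.sum_add_distrib, Finset.sum_add_distrib]
  simp only [g', Finset.sum_add_distrib]
  ring

/-- The normalized trace of a power of the rescaled realigned matrix. -/
noncomputable def normTrace (c : ℝ) {n l : ℕ} (p : ℕ) (Q : Matrix (Fin n × Fin l) (Fin n × Fin l) ℂ) :
    ℂ :=
  1 / (n : ℂ) ^ 2 * ((((c : ℂ) ^ 2 * n) • (realign Q * realignAdj Q)) ^ p).trace

theorem trace_mul_comm_pow {I K : Type*} [Fintype I] [Fintype K] [DecidableEq I] [DecidableEq K]
    (X : Matrix I K ℂ) (Y : Matrix K I ℂ) (t : ℕ) (ht : t ≠ 0) :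
    ((Y * X) ^ t).trace = ((X * Y) ^ t).trace := by
  obtain ⟨j, rfl⟩ := Nat.exists_eq_succ_of_ne_zero ht
  rw [Nat.succ_eq_add_one, ← mul_pow_mul_eq, Matrix.trace_mul_comm, ← Matrix.mul_assoc, pow_succ']

theorem normTrace_eq (c : ℝ) {n l : ℕ} (p : ℕ) (Q : Matrix (Fin n × Fin l) (Fin n × Fin l) ℂ) :
    normTrace c p Q = ((c : ℂ) ^ 2 * n) ^ p / (n : ℂ) ^ 2 *
      ((realign Q * realignAdj Q) ^ p).trace := by
  rw [normTrace, smul_pow, Matrix.trace_smul, smul_eq_mul]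
  ring

theorem normTrace_zero (c : ℝ) {n l : ℕ} (hn : 0 < n)
    (Q : Matrix (Fin n × Fin l) (Fin n × Fin l) ℂ) : normTrace c 0 Q = 1 := by
  have : (n : ℂ) ≠ 0 := by exact_mod_cast hn.ne'
  rw [normTrace_eq, pow_zero, pow_zero, Matrix.trace_one]
  simp only [Fintype.card_prod, Fintype.card_fin, Nat.cast_mul]
  field_simp

theorem continuous_realign {n l : ℕ} :
    Continuous fun Q : Matrix (Fin n × Fin l) (Fin n × Fin l) ℂ => realign Q :=
  continuous_matrix fun _ _ => continuous_id.matrix_elem _ _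

theorem continuous_realignAdj {n l : ℕ} :
    Continuous fun Q : Matrix (Fin n × Fin l) (Fin n × Fin l) ℂ => realignAdj Q :=
  continuous_matrix fun _ _ => continuous_id.matrix_elem _ _

theorem continuous_normTrace (c : ℝ) (n l p : ℕ) :
    Continuous fun Q : Matrix (Fin n × Fin l) (Fin n × Fin l) ℂ => normTrace c p Q := by
  have h : Continuous fun Q : Matrix (Fin n × Fin l) (Fin n × Fin l) ℂ =>
      ((c : ℂ) ^ 2 * n) • (realign Q * realignAdj Q) :=
    (continuous_realign.matrix_mul continuous_realignAdj).const_smul ((c : ℂ) ^ 2 * n)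
  exact continuous_const.mul (h.pow p).matrix_trace

theorem star_normTrace (c : ℝ) {n l : ℕ} (p : ℕ)
    {Q : Matrix (Fin n × Fin l) (Fin n × Fin l) ℂ} (hQ : Q.IsHermitian) :
    (starRingEnd ℂ) (normTrace c p Q) = normTrace c p Q := by
  have h : (((c : ℂ) ^ 2 * n) • (realign Q * realignAdj Q)).IsHermitian := by
    rw [← realign_conjTranspose hQ]
    refine Matrix.IsHermitian.smul (Matrix.isHermitian_mul_conjTranspose_self _) ?_
    simp [IsSelfAdjoint]
  have h2 := h.pow p
  rw [normTrace, map_mul, starRingEnd_apply (Matrix.trace _), ← Matrix.trace_conjTranspose, h2]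
  simp

/-- The expectation of `normTrace`. -/
noncomputable def meanTrace (μ : (n : ℕ) → Measure (Matrix.unitaryGroup (Fin n × Fin (k n)) ℂ))
    (D : (n : ℕ) → Matrix (Fin n × Fin (k n)) (Fin n × Fin (k n)) ℂ) (c : ℝ) (p n : ℕ) : ℂ :=
  ∫ U, normTrace c p (U.1 * D n * (U.1)ᴴ) ∂(μ n)

/-- The expectation of a product of two values of `normTrace`. -/
noncomputable def meanTraceMul (μ : (n : ℕ) → Measure (Matrix.unitaryGroup (Fin n × Fin (k n)) ℂ))
    (D : (n : ℕ) → Matrix (Fin n × Fin (k n)) (Fin n × Fin (k n)) ℂ) (c : ℝ) (p p' n : ℕ) : ℂ :=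
  ∫ U, normTrace c p (U.1 * D n * (U.1)ᴴ) * normTrace c p' (U.1 * D n * (U.1)ᴴ) ∂(μ n)

theorem sqrt_natCast_pow (n q : ℕ) : ((√(n : ℝ) : ℝ) : ℂ) ^ (2 * q) = (n : ℂ) ^ q := by
  rw [pow_mul, sqrt_natCast_sq]

theorem meanTrace_succ (q : ℕ) {n : ℕ} (hn : 0 < n) :
    meanTrace μ D c (q + 1) n = (c : ℂ) ^ (2 * (q + 1)) / (n : ℂ) ^ (2 * q + 4) *
      scaledNet μ D n Finset.univ (chainPerm (shift q)) (chainPerm 1) := by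
  have h1 : (n : ℂ) ≠ 0 := by exact_mod_cast hn.ne'
  simp only [meanTrace, normTrace_eq, scaledNet, net_shift_univ]
  rw [integral_const_mul, ← mul_assoc]
  congr 1
  have h2 : 3 * (Finset.univ : Finset (Fin (q + 1) × Bool)).card = 2 * (3 * (q + 1)) := by
    simp only [Finset.card_univ, Fintype.card_prod, Fintype.card_fin, Fintype.card_bool]
    ring
  rw [h2, sqrt_natCast_pow]
  field_simp
  ring

theorem meanTraceMul_succ (q q' : ℕ) {n : ℕ} (hn : 0 < n) :
    meanTraceMul μ D c (q + 1) (q' + 1) n =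
      (c : ℂ) ^ (2 * (q + 1)) / (n : ℂ) ^ (2 * q + 4) *
      ((c : ℂ) ^ (2 * (q' + 1)) / (n : ℂ) ^ (2 * q' + 4)) *
      scaledNet μ D n (Finset.univ.disjSum Finset.univ)
        (Perm.sumCongr (chainPerm (shift q)) (chainPerm (shift q')))
        (Perm.sumCongr (chainPerm 1) (chainPerm 1)) := by
  have h1 : (n : ℂ) ≠ 0 := by exact_mod_cast hn.ne'
  simp only [meanTraceMul, normTrace_eq, scaledNet, net_disjSum, net_shift_univ]
  simp only [mul_mul_mul_comm _ (Matrix.trace _)]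
  rw [integral_const_mul, ← mul_assoc]
  congr 1
  have h2 : 3 * ((Finset.univ : Finset (Fin (q + 1) × Bool)).disjSum
      (Finset.univ : Finset (Fin (q' + 1) × Bool))).card = 2 * (3 * (q + 1) + 3 * (q' + 1)) := by
    simp only [Finset.card_disjSum, Finset.card_univ, Fintype.card_prod, Fintype.card_fin,
      Fintype.card_bool]
    ring
  rw [h2, sqrt_natCast_pow]
  field_simp
  ring

/-- For t = 0 the inner trace is that of the identity of size k², not n². The resulting ratio (k/n)²
→ c² is where the parameter of the limit law enters. -/
theorem scaledNet_shift_erase (hc : 0 < c) (q : ℕ) (t : Fin (q + 1)) {n : ℕ} (hn : 0 < n) :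
    (c : ℂ) ^ (2 * (q + 1)) / (n : ℂ) ^ (2 * q + 4) *
      scaledNet μ D n ((Finset.univ.erase (0, false)).erase (t, true))
        (chainPerm (shift q) * swap (0, false) (t, true))
        (chainPerm 1 * swap (0, false) (t, true)) =
      (c : ℂ) ^ 2 * ((if (t : ℕ) = 0 then ((k n : ℂ) / n) ^ 2 else 1) *
        meanTraceMul μ D c t (q - t) n) := by
  have h1 : (n : ℂ) ≠ 0 := by exact_mod_cast hn.ne'
  have h0 : (c : ℂ) ≠ 0 := by exact_mod_cast hc.ne'
  have h2 : 3 * (((Finset.univ : Finset (Fin (q + 1) × Bool)).erase (0, false)).erase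
      (t, true)).card = 2 * (3 * q) := by
    rw [Finset.card_erase_of_mem (by simp), Finset.card_erase_of_mem (by simp)]
    simp only [Finset.card_univ, Fintype.card_prod, Fintype.card_fin, Fintype.card_bool]
    omega
  have h3 : ∀ Q : Matrix (Fin n × Fin (k n)) (Fin n × Fin (k n)) ℂ,
      ((realignAdj Q * realign Q) ^ (t : ℕ)).trace * ((realign Q * realignAdj Q) ^ (q - t)).trace =
      ((if (t : ℕ) = 0 then ((k n : ℂ) / n) ^ 2 else 1) * (n : ℂ) ^ 4 / ((c : ℂ) ^ 2 * n) ^ q) *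
        (normTrace c t Q * normTrace c (q - t) Q) := fun Q => by
    have h4 : ((c : ℂ) ^ 2 * n) ^ q = ((c : ℂ) ^ 2 * n) ^ (t : ℕ) * ((c : ℂ) ^ 2 * n) ^ (q - t) := by
      rw [← pow_add]
      congr 1
      omega
    rw [h4, normTrace_eq c (q - t)]
    split_ifs with ht
    · rw [ht, normTrace_zero c hn, pow_zero, Matrix.trace_one]
      simp only [Fintype.card_prod, Fintype.card_fin, Nat.cast_mul]
      field_simp
    · rw [trace_mul_comm_pow _ _ _ ht, normTrace_eq c t]
      field_simp
  rw [scaledNet, h2, sqrt_natCast_pow]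
  simp only [net_shift_erase, h3]
  rw [integral_const_mul, meanTraceMul]
  simp only [← mul_assoc]
  congr 1
  field_simp
  ring

/-- Two cyclic words have at most four orbits, so `isBigO_scaledCov` gives the exponent 2q + 2q' +
6, against the normalization 2q + 2q' + 8. -/
theorem HaarModel.isBigO_covariance (M : HaarModel c k μ D) (p p' : ℕ) :
    (fun n => meanTraceMul μ D c p p' n - meanTrace μ D c p n * meanTrace μ D c p' n)
      =O[atTop] fun n => ((n : ℝ) ^ 2)⁻¹ := by
  have hzero : ∀ f : ℕ → ℂ, (∀ᶠ n in atTop, f n = 0) →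
      f =O[atTop] fun n => ((n : ℝ) ^ 2)⁻¹ := fun f hf =>
    (isBigO_zero _ _).congr' (hf.mono fun n hn => hn.symm) EventuallyEq.rfl
  rcases p with _ | q
  · refine hzero _ ?_
    filter_upwards [M.eventually_pos] with n hn
    have := M.isProbability n
    simp [meanTraceMul, meanTrace, normTrace_zero c hn.1]
  rcases p' with _ | q'
  · refine hzero _ ?_
    filter_upwards [M.eventually_pos] with n hn
    have := M.isProbability n
    simp [meanTraceMul, meanTrace, normTrace_zero c hn.1]
  have h := M.isBigO_scaledCov (Finset.univ : Finset (Fin (q + 1) × Bool))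
    (Finset.univ : Finset (Fin (q' + 1) × Bool)) (chainPerm (shift q)) (chainPerm 1)
    (chainPerm (shift q')) (chainPerm 1) (g := 2 * q + 2 * q' + 6) (by
      have := orbitCount_sumCongr_shift_le q q'
      simp only [Fintype.card_prod, Fintype.card_fin, Fintype.card_bool]
      omega)
  have h2 := ((h.mul (isBigO_ofReal fun n : ℕ => ((n : ℝ) ^ (2 * q + 2 * q' + 8))⁻¹))).const_mul_left
    ((c : ℂ) ^ (2 * (q + 1)) * (c : ℂ) ^ (2 * (q' + 1)))
  refine h2.congr' ?_ ?_
  · filter_upwards [M.eventually_pos] with n hn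
    have h1 : (n : ℂ) ≠ 0 := by exact_mod_cast hn.1.ne'
    rw [meanTraceMul_succ q q' hn.1, meanTrace_succ q hn.1, meanTrace_succ q' hn.1, scaledCov]
    push_cast
    field_simp
    ring
  · filter_upwards [M.eventually_pos] with n hn
    have h1 : (n : ℝ) ≠ 0 := by exact_mod_cast hn.1.ne'
    field_simp
    ring

theorem HaarModel.tendsto_meanTrace_recursion (M : HaarModel c k μ D) (q : ℕ) :
    Tendsto (fun n => meanTrace μ D c (q + 1) n - ∑ t : Fin (q + 1), (c : ℂ) ^ 2 * coefV k n *
      ((if (t : ℕ) = 0 then ((k n : ℂ) / n) ^ 2 else 1) * meanTraceMul μ D c t (q - t) n))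
      atTop (𝓝 0) := by
  have h := ((M.isBigO_shift_remainder q).mul
    (isBigO_ofReal fun n : ℕ => ((n : ℝ) ^ (2 * q + 4))⁻¹)).const_mul_left ((c : ℂ) ^ (2 * (q + 1)))
  have h2 : Tendsto (fun n : ℕ => (√(n : ℝ))⁻¹ * (n : ℝ) ^ (2 * q + 4) *
      ((n : ℝ) ^ (2 * q + 4))⁻¹) atTop (𝓝 0) := by
    refine Tendsto.congr' ?_
      (Real.tendsto_sqrt_atTop.comp tendsto_natCast_atTop_atTop).inv_tendsto_atTop
    filter_upwards [M.eventually_pos] with n hn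
    have h1 : (n : ℝ) ≠ 0 := by exact_mod_cast hn.1.ne'
    rw [mul_assoc, mul_inv_cancel₀ (pow_ne_zero _ h1), mul_one]
    rfl
  refine (h.trans_tendsto h2).congr' ?_
  filter_upwards [M.eventually_pos] with n hn
  rw [meanTrace_succ q hn.1]
  have h3 : ∀ t : Fin (q + 1), (c : ℂ) ^ 2 * coefV k n *
      ((if (t : ℕ) = 0 then ((k n : ℂ) / n) ^ 2 else 1) * meanTraceMul μ D c t (q - t) n) =
      (c : ℂ) ^ (2 * (q + 1)) / (n : ℂ) ^ (2 * q + 4) * (coefV k n *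
        scaledNet μ D n ((Finset.univ.erase (0, false)).erase (t, true))
        (chainPerm (shift q) * swap (0, false) (t, true))
        (chainPerm 1 * swap (0, false) (t, true))) := fun t => by
    rw [mul_left_comm _ (coefV k n), scaledNet_shift_erase M.pos q t hn.1]
    ring
  simp only [h3, ← Finset.mul_sum]
  push_cast
  ring

theorem HaarModel.tendsto_k_div (M : HaarModel c k μ D) :
    Tendsto (fun n : ℕ => (k n : ℂ) / n) atTop (𝓝 (c : ℂ)) := by
  have h2 := (Complex.continuous_ofReal.tendsto c).comp M.tendsto
  exact h2.congr fun n => by simp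

/-- The mean normalized traces converge to the solution of the Marchenko–Pastur recursion. -/
theorem HaarModel.tendsto_meanTrace (M : HaarModel c k μ D) (m : ℕ → ℝ) (hm₀ : m 0 = 1)
    (hm : ∀ q, m (q + 1) = ∑ t : Fin (q + 1), (if (t : ℕ) = 0 then c ^ 2 else m t) * m (q - t))
    (p : ℕ) : Tendsto (meanTrace μ D c p) atTop (𝓝 (m p : ℂ)) := by
  induction p using Nat.strong_induction_on with
  | _ p ih =>
  rcases p with _ | q
  · rw [hm₀]
    refine tendsto_const_nhds.congr' ?_
    filter_upwards [M.eventually_pos] with n hn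
    have := M.isProbability n
    simp [meanTrace, normTrace_zero c hn.1]
  have hinv : Tendsto (fun n : ℕ => ((n : ℝ) ^ 2)⁻¹) atTop (𝓝 0) :=
    ((tendsto_pow_atTop two_ne_zero).comp tendsto_natCast_atTop_atTop).inv_tendsto_atTop
  -- The covariance tends to zero, so the mean of the product has the limit of the product of means,
  -- known by induction.
  have h1 : ∀ t : Fin (q + 1), Tendsto (fun n => meanTraceMul μ D c t (q - t) n) atTop
      (𝓝 ((m t : ℂ) * m (q - t))) := fun t => by
    have h2 := (ih t (by omega)).mul (ih (q - t) (by omega))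
    have h3 := (M.isBigO_covariance t (q - t)).trans_tendsto hinv
    simpa using h3.add h2
  have hc : (c : ℂ) ≠ 0 := by exact_mod_cast M.pos.ne'
  have h4 : Tendsto (fun n => ∑ t : Fin (q + 1), (c : ℂ) ^ 2 * coefV k n *
      ((if (t : ℕ) = 0 then ((k n : ℂ) / n) ^ 2 else 1) * meanTraceMul μ D c t (q - t) n)) atTop
      (𝓝 (∑ t : Fin (q + 1), (c : ℂ) ^ 2 * ((c : ℂ) ^ 2)⁻¹ *
        ((if (t : ℕ) = 0 then (c : ℂ) ^ 2 else 1) * ((m t : ℂ) * m (q - t))))) := by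
    refine tendsto_finsetSum _ fun t _ => (M.tendsto_coefV.const_mul _).mul (Tendsto.mul ?_ (h1 t))
    split_ifs
    · exact M.tendsto_k_div.pow 2
    · exact tendsto_const_nhds
  have h5 := (M.tendsto_meanTrace_recursion q).add h4
  simp only [sub_add_cancel, zero_add] at h5
  convert h5 using 2
  rw [hm]
  push_cast
  refine Finset.sum_congr rfl fun t _ => ?_
  rw [mul_inv_cancel₀ (pow_ne_zero _ hc), one_mul]
  split_ifs with ht
  · rw [ht, hm₀]
    simp
  · simp

theorem isHermitian_conj {d : Type*} [Fintype d] [DecidableEq d] (U : Matrix d d ℂ)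
    {A : Matrix d d ℂ} (hA : A.IsHermitian) : (U * A * Uᴴ).IsHermitian :=
  Matrix.isHermitian_mul_mul_conjTranspose U hA

/-- Normalized traces are real because the matrices are Hermitian, so the mean square deviation is
the covariance of the trace with itself, of order n^{-2}. -/
theorem HaarModel.summable_variance (M : HaarModel c k μ D) (p : ℕ) :
    Summable fun n => ∫ U, ‖normTrace c p (U.1 * D n * (U.1)ᴴ) - meanTrace μ D c p n‖ ^ 2 ∂(μ n) := by
  refine summable_of_isBigO_nat (Real.summable_nat_pow_inv.2 one_lt_two) ?_
  refine ((M.isBigO_covariance p p).norm_left).congr_left fun n => ?_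
  have := M.isProbability n
  have hcont : Continuous fun U : Matrix.unitaryGroup (Fin n × Fin (k n)) ℂ =>
      normTrace c p (U.1 * D n * (U.1)ᴴ) := (continuous_normTrace c n (k n) p).comp
        (continuous_conj (D n))
  have hmul : Continuous fun U : Matrix.unitaryGroup (Fin n × Fin (k n)) ℂ =>
      normTrace c p (U.1 * D n * (U.1)ᴴ) * normTrace c p (U.1 * D n * (U.1)ᴴ) := hcont.mul hcont
  have hstar : ∀ U : Matrix.unitaryGroup (Fin n × Fin (k n)) ℂ,
      (starRingEnd ℂ) (normTrace c p (U.1 * D n * (U.1)ᴴ)) = normTrace c p (U.1 * D n * (U.1)ᴴ) :=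
    fun U => star_normTrace c p (isHermitian_conj _ (M.isHermitian n))
  have hstar2 : (starRingEnd ℂ) (meanTrace μ D c p n) = meanTrace μ D c p n := by
    rw [meanTrace, ← integral_conj]
    simp only [hstar]
  have h1 : ((∫ U, ‖normTrace c p (U.1 * D n * (U.1)ᴴ) - meanTrace μ D c p n‖ ^ 2 ∂(μ n) : ℝ) : ℂ) =
      meanTraceMul μ D c p p n - meanTrace μ D c p n * meanTrace μ D c p n := by
    rw [← integral_complex_ofReal]
    have h2 : ∀ U : Matrix.unitaryGroup (Fin n × Fin (k n)) ℂ,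
        ((‖normTrace c p (U.1 * D n * (U.1)ᴴ) - meanTrace μ D c p n‖ ^ 2 : ℝ) : ℂ) =
        -(2 * meanTrace μ D c p n * normTrace c p (U.1 * D n * (U.1)ᴴ)) +
        1 * (normTrace c p (U.1 * D n * (U.1)ᴴ) * normTrace c p (U.1 * D n * (U.1)ᴴ)) +
        meanTrace μ D c p n * meanTrace μ D c p n * 1 := fun U => by
      rw [Complex.ofReal_pow, ← Complex.mul_conj', map_sub, hstar, hstar2]
      ring
    simp only [h2]
    rw [integral_neg_add_mul_add_mul ((integrable_of_continuous hcont).const_mul _)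
      (integrable_of_continuous hmul) (integrable_const 1), integral_const_mul,
      integral_const]
    simp only [meanTraceMul, probReal_univ, one_smul]
    rw [← meanTrace]
    ring
  rw [← h1, Complex.norm_real, Real.norm_of_nonneg (integral_nonneg fun _ => by positivity)]

/-- By Tonelli the series of the functions is almost surely finite; no independence is involved. -/
theorem ae_tendsto_zero_of_summable_integral {Ω : Type*} [MeasurableSpace Ω] {P : Measure Ω}
    {f : ℕ → Ω → ℝ} (hf : ∀ n, Integrable (f n) P) (h0 : ∀ n ω, 0 ≤ f n ω)
    (hs : Summable fun n => ∫ ω, f n ω ∂P) : ∀ᵐ ω ∂P, Tendsto (fun n => f n ω) atTop (𝓝 0) := by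
  have h1 : ∫⁻ ω, ∑' n, ENNReal.ofReal (f n ω) ∂P ≠ ⊤ := by
    rw [lintegral_tsum fun n => (hf n).aemeasurable.ennreal_ofReal]
    have h2 : ∀ n, ∫⁻ ω, ENNReal.ofReal (f n ω) ∂P = ENNReal.ofReal (∫ ω, f n ω ∂P) := fun n =>
      (ofReal_integral_eq_lintegral_ofReal (hf n) (ae_of_all _ (h0 n))).symm
    simp only [h2]
    exact hs.tsum_ofReal_ne_top
  have h3 := ae_lt_top' (AEMeasurable.tsum fun n =>
    (hf n).aemeasurable.ennreal_ofReal) h1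
  filter_upwards [h3] with ω hω
  have h4 := ENNReal.tendsto_atTop_zero_of_tsum_ne_top hω.ne
  have h5 := (ENNReal.tendsto_toReal ENNReal.zero_ne_top).comp h4
  refine h5.congr fun n => ?_
  simp [h0 n ω]

theorem HaarModel.ae_tendsto_normTrace {Ω : Type*} [MeasurableSpace Ω] {P : Measure Ω}
    {U : (n : ℕ) → Ω → Matrix.unitaryGroup (Fin n × Fin (k n)) ℂ}
    (hU : ∀ n, Measurable (U n)) (M : HaarModel c k (fun n => P.map (U n)) D) (m : ℕ → ℝ)
    (hm₀ : m 0 = 1)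
    (hm : ∀ q, m (q + 1) = ∑ t : Fin (q + 1), (if (t : ℕ) = 0 then c ^ 2 else m t) * m (q - t))
    (p : ℕ) : ∀ᵐ ω ∂P, Tendsto
      (fun n => normTrace c p ((U n ω).1 * D n * ((U n ω).1)ᴴ)) atTop (𝓝 (m p : ℂ)) := by
  have hcont : ∀ n, Continuous fun V : Matrix.unitaryGroup (Fin n × Fin (k n)) ℂ =>
      ‖normTrace c p (V.1 * D n * (V.1)ᴴ) - meanTrace (fun n => P.map (U n)) D c p n‖ ^ 2 := fun n =>
    ((((continuous_normTrace c n (k n) p).comp (continuous_conj (D n))).sub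
      continuous_const).norm.pow 2)
  have hint : ∀ n, Integrable (fun V : Matrix.unitaryGroup (Fin n × Fin (k n)) ℂ =>
      ‖normTrace c p (V.1 * D n * (V.1)ᴴ) - meanTrace (fun n => P.map (U n)) D c p n‖ ^ 2)
      (P.map (U n)) := fun n => by
    have := M.isProbability n
    exact (hcont n).integrable_of_hasCompactSupport (HasCompactSupport.of_compactSpace _)
  have h := ae_tendsto_zero_of_summable_integral (P := P)
    (f := fun n ω => ‖normTrace c p ((U n ω).1 * D n * ((U n ω).1)ᴴ) -
      meanTrace (fun n => P.map (U n)) D c p n‖ ^ 2)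
    (fun n => (hint n).comp_measurable (hU n)) (fun n ω => by positivity) (by
      refine M.summable_variance p |>.congr fun n => ?_
      exact integral_map (hU n).aemeasurable (hcont n).aestronglyMeasurable)
  filter_upwards [h] with ω hω
  have h2 : Tendsto (fun n => ‖normTrace c p ((U n ω).1 * D n * ((U n ω).1)ᴴ) -
      meanTrace (fun n => P.map (U n)) D c p n‖) atTop (𝓝 0) := by
    have := hω.sqrt
    simpa [Real.sqrt_sq] using this
  have h3 := (tendsto_zero_iff_norm_tendsto_zero.2 h2).add (M.tendsto_meanTrace m hm₀ hm p)
  simpa using h3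

end Moments
end RandomChannel

namespace RandomChannel

/-! ### From the quadratic moment recursion to a linear one. -/

section Recursion

/-- The solution of the quadratic recursion for the moments of the Marchenko–Pastur law. -/
noncomputable def mpSeq (r : ℝ) : ℕ → ℝ
  | 0 => 1
  | q + 1 => ∑ t : Fin (q + 1), (if (t : ℕ) = 0 then r else mpSeq r t) * mpSeq r (q - t)

theorem mpSeq_zero (r : ℝ) : mpSeq r 0 = 1 := by rw [mpSeq]

theorem mpSeq_succ (r : ℝ) (q : ℕ) : mpSeq r (q + 1) =
    ∑ t : Fin (q + 1), (if (t : ℕ) = 0 then r else mpSeq r t) * mpSeq r (q - t) := by rw [mpSeq]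

theorem mpSeq_one (r : ℝ) : mpSeq r 1 = r := by
  rw [mpSeq_succ]
  simp [mpSeq_zero]

open PowerSeries in
theorem mk_mpSeq_eq (r : ℝ) : (PowerSeries.mk (mpSeq r)) =
    1 + X * ((PowerSeries.mk (mpSeq r) + C (r - 1)) * PowerSeries.mk (mpSeq r)) := by
  ext q
  rcases q with _ | q
  · simp [mpSeq_zero]
  · rw [map_add, coeff_succ_X_mul, coeff_mul, coeff_mk, mpSeq_succ,
      Finset.Nat.sum_antidiagonal_eq_sum_range_succ
      (fun i j => coeff i (PowerSeries.mk (mpSeq r) + C (r - 1)) * coeff j (PowerSeries.mk (mpSeq r))),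
      Finset.sum_range, coeff_one, if_neg (Nat.succ_ne_zero q), zero_add]
    refine Finset.sum_congr rfl fun t _ => ?_
    rw [map_add, coeff_mk, coeff_mk, coeff_C]
    split_ifs with h
    · rw [h, mpSeq_zero]
      ring
    · rw [add_zero]

open PowerSeries in
/-- The linear recursion for the moments of the Marchenko–Pastur law. -/
theorem mpSeq_linear (r : ℝ) (q : ℕ) : (q + 3) * mpSeq r (q + 2) =
    (2 * q + 3) * (1 + r) * mpSeq r (q + 1) - q * (1 - r) ^ 2 * mpSeq r q := by
  set M : PowerSeries ℝ := PowerSeries.mk (mpSeq r) with hM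
  have h1 : M = 1 + X * ((M + C (r - 1)) * M) := mk_mpSeq_eq r
  -- Completing the square in the quadratic equation for M gives F² = Δ with Δ a polynomial.
  -- Differentiating, 2ΔF' = Δ'F, and the coefficient of X^{q+2} is the linear recursion.
  set F : PowerSeries ℝ := 2 * (X * M) + (C (r - 1) * X - 1) with hF
  set Δ : PowerSeries ℝ := 1 + C (-2 * (1 + r)) * X + C ((1 - r) ^ 2) * (X * X) with hΔ
  have hC : C ((1 - r) ^ 2) = (C (r - 1)) ^ 2 := by
    rw [← map_pow]
    congr 1
    ring
  have hC2 : (C (-2 * (1 + r)) : PowerSeries ℝ) = -4 - 2 * C (r - 1) := by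
    rw [show -2 * (1 + r) = -4 - 2 * (r - 1) by ring, map_sub, map_mul, map_neg, map_ofNat,
      map_ofNat]
  have h2 : F * F = Δ := by
    rw [hF, hΔ, hC, hC2]
    linear_combination (4 * X) * (-h1)
  have h3 : 2 * (Δ * d⁄dX ℝ F) = d⁄dX ℝ Δ * F := by
    have h4 : d⁄dX ℝ Δ = 2 * (F * d⁄dX ℝ F) := by
      rw [← h2, Derivation.leibniz, smul_eq_mul]
      ring
    rw [h4, ← h2]
    ring
  have hF' : ∀ j, coeff (j + 2) F = 2 * mpSeq r (j + 1) := fun j => by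
    rw [hF, map_add, map_sub, two_mul, map_add, coeff_succ_X_mul, coeff_C_mul, coeff_X, coeff_one,
      hM, coeff_mk]
    simp
    ring
  have hdΔ : d⁄dX ℝ Δ = C (-2 * (1 + r)) + C (2 * (1 - r) ^ 2) * X := by
    rw [hΔ]
    simp only [map_add, Derivation.leibniz, PowerSeries.derivative_C, PowerSeries.derivative_X,
      smul_eq_mul, Derivation.map_one_eq_zero, two_mul, add_mul]
    ring
  have h5 := congrArg (coeff (q + 2)) h3
  rw [hdΔ, hΔ] at h5
  simp only [two_mul, add_mul, one_mul, map_add, mul_assoc, coeff_C_mul, coeff_succ_X_mul,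
    coeff_derivative] at h5
  -- For q = 0 the coefficient of X in F occurs, which does not have the form given by `hF'`; its
  -- contributions on the two sides cancel.
  rcases q with _ | q
  · have h6 := hF' 0
    have h7 := hF' 1
    simp only [zero_add, Nat.reduceAdd] at h5 h6 h7
    rw [h6, h7] at h5
    push_cast at h5 ⊢
    linarith
  · have h6 := hF' (q + 2)
    have h7 := hF' (q + 1)
    have h8 := hF' q
    simp only [add_assoc, Nat.reduceAdd] at h5 h6 h7 h8
    rw [h6, h7, h8] at h5
    push_cast at h5 ⊢
    simp only [add_assoc, Nat.reduceAdd]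
    linarith

end Recursion
end RandomChannel

namespace RandomChannel

/-! ### Integrals of the Marchenko–Pastur density. -/

section Density

/-- The quadratic polynomial under the square root in the Marchenko–Pastur density. -/
def mpQuad (r x : ℝ) : ℝ := 4 * r - (x - 1 - r) ^ 2

theorem continuous_mpQuad (r : ℝ) : Continuous (mpQuad r) := by
  unfold mpQuad
  fun_prop

variable {r : ℝ}

theorem mp_lo_eq (hr : 0 < r) : 1 + r - 2 * √r = (1 - √r) ^ 2 := by
  nlinarith [Real.sq_sqrt hr.le]

theorem mp_lo_nonneg (hr : 0 < r) : 0 ≤ 1 + r - 2 * √r := by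
  rw [mp_lo_eq hr]
  positivity

theorem mp_lo_le_hi : 1 + r - 2 * √r ≤ 1 + r + 2 * √r := by
  linarith [Real.sqrt_nonneg r]

theorem mpQuad_eq (hr : 0 < r) (x : ℝ) :
    mpQuad r x = (x - (1 + r - 2 * √r)) * (1 + r + 2 * √r - x) := by
  rw [mpQuad]
  linear_combination (-4) * Real.sq_sqrt hr.le

theorem mpQuad_pos (hr : 0 < r) {x : ℝ} (hx : x ∈ Set.Ioo (1 + r - 2 * √r) (1 + r + 2 * √r)) :
    0 < mpQuad r x := by
  rw [mpQuad_eq hr]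
  exact mul_pos (by linarith [hx.1]) (by linarith [hx.2])

theorem hasDerivAt_mpQuad (r x : ℝ) : HasDerivAt (mpQuad r) (2 * (1 + r - x)) x := by
  have h := ((((hasDerivAt_id x).sub_const 1).sub_const r).pow 2).const_sub (4 * r)
  refine h.congr_deriv ?_
  simp
  ring

theorem hasDerivAt_sqrt_mpQuad (hr : 0 < r) {x : ℝ}
    (hx : x ∈ Set.Ioo (1 + r - 2 * √r) (1 + r + 2 * √r)) :
    HasDerivAt (fun y => √(mpQuad r y)) ((1 + r - x) / √(mpQuad r x)) x := by
  have hp := mpQuad_pos hr hx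
  refine ((hasDerivAt_mpQuad r x).sqrt hp.ne').congr_deriv ?_
  have := (Real.sqrt_pos.2 hp).ne'
  field_simp

theorem hasDerivAt_arcsin_left (hr : 0 < r) {x : ℝ}
    (hx : x ∈ Set.Ioo (1 + r - 2 * √r) (1 + r + 2 * √r)) :
    HasDerivAt (fun y => Real.arcsin ((y - 1 - r) / (2 * √r))) (1 / √(mpQuad r x)) x := by
  have hs := Real.sqrt_pos.2 hr
  have hp := mpQuad_pos hr hx
  have h1 : (x - 1 - r) / (2 * √r) ≠ -1 := by
    rw [Ne, div_eq_iff (by positivity)]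
    intro h
    linarith [hx.1]
  have h2 : (x - 1 - r) / (2 * √r) ≠ 1 := by
    rw [Ne, div_eq_iff (by positivity)]
    intro h
    linarith [hx.2]
  have h3 : HasDerivAt (fun y => (y - 1 - r) / (2 * √r)) (1 / (2 * √r)) x :=
    (((hasDerivAt_id x).sub_const 1).sub_const r).div_const _
  refine ((Real.hasDerivAt_arcsin h1 h2).comp x h3).congr_deriv ?_
  have h4 : 1 - ((x - 1 - r) / (2 * √r)) ^ 2 = mpQuad r x / (2 * √r) ^ 2 := by
    rw [mpQuad, div_pow, eq_div_iff (by positivity), sub_mul, div_mul_cancel₀ _ (by positivity)]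
    linear_combination 4 * Real.sq_sqrt hr.le
  rw [h4, Real.sqrt_div hp.le, Real.sqrt_sq (by positivity)]
  have := (Real.sqrt_pos.2 hp).ne'
  field_simp

/-- The factor |1 - r| is kept on the arcsine so that the formula survives at r = 1, where both
sides vanish. -/
theorem hasDerivAt_arcsin_right (hr : 0 < r) {x : ℝ}
    (hx : x ∈ Set.Ioo (1 + r - 2 * √r) (1 + r + 2 * √r)) :
    HasDerivAt (fun y => |1 - r| * Real.arcsin (((1 + r) * y - (1 - r) ^ 2) / (2 * √r * y)))
      ((1 - r) ^ 2 / (x * √(mpQuad r x))) x := by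
  rcases eq_or_ne r 1 with rfl | hr1
  · simpa using hasDerivAt_const x (0 : ℝ)
  have hs := Real.sqrt_pos.2 hr
  have hp := mpQuad_pos hr hx
  have hx0 : 0 < x := (mp_lo_nonneg hr).trans_lt hx.1
  have ha : 0 < |1 - r| := abs_pos.2 (sub_ne_zero.2 hr1.symm)
  have h4 : 1 - (((1 + r) * x - (1 - r) ^ 2) / (2 * √r * x)) ^ 2 =
      (|1 - r| * √(mpQuad r x) / (2 * √r * x)) ^ 2 := by
    rw [div_pow, div_pow, mul_pow |1 - r|, sq_abs, Real.sq_sqrt hp.le, eq_div_iff (by positivity),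
      sub_mul, div_mul_cancel₀ _ (by positivity), mpQuad]
    linear_combination (4 * x ^ 2) * Real.sq_sqrt hr.le
  have h5 : 0 < |1 - r| * √(mpQuad r x) / (2 * √r * x) := by
    have := Real.sqrt_pos.2 hp
    positivity
  have h1 : ((1 + r) * x - (1 - r) ^ 2) / (2 * √r * x) ≠ -1 := fun h => by
    rw [h] at h4
    nlinarith
  have h2 : ((1 + r) * x - (1 - r) ^ 2) / (2 * √r * x) ≠ 1 := fun h => by
    rw [h] at h4
    nlinarith
  have h3 : HasDerivAt (fun y => ((1 + r) * y - (1 - r) ^ 2) / (2 * √r * y))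
      ((1 - r) ^ 2 / (2 * √r * x ^ 2)) x := by
    refine ((((hasDerivAt_id x).const_mul (1 + r)).sub_const ((1 - r) ^ 2)).div
      ((hasDerivAt_id x).const_mul (2 * √r)) (mul_ne_zero (by positivity) hx0.ne')).congr_deriv ?_
    simp only [id]
    field_simp
    ring
  refine (((Real.hasDerivAt_arcsin h1 h2).comp x h3).const_mul |1 - r|).congr_deriv ?_
  rw [h4, Real.sqrt_sq h5.le]
  have := (Real.sqrt_pos.2 hp).ne'
  field_simp

/-- An antiderivative of the Marchenko–Pastur density, up to a constant factor. -/
noncomputable def mpPrimitive (r x : ℝ) : ℝ :=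
  √(mpQuad r x) + (1 + r) * Real.arcsin ((x - 1 - r) / (2 * √r)) -
    |1 - r| * Real.arcsin (((1 + r) * x - (1 - r) ^ 2) / (2 * √r * x))

theorem hasDerivAt_mpPrimitive (hr : 0 < r) {x : ℝ}
    (hx : x ∈ Set.Ioo (1 + r - 2 * √r) (1 + r + 2 * √r)) :
    HasDerivAt (mpPrimitive r) (√(mpQuad r x) / x) x := by
  have hp := mpQuad_pos hr hx
  have hx0 : 0 < x := (mp_lo_nonneg hr).trans_lt hx.1
  refine (((hasDerivAt_sqrt_mpQuad hr hx).add ((hasDerivAt_arcsin_left hr hx).const_mul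
    (1 + r))).sub (hasDerivAt_arcsin_right hr hx)).congr_deriv ?_
  have h1 := (Real.sqrt_pos.2 hp).ne'
  field_simp
  rw [Real.sq_sqrt hp.le, mpQuad]
  ring

theorem continuousOn_mpPrimitive (hr : 0 < r) :
    ContinuousOn (mpPrimitive r) (Set.Icc (1 + r - 2 * √r) (1 + r + 2 * √r)) := by
  have hs := Real.sqrt_pos.2 hr
  refine ContinuousOn.sub (Continuous.continuousOn ?_) ?_
  · exact (continuous_mpQuad r).sqrt.add (continuous_const.mul
      (Real.continuous_arcsin.comp (by fun_prop)))
  -- At r = 1 the left endpoint is 0 and the quotient degenerates there, but its prefactor is zero.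
  rcases eq_or_ne r 1 with rfl | hr1
  · simpa using continuousOn_const
  have hlo : 0 < 1 + r - 2 * √r := by
    rw [mp_lo_eq hr]
    refine sq_pos_of_ne_zero (sub_ne_zero.2 fun h => hr1 ?_)
    rw [← Real.sq_sqrt hr.le, ← h, one_pow]
  refine continuousOn_const.mul (Real.continuous_arcsin.comp_continuousOn
    (ContinuousOn.div (by fun_prop) (by fun_prop) fun x hx => ?_))
  have : 0 < x := hlo.trans_le hx.1
  positivity

/-- At r = 1 the integrand is unbounded near 0. Integrability follows because it is the nonnegative
derivative of a function continuous up to the endpoints. -/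
theorem intervalIntegrable_mp (hr : 0 < r) : IntervalIntegrable (fun x => √(mpQuad r x) / x) volume
    (1 + r - 2 * √r) (1 + r + 2 * √r) := by
  rw [intervalIntegrable_iff_integrableOn_Ioc_of_le mp_lo_le_hi]
  refine intervalIntegral.integrableOn_deriv_of_nonneg (continuousOn_mpPrimitive hr)
    (fun x hx => hasDerivAt_mpPrimitive hr hx) fun x hx => ?_
  have hx0 : 0 < x := (mp_lo_nonneg hr).trans_lt hx.1
  positivity

/-- The value is 2π min(1, r), so after division by 2π the atom of mass max(1 - r, 0) completes the
total to one. -/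
theorem integral_mp (hr : 0 < r) : ∫ x in (1 + r - 2 * √r)..(1 + r + 2 * √r), √(mpQuad r x) / x =
    Real.pi * (1 + r - |1 - r|) := by
  have hs := Real.sqrt_pos.2 hr
  have hsq := Real.sq_sqrt hr.le
  rw [intervalIntegral.integral_eq_sub_of_hasDerivAt_of_le mp_lo_le_hi (continuousOn_mpPrimitive hr)
    (fun x hx => hasDerivAt_mpPrimitive hr hx) (intervalIntegrable_mp hr)]
  have h1 : mpPrimitive r (1 + r + 2 * √r) = Real.pi / 2 * (1 + r - |1 - r|) := by
    have e1 : mpQuad r (1 + r + 2 * √r) = 0 := by rw [mpQuad_eq hr]; ring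
    have e2 : (1 + r + 2 * √r - 1 - r) / (2 * √r) = 1 := by
      rw [div_eq_one_iff_eq (by positivity)]
      ring
    have e3 : ((1 + r) * (1 + r + 2 * √r) - (1 - r) ^ 2) / (2 * √r * (1 + r + 2 * √r)) = 1 := by
      rw [div_eq_one_iff_eq (by positivity)]
      linear_combination (-4) * hsq
    rw [mpPrimitive, e1, e2, e3, Real.sqrt_zero, Real.arcsin_one]
    ring
  have h2 : mpPrimitive r (1 + r - 2 * √r) = -(Real.pi / 2 * (1 + r - |1 - r|)) := by
    have e1 : mpQuad r (1 + r - 2 * √r) = 0 := by rw [mpQuad_eq hr]; ring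
    have e2 : (1 + r - 2 * √r - 1 - r) / (2 * √r) = -1 := by
      rw [div_eq_iff (by positivity)]
      ring
    have e3 : |1 - r| * Real.arcsin
        (((1 + r) * (1 + r - 2 * √r) - (1 - r) ^ 2) / (2 * √r * (1 + r - 2 * √r))) =
        |1 - r| * -(Real.pi / 2) := by
      rcases eq_or_ne r 1 with rfl | hr1
      · simp
      have hlo : 1 + r - 2 * √r ≠ 0 := by
        rw [mp_lo_eq hr]
        refine pow_ne_zero _ (sub_ne_zero.2 fun h => hr1 ?_)
        rw [← Real.sq_sqrt hr.le, ← h, one_pow]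
      have e4 : ((1 + r) * (1 + r - 2 * √r) - (1 - r) ^ 2) / (2 * √r * (1 + r - 2 * √r)) = -1 := by
        rw [div_eq_iff (by positivity)]
        linear_combination (-4) * hsq
      rw [e4, Real.arcsin_neg_one]
    rw [mpPrimitive, e1, e2, e3, Real.sqrt_zero, Real.arcsin_neg_one]
    ring
  rw [h1, h2]
  ring

/-- The moments of the semicircle supported on the Marchenko–Pastur interval. -/
noncomputable def semiMoment (r : ℝ) (j : ℕ) : ℝ :=
  ∫ x in (1 + r - 2 * √r)..(1 + r + 2 * √r), x ^ j * √(mpQuad r x)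

theorem semiMoment_zero (hr : 0 < r) : semiMoment r 0 = 2 * Real.pi * r := by
  have hs := Real.sqrt_pos.2 hr
  -- The substitution x = 2√r y + (1 + r) maps the unit half disc onto the interval of support.
  have h := intervalIntegral.integral_comp_mul_add (a := -1) (b := 1)
    (fun x => √(mpQuad r x)) (c := 2 * √r) (by positivity) (1 + r)
  have h2 : ∀ y, √(mpQuad r (2 * √r * y + (1 + r))) = 2 * √r * √(1 - y ^ 2) := fun y => by
    rw [← Real.sqrt_sq (show 0 ≤ 2 * √r by positivity), ← Real.sqrt_mul (sq_nonneg _),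
      Real.sqrt_sq (by positivity)]
    congr 1
    rw [mpQuad]
    linear_combination (-4) * Real.sq_sqrt hr.le
  simp only [h2, intervalIntegral.integral_const_mul, integral_sqrt_one_sub_sq, smul_eq_mul] at h
  simp only [semiMoment, pow_zero, one_mul]
  rw [show 1 + r - 2 * √r = 2 * √r * -1 + (1 + r) by ring,
    show 1 + r + 2 * √r = 2 * √r * 1 + (1 + r) by ring]
  rw [eq_comm, inv_mul_eq_iff_eq_mul₀ (by positivity)] at h
  rw [h]
  linear_combination (2 * Real.pi) * Real.sq_sqrt hr.le

/-- The function x^j q(x)^{3/2}, with q = `mpQuad r`, vanishes at both endpoints, so its derivative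
integrates to zero. For j = 0 the truncated index j - 1 has coefficient 0. -/
theorem semiMoment_linear (hr : 0 < r) (j : ℕ) : (j + 3) * semiMoment r (j + 1) =
    (2 * j + 3) * (1 + r) * semiMoment r j - j * (1 - r) ^ 2 * semiMoment r (j - 1) := by
  have hcont : ∀ i : ℕ, Continuous fun x => x ^ i * √(mpQuad r x) := fun i =>
    (continuous_pow i).mul (continuous_mpQuad r).sqrt
  have hint : ∀ i : ℕ, IntervalIntegrable (fun x => x ^ i * √(mpQuad r x)) volume
      (1 + r - 2 * √r) (1 + r + 2 * √r) := fun i => (hcont i).intervalIntegrable _ _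
  have hcomb : (fun x => (2 * j + 3) * (1 + r) * (x ^ j * √(mpQuad r x)) -
      j * (1 - r) ^ 2 * (x ^ (j - 1) * √(mpQuad r x)) - (j + 3) * (x ^ (j + 1) * √(mpQuad r x))) =
      fun x => (j * x ^ (j - 1) * mpQuad r x + 3 * x ^ j * (1 + r - x)) * √(mpQuad r x) := by
    ext x
    have : mpQuad r x = -x ^ 2 + 2 * (1 + r) * x - (1 - r) ^ 2 := by rw [mpQuad]; ring
    rcases j with _ | j
    · simp
      ring
    · simp only [Nat.add_sub_cancel]
      generalize √(mpQuad r x) = s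
      rw [this]
      push_cast
      ring
  have key := intervalIntegral.integral_eq_sub_of_hasDerivAt_of_le
    (f := fun x => x ^ j * (mpQuad r x * √(mpQuad r x)))
    (f' := fun x => (2 * j + 3) * (1 + r) * (x ^ j * √(mpQuad r x)) -
      j * (1 - r) ^ 2 * (x ^ (j - 1) * √(mpQuad r x)) - (j + 3) * (x ^ (j + 1) * √(mpQuad r x)))
    (mp_lo_le_hi (r := r))
    (((continuous_pow j).mul ((continuous_mpQuad r).mul (continuous_mpQuad r).sqrt)).continuousOn)
    (fun x hx => by
      rw [congrFun hcomb x]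
      have hp := mpQuad_pos hr hx
      have h1 := (Real.sqrt_pos.2 hp).ne'
      refine ((hasDerivAt_pow j x).mul ((hasDerivAt_mpQuad r x).mul
        (hasDerivAt_sqrt_mpQuad hr hx))).congr_deriv ?_
      have h2 : mpQuad r x * ((1 + r - x) / √(mpQuad r x)) = (1 + r - x) * √(mpQuad r x) := by
        rw [mul_div_assoc', div_eq_iff h1, mul_assoc, Real.mul_self_sqrt hp.le]
        ring
      rw [Pi.mul_apply, h2]
      ring)
    ((((hint j).const_mul _).sub ((hint (j - 1)).const_mul _)).sub ((hint (j + 1)).const_mul _))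
  have e1 : mpQuad r (1 + r + 2 * √r) = 0 := by rw [mpQuad_eq hr]; ring
  have e2 : mpQuad r (1 + r - 2 * √r) = 0 := by rw [mpQuad_eq hr]; ring
  rw [e1, e2, intervalIntegral.integral_sub (((hint j).const_mul _).sub ((hint (j - 1)).const_mul _))
    ((hint (j + 1)).const_mul _), intervalIntegral.integral_sub ((hint j).const_mul _)
    ((hint (j - 1)).const_mul _), intervalIntegral.integral_const_mul,
    intervalIntegral.integral_const_mul, intervalIntegral.integral_const_mul] at key
  simp only [semiMoment]
  linear_combination -key

/-- Both sides satisfy the same linear recursion, shifted by one index because the density carries a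
factor 1/x, and they agree at j = 0. -/
theorem semiMoment_eq (hr : 0 < r) (j : ℕ) : semiMoment r j = 2 * Real.pi * mpSeq r (j + 1) := by
  induction j using Nat.strong_induction_on with
  | _ j ih =>
  rcases j with _ | j
  · rw [semiMoment_zero hr, zero_add, mpSeq_one]
  have h1 := semiMoment_linear hr j
  have h2 := mpSeq_linear r j
  rw [ih j (by omega)] at h1
  have h3 : (j : ℝ) * semiMoment r (j - 1) = j * (2 * Real.pi * mpSeq r j) := by
    rcases j with _ | j
    · simp
    · rw [Nat.add_sub_cancel, ih j (by omega)]
  have h4 : ((j : ℝ) + 3) ≠ 0 := by positivity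
  refine mul_left_cancel₀ h4 ?_
  rw [h1]
  linear_combination (-(1 - r) ^ 2) * h3 - (2 * Real.pi) * h2

end Density

/-! ### Moments of the Marchenko–Pastur measure, atom included. -/

section Moments
variable {r : ℝ}

/-- The Marchenko–Pastur density. -/
noncomputable def mpDensity (r x : ℝ) : ℝ :=
  (Set.Icc (1 + r - 2 * √r) (1 + r + 2 * √r)).indicator
    (fun x => √(mpQuad r x) / (2 * Real.pi * x)) x

theorem marchenkoPastur_eq (r : ℝ) : marchenkoPastur r =
    ENNReal.ofReal (max (1 - r) 0) • Measure.dirac 0 +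
      volume.withDensity fun x => ENNReal.ofReal (mpDensity r x) := rfl

theorem measurable_mpDensity (r : ℝ) : Measurable (mpDensity r) := by
  refine Measurable.indicator ?_ measurableSet_Icc
  exact (continuous_mpQuad r).sqrt.measurable.div (measurable_const.mul measurable_id)

theorem mpDensity_nonneg (hr : 0 < r) (x : ℝ) : 0 ≤ mpDensity r x := by
  refine Set.indicator_nonneg (fun y hy => ?_) x
  have : 0 ≤ y := (mp_lo_nonneg hr).trans hy.1
  have := Real.pi_pos
  positivity

theorem integrableOn_mp (hr : 0 < r) : IntegrableOn (fun x => √(mpQuad r x) / (2 * Real.pi * x))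
    (Set.Icc (1 + r - 2 * √r) (1 + r + 2 * √r)) := by
  have h := (intervalIntegrable_iff_integrableOn_Icc_of_le mp_lo_le_hi).1 (intervalIntegrable_mp hr)
  refine (h.const_mul (2 * Real.pi)⁻¹).congr (ae_of_all _ fun x => ?_)
  change (2 * Real.pi)⁻¹ * (√(mpQuad r x) / x) = √(mpQuad r x) / (2 * Real.pi * x)
  rw [div_mul_eq_div_div_swap, inv_mul_eq_div]

theorem integrable_mul_mpDensity (hr : 0 < r) {f : ℝ → ℝ} (hf : Continuous f) :
    Integrable fun x => mpDensity r x * f x := by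
  have h1 := (integrableOn_mp hr).mul_continuousOn hf.continuousOn isCompact_Icc
  refine ((integrable_indicator_iff measurableSet_Icc).2 h1).congr (ae_of_all _ fun x => ?_)
  by_cases hx : x ∈ Set.Icc (1 + r - 2 * √r) (1 + r + 2 * √r) <;> simp [mpDensity, hx]

theorem integrable_marchenkoPastur (hr : 0 < r) {f : ℝ → ℝ} (hf : Continuous f) :
    Integrable f (marchenkoPastur r) := by
  rw [marchenkoPastur_eq]
  refine Integrable.add_measure ?_ ?_
  · refine Integrable.smul_measure ?_ ENNReal.ofReal_ne_top
    exact integrable_dirac (by simp)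
  · rw [integrable_withDensity_iff_integrable_smul' (measurable_mpDensity r).ennreal_ofReal
      (ae_of_all _ fun x => ENNReal.ofReal_lt_top)]
    refine (integrable_mul_mpDensity hr hf).congr (ae_of_all _ fun x => ?_)
    simp [ENNReal.toReal_ofReal (mpDensity_nonneg hr x)]

theorem integral_marchenkoPastur (hr : 0 < r) {f : ℝ → ℝ} (hf : Continuous f) :
    ∫ x, f x ∂(marchenkoPastur r) = max (1 - r) 0 * f 0 +
      ∫ x in (1 + r - 2 * √r)..(1 + r + 2 * √r), √(mpQuad r x) / (2 * Real.pi * x) * f x := by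
  have hint := integrable_marchenkoPastur hr hf
  rw [marchenkoPastur_eq] at hint ⊢
  rw [integral_add_measure hint.left_of_add_measure hint.right_of_add_measure,
    integral_smul_measure, integral_dirac, ENNReal.toReal_ofReal (le_max_right _ _), smul_eq_mul]
  congr 1
  rw [integral_withDensity_eq_integral_toReal_smul (measurable_mpDensity r).ennreal_ofReal
    (ae_of_all _ fun x => ENNReal.ofReal_lt_top),
    intervalIntegral.integral_of_le mp_lo_le_hi, ← integral_Icc_eq_integral_Ioc,
    ← integral_indicator measurableSet_Icc]
  refine integral_congr_ae (ae_of_all _ fun x => ?_)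
  simp only [ENNReal.toReal_ofReal (mpDensity_nonneg hr x), smul_eq_mul]
  by_cases hx : x ∈ Set.Icc (1 + r - 2 * √r) (1 + r + 2 * √r) <;> simp [mpDensity, hx]

/-- The moments of the Marchenko–Pastur law. -/
theorem integral_pow_marchenkoPastur (hr : 0 < r) (p : ℕ) :
    ∫ x, x ^ p ∂(marchenkoPastur r) = mpSeq r p := by
  rw [integral_marchenkoPastur hr (continuous_pow p)]
  have hpi := Real.pi_pos
  rcases p with _ | p
  · have h1 : ∀ x, √(mpQuad r x) / (2 * Real.pi * x) * x ^ 0 =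
        (2 * Real.pi)⁻¹ * (√(mpQuad r x) / x) := fun x => by
      rw [pow_zero, mul_one, div_mul_eq_div_div_swap, inv_mul_eq_div]
    simp only [h1]
    rw [intervalIntegral.integral_const_mul, integral_mp hr, mpSeq_zero, pow_zero, mul_one]
    have h2 : (2 * Real.pi)⁻¹ * (Real.pi * (1 + r - |1 - r|)) = (1 + r - |1 - r|) / 2 := by
      field_simp
    rw [h2]
    rcases le_total r 1 with h | h
    · rw [max_eq_left (by linarith), abs_of_nonneg (by linarith)]
      ring
    · rw [max_eq_right (by linarith), abs_of_nonpos (by linarith)]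
      ring
  · have h1 : ∀ x, x ≠ 0 → √(mpQuad r x) / (2 * Real.pi * x) * x ^ (p + 1) =
        (2 * Real.pi)⁻¹ * (x ^ p * √(mpQuad r x)) := fun x hx => by
      rw [pow_succ]
      field_simp
    rw [zero_pow (Nat.succ_ne_zero p), mul_zero, zero_add]
    have h2 : ∀ᵐ x : ℝ, x ≠ 0 := by simp [ae_iff]
    rw [intervalIntegral.integral_congr_ae (h2.mono fun x hx _ => h1 x hx),
      intervalIntegral.integral_const_mul]
    have h3 := semiMoment_eq hr p
    rw [semiMoment] at h3
    rw [h3]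
    field_simp

end Moments
end RandomChannel

namespace RandomChannel

/-! ### Rank-one projections and the trace of a compressed power. -/

section RankOne

variable {d : Type*} [Fintype d]

/-- The hypothesis is the vanishing of the 2 × 2 minors, a form of rank at most one which needs no
choice of vectors. -/
theorem mul_mul_of_exchange {E : Matrix d d ℂ}
    (hE : ∀ i j s t, E i j * E s t = E i t * E s j) (X : Matrix d d ℂ) :
    E * X * E = (E * X).trace • E := by
  ext i t
  simp only [Matrix.mul_apply, Matrix.smul_apply, Matrix.trace, Matrix.diag_apply, smul_eq_mul,
    Finset.sum_mul]
  refine Finset.sum_congr rfl fun s _ => Finset.sum_congr rfl fun j _ => ?_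
  linear_combination X j s * hE i j s t

variable [DecidableEq d]

/-- A matrix of rank one satisfies the exchange relation of an elementary tensor. -/
theorem mul_exchange_of_rank_eq_one {Y : Matrix d d ℂ} (hY : Y.rank = 1) (i j s t : d) :
    Y i j * Y s t = Y i t * Y s j := by
  rw [Matrix.rank] at hY
  obtain ⟨v, -, hv⟩ := finrank_eq_one_iff'.1 hY
  have h : ∀ j, ∃ a : ℂ, ∀ i, Y i j = a * v.1 i := fun j => by
    obtain ⟨a, ha⟩ := hv ⟨Y.mulVecLin (Pi.single j 1), LinearMap.mem_range_self _ _⟩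
    refine ⟨a, fun i => ?_⟩
    have := congrFun (congrArg Subtype.val ha) i
    simpa using this.symm
  obtain ⟨a, ha⟩ := h j
  obtain ⟨b, hb⟩ := h t
  rw [ha, hb, ha, hb]
  ring

theorem trace_eq_one_of_exchange {E : Matrix d d ℂ}
    (hE : ∀ i j s t, E i j * E s t = E i t * E s j) (h : E * E = E) (h0 : E ≠ 0) :
    E.trace = 1 := by
  have h1 := mul_mul_of_exchange hE 1
  rw [mul_one, h] at h1
  by_contra h2
  refine h0 (((smul_eq_zero (r := 1 - E.trace) (m := E)).1 ?_).resolve_left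
    (sub_ne_zero.2 (Ne.symm h2)))
  rw [sub_smul, one_smul, ← h1, sub_self]

open scoped Matrix.Norms.L2Operator

theorem norm_eq_one_of_isStarProjection {E : Matrix d d ℂ} (h : IsStarProjection E) (h0 : E ≠ 0) :
    ‖E‖ = 1 := by
  have h1 : ‖E‖ = ‖E‖ * ‖E‖ := by
    rw [← CStarRing.norm_star_mul_self, h.isSelfAdjoint.star_eq, h.isIdempotentElem.eq]
  exact (mul_right_cancel₀ (norm_ne_zero_iff.2 h0) ((one_mul _).trans h1)).symm

theorem norm_le_one_of_isStarProjection {E : Matrix d d ℂ} (h : IsStarProjection E) :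
    ‖E‖ ≤ 1 := by
  by_cases h0 : E = 0
  · rw [h0, norm_zero]
    exact zero_le_one
  · exact (norm_eq_one_of_isStarProjection h h0).le

/-- Since EXE = tr(EX) E and ‖E‖ = 1, no dimension factor appears. -/
theorem norm_trace_mul_le {E : Matrix d d ℂ} (hE : ∀ i j s t, E i j * E s t = E i t * E s j)
    (h : IsStarProjection E) (X : Matrix d d ℂ) : ‖(E * X).trace‖ ≤ ‖X‖ := by
  by_cases h0 : E = 0
  · simp [h0]
  have h1 := norm_eq_one_of_isStarProjection h h0
  calc ‖(E * X).trace‖ = ‖(E * X).trace • E‖ := by rw [norm_smul, h1, mul_one]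
    _ = ‖E * X * E‖ := by rw [mul_mul_of_exchange hE]
    _ ≤ ‖E‖ * ‖X‖ * ‖E‖ := (norm_mul_le _ _).trans
      (mul_le_mul_of_nonneg_right (norm_mul_le _ _) (norm_nonneg _))
    _ = ‖X‖ := by rw [h1, one_mul, mul_one]

/-- The projections are removed one at a time, each at the cost of a trace against E. The free
matrix X carries the factors still containing E, which makes the induction close. -/
theorem norm_trace_pow_mul_sub_le {E : Matrix d d ℂ}
    (hE : ∀ i j s t, E i j * E s t = E i t * E s j) (h : IsStarProjection E) (B : Matrix d d ℂ)
    (p : ℕ) : ∀ X : Matrix d d ℂ,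
    ‖(((1 - E) * B) ^ p * X).trace - (B ^ p * X).trace‖ ≤ p * ‖B‖ ^ p * ‖X‖ := by
  induction p with
  | zero => simp
  | succ p ih =>
    intro X
    have hB : ‖B ^ p‖ * ‖B‖ ≤ ‖B‖ ^ (p + 1) := by
      rcases p with _ | p
      · rw [pow_zero, zero_add, pow_one]
        exact mul_le_of_le_one_left (norm_nonneg _)
          (norm_le_one_of_isStarProjection (IsStarProjection.one _))
      · rw [pow_succ ‖B‖]
        exact mul_le_mul_of_nonneg_right (norm_pow_le' _ (Nat.succ_pos p)) (norm_nonneg _)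
    have h1 : (((1 - E) * B) ^ (p + 1) * X).trace - (B ^ (p + 1) * X).trace =
        ((((1 - E) * B) ^ p * ((1 - E) * B * X)).trace - (B ^ p * ((1 - E) * B * X)).trace) -
        (E * (B * X * B ^ p)).trace := by
      have h2 : (E * (B * X * B ^ p)).trace = (B ^ p * (E * B * X)).trace := by
        rw [← mul_assoc, Matrix.trace_mul_comm, mul_assoc E]
      have h6 : (1 - E) * B * X + E * B * X = B * X := by noncomm_ring
      rw [h2, sub_sub, ← Matrix.trace_add, ← mul_add, h6, pow_succ, pow_succ, mul_assoc _ _ X,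
        mul_assoc (B ^ p) B X]
    have h3 : ‖(1 - E) * B * X‖ ≤ ‖B‖ * ‖X‖ := (norm_mul_le _ _).trans
      (mul_le_mul_of_nonneg_right ((norm_mul_le _ _).trans (mul_le_of_le_one_left (norm_nonneg _)
        (norm_le_one_of_isStarProjection h.one_sub))) (norm_nonneg _))
    have h4 : ‖(E * (B * X * B ^ p)).trace‖ ≤ ‖B‖ ^ (p + 1) * ‖X‖ := by
      refine (norm_trace_mul_le hE h _).trans ((norm_mul_le _ _).trans ?_)
      calc ‖B * X‖ * ‖B ^ p‖ ≤ ‖B‖ * ‖X‖ * ‖B ^ p‖ :=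
            mul_le_mul_of_nonneg_right (norm_mul_le _ _) (norm_nonneg _)
        _ = (‖B ^ p‖ * ‖B‖) * ‖X‖ := by ring
        _ ≤ _ := mul_le_mul_of_nonneg_right hB (norm_nonneg _)
    rw [h1]
    refine (norm_sub_le _ _).trans ?_
    have h5 := (ih ((1 - E) * B * X)).trans
      (mul_le_mul_of_nonneg_left h3 (by positivity))
    push_cast
    linarith [show (p : ℝ) * ‖B‖ ^ p * (‖B‖ * ‖X‖) = p * ‖B‖ ^ (p + 1) * ‖X‖ by ring]

theorem trace_compression_pow {Q : Matrix d d ℂ} (hQ : Q * Q = Q) (B : Matrix d d ℂ) (p : ℕ) :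
    ((Q * B * Q) ^ (p + 1)).trace = ((Q * B) ^ (p + 1)).trace := by
  have h : ∀ p : ℕ, (Q * B * Q) ^ (p + 1) = (Q * B) ^ (p + 1) * Q := fun p => by
    induction p with
    | zero => simp
    | succ p ih =>
      rw [pow_succ, ih, pow_succ (Q * B) (p + 1)]
      simp only [mul_assoc]
      rw [← mul_assoc Q Q, hQ]
  rw [h, Matrix.trace_mul_comm, pow_succ', ← mul_assoc, ← mul_assoc, hQ]

/-- Compressing by the complement of a rank one projection changes the trace of a power by a
bounded multiple of the power of the norm. -/
theorem norm_trace_compression_pow_sub_le {E : Matrix d d ℂ}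
    (hE : ∀ i j s t, E i j * E s t = E i t * E s j) (h : IsStarProjection E) (B : Matrix d d ℂ)
    (p : ℕ) : ‖(((1 - E) * B * (1 - E)) ^ p).trace - (B ^ p).trace‖ ≤ p * ‖B‖ ^ p := by
  rcases p with _ | p
  · simp
  rw [trace_compression_pow h.one_sub.isIdempotentElem.eq]
  have h1 := norm_trace_pow_mul_sub_le hE h B (p + 1) 1
  rw [mul_one, mul_one] at h1
  exact h1.trans (mul_le_of_le_one_right (by positivity)
    (norm_le_one_of_isStarProjection (IsStarProjection.one _)))

theorem trace_pow_eq_sum_eigenvalues {A : Matrix d d ℂ} (hA : A.IsHermitian) (p : ℕ) :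
    (A ^ p).trace = ((∑ i, hA.eigenvalues i ^ p : ℝ) : ℂ) := by
  conv_lhs => rw [hA.spectral_theorem, ← map_pow, Unitary.conjStarAlgAut_apply,
    Matrix.trace_mul_cycle, Unitary.coe_star_mul_self, one_mul, Matrix.diagonal_pow,
    Matrix.trace_diagonal]
  simp

/-- An even power of the largest eigenvalue in modulus is one term of a nonnegative sum. This
replaces any separate bound on the operator norm. -/
theorem norm_pow_le_trace {A : Matrix d d ℂ} (hA : A.IsHermitian) {p : ℕ} (hp : 0 < p) :
    ‖A‖ ^ (2 * p) ≤ (A ^ (2 * p)).trace.re := by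
  rw [trace_pow_eq_sum_eigenvalues hA, Complex.ofReal_re]
  have h0 : ∀ i, 0 ≤ hA.eigenvalues i ^ (2 * p) := fun i => by
    rw [pow_mul]
    positivity
  have h1 : ‖A‖ = ‖(RCLike.ofReal ∘ hA.eigenvalues : d → ℂ)‖ := by
    conv_lhs => rw [hA.spectral_theorem, Unitary.conjStarAlgAut_apply]
    rw [CStarRing.norm_mul_mem_unitary _ (Unitary.star_mem hA.eigenvectorUnitary.2),
      CStarRing.norm_coe_unitary_mul, Matrix.l2_opNorm_diagonal]
  rcases isEmpty_or_nonempty d with hd | hd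
  · rw [h1, Subsingleton.elim (RCLike.ofReal ∘ hA.eigenvalues : d → ℂ) 0, norm_zero,
      zero_pow (by omega)]
    exact Finset.sum_nonneg fun i _ => h0 i
  · obtain ⟨i, hi⟩ := Finite.exists_max fun i => ‖(RCLike.ofReal ∘ hA.eigenvalues : d → ℂ) i‖
    have h2 : ‖A‖ ≤ |hA.eigenvalues i| := by
      rw [h1]
      refine (pi_norm_le_iff_of_nonneg (abs_nonneg _)).2 fun j => (hi j).trans ?_
      simp
    calc ‖A‖ ^ (2 * p) ≤ |hA.eigenvalues i| ^ (2 * p) := pow_le_pow_left₀ (norm_nonneg _) h2 _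
      _ = hA.eigenvalues i ^ (2 * p) := by rw [pow_mul, sq_abs, ← pow_mul]
      _ ≤ _ := Finset.single_le_sum (fun j _ => h0 j) (Finset.mem_univ i)

end RankOne
end RandomChannel

namespace RandomChannel

/-! ### The output matrix in terms of the realigned interaction. -/

section Output

theorem bell_apply (n : ℕ) (x y : Fin n × Fin n) :
    bell n x y = if x.1 = x.2 ∧ y.1 = y.2 then 1 / (n : ℂ) else 0 := by
  simp only [bell, Matrix.smul_apply, Matrix.sum_apply, Matrix.kroneckerMap_apply, smul_eq_mul]
  rw [Finset.sum_eq_single x.1 (fun i _ hi => Finset.sum_eq_zero fun j _ => by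
      rw [Matrix.single_apply_of_row_ne hi, zero_mul]) (by simp),
    Finset.sum_eq_single y.1 (fun j _ hj => by
      rw [Matrix.single_apply_of_col_ne _ _ hj, zero_mul]) (by simp)]
  by_cases hx : x.1 = x.2 <;> by_cases hy : y.1 = y.2 <;> simp [hx, hy]

theorem bell_exchange (n : ℕ) (i j s t : Fin n × Fin n) :
    bell n i j * bell n s t = bell n i t * bell n s j := by
  simp only [bell_apply]
  by_cases h1 : i.1 = i.2 <;> by_cases h2 : j.1 = j.2 <;> by_cases h3 : s.1 = s.2 <;>
    by_cases h4 : t.1 = t.2 <;> simp [h1, h2, h3, h4]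

theorem isStarProjection_bell {n : ℕ} (hn : 0 < n) : IsStarProjection (bell n) := by
  refine ⟨?_, ?_⟩
  · ext x y
    rw [Matrix.mul_apply]
    simp only [bell_apply, Fintype.sum_prod_type]
    have : (n : ℂ) ≠ 0 := Nat.cast_ne_zero.2 hn.ne'
    by_cases hx : x.1 = x.2 <;> by_cases hy : y.1 = y.2 <;> simp [hx, hy]
    field_simp
  · ext x y
    rw [Matrix.star_apply, bell_apply, bell_apply]
    by_cases hx : x.1 = x.2 <;> by_cases hy : y.1 = y.2 <;> simp [hx, hy]

/-- The entries of the realigned identity are δ_{aa'} δ_{ll'}, so each column is a multiple of the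
Bell vector. -/
theorem bell_mul_realign_one {n l : ℕ} (hn : 0 < n) :
    (1 - bell n) * realign (1 : Matrix (Fin n × Fin l) (Fin n × Fin l) ℂ) = 0 := by
  have h0 : (n : ℂ) ≠ 0 := Nat.cast_ne_zero.2 hn.ne'
  rw [Matrix.sub_mul, Matrix.one_mul, sub_eq_zero]
  ext x y
  rw [Matrix.mul_apply, Fintype.sum_prod_type]
  simp only [bell_apply, realign, Matrix.of_apply, Matrix.one_apply, Prod.mk.injEq]
  by_cases hx : x.1 = x.2 <;> by_cases hy : y.1 = y.2 <;> simp [hx, hy, h0]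

theorem realign_one_mul_bell {n l : ℕ} (hn : 0 < n) :
    realignAdj (1 : Matrix (Fin n × Fin l) (Fin n × Fin l) ℂ) * (1 - bell n) = 0 := by
  have h := congrArg Matrix.conjTranspose (bell_mul_realign_one (l := l) hn)
  rw [Matrix.conjTranspose_mul, realign_conjTranspose Matrix.isHermitian_one,
    Matrix.conjTranspose_zero] at h
  rwa [← Matrix.star_eq_conjTranspose, (isStarProjection_bell hn).one_sub.isSelfAdjoint.star_eq]
    at h

variable {n l : ℕ}

/-- The matrix `U (1 ⊗ Y) U*`. -/
noncomputable def interaction (U : Matrix (Fin n × Fin l) (Fin n × Fin l) ℂ) (Y : Matrix (Fin l) (Fin l) ℂ) :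
    Matrix (Fin n × Fin l) (Fin n × Fin l) ℂ :=
  U * ((1 : Matrix (Fin n) (Fin n) ℂ) ⊗ₖ Y) * Uᴴ

theorem interaction_apply (U : Matrix (Fin n × Fin l) (Fin n × Fin l) ℂ)
    (Y : Matrix (Fin l) (Fin l) ℂ) (x y : Fin n × Fin l) :
    interaction U Y x y = ∑ i, ∑ s, ∑ t, U x (i, s) * Y s t * star (U y (i, t)) := by
  simp only [interaction, Matrix.mul_apply, Fintype.sum_prod_type, Matrix.kroneckerMap_apply,
    Matrix.conjTranspose_apply, Matrix.one_apply, Finset.sum_mul, ite_mul, one_mul, zero_mul,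
    mul_ite, mul_zero, Finset.sum_ite_irrel, Finset.sum_const_zero, Finset.sum_ite_eq',
    Finset.mem_univ, if_true]
  exact Finset.sum_congr rfl fun i _ => Finset.sum_comm

theorem channel_single_apply (U : Matrix (Fin n × Fin l) (Fin n × Fin l) ℂ)
    (Y : Matrix (Fin l) (Fin l) ℂ) (i j a b : Fin n) :
    channel U Y (Matrix.single i j 1) a b =
      ∑ q, ∑ s, ∑ t, U (a, q) (i, s) * Y s t * star (U (b, q) (j, t)) := by
  simp only [channel, partialTrace, LinearMap.coe_mk, AddHom.coe_mk, Matrix.of_apply]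
  refine Finset.sum_congr rfl fun q _ => ?_
  simp only [Matrix.mul_apply, Fintype.sum_prod_type, Matrix.kroneckerMap_apply,
    Matrix.conjTranspose_apply, Matrix.single_apply, Finset.sum_mul, ite_mul, one_mul, zero_mul,
    mul_ite, mul_zero, Finset.sum_ite_irrel, Finset.sum_const_zero, Finset.sum_ite_eq,
    Finset.mem_univ, if_true, ite_and]
  exact Finset.sum_comm

theorem exists_eq_vecMulVec_star {Y : Matrix (Fin l) (Fin l) ℂ} (hY : IsStarProjection Y)
    (h1 : Y.rank = 1) : ∃ w : Fin l → ℂ, ∀ s t, Y s t = w s * star (w t) := by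
  have hY0 : Y ≠ 0 := fun h => by simp [h] at h1
  have htr := trace_eq_one_of_exchange (mul_exchange_of_rank_eq_one h1) hY.isIdempotentElem.eq hY0
  obtain ⟨t₀, ht₀⟩ : ∃ t, Y t t ≠ 0 := by
    by_contra! h
    rw [Matrix.trace, Finset.sum_eq_zero (s := Finset.univ) (f := fun t => Y.diag t) fun t _ => h t]
      at htr
    exact zero_ne_one htr
  have hH : ∀ s t, star (Y s t) = Y t s := fun s t =>
    congrFun (congrFun hY.isSelfAdjoint.star_eq t) s
  have hsum : Y t₀ t₀ = ((∑ s, Complex.normSq (Y t₀ s) : ℝ) : ℂ) := by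
    conv_lhs => rw [← hY.isIdempotentElem.eq, Matrix.mul_apply]
    rw [Complex.ofReal_sum]
    refine Finset.sum_congr rfl fun s _ => ?_
    rw [← hH t₀ s, ← Complex.mul_conj]
    rfl
  set z : ℝ := ∑ s, Complex.normSq (Y t₀ s) with hz
  have hz0 : 0 ≤ z := Finset.sum_nonneg fun s _ => Complex.normSq_nonneg _
  have hsq : ((√z : ℝ) : ℂ) * (√z : ℝ) = Y t₀ t₀ := by
    rw [hsum, ← Complex.ofReal_mul, Real.mul_self_sqrt hz0]
  have hs0 : ((√z : ℝ) : ℂ) ≠ 0 := fun h => ht₀ (by rw [← hsq, h, mul_zero])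
  refine ⟨fun s => Y s t₀ / (√z : ℝ), fun s t => ?_⟩
  have h2 : star (((√z : ℝ) : ℂ)) = (√z : ℝ) := Complex.conj_ofReal _
  rw [star_div₀, h2, hH, div_mul_div_comm, hsq, eq_div_iff ht₀]
  exact mul_exchange_of_rank_eq_one h1 s t t₀ t₀

/-- With Y = ww* and F = U(1 ⊗ w), the matrix U(1 ⊗ Y)U* is FF*. Each entry of Z is a sum of
products of four entries of F, and grouping them by the Bell indices i and j instead of by the
channels forms two entries of FF*. -/
theorem outputZ_eq (U : Matrix.unitaryGroup (Fin n × Fin l) ℂ) {Y : Matrix (Fin l) (Fin l) ℂ}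
    (hY : IsStarProjection Y) (h1 : Y.rank = 1) : outputZ U Y =
      (1 / (n : ℂ)) • (realign (interaction U.1 Y) * realignAdj (interaction U.1 Y)) := by
  obtain ⟨w, hw⟩ := exists_eq_vecMulVec_star hY h1
  set F : Fin n × Fin l → Fin n → ℂ := fun x i => ∑ s, U.1 x (i, s) * w s with hF
  have hstar : ∀ x i, star (F x i) = ∑ s, star (U.1 x (i, s)) * star (w s) := fun x i => by
    simp [hF, star_sum]
  have hP : ∀ x y, interaction U.1 Y x y = ∑ i, F x i * star (F y i) := fun x y => by
    rw [interaction_apply]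
    refine Finset.sum_congr rfl fun i _ => ?_
    rw [hstar, Finset.sum_mul_sum]
    refine Finset.sum_congr rfl fun s _ => Finset.sum_congr rfl fun t _ => ?_
    rw [hw]
    ring
  have hC : ∀ i j a b, channel U.1 Y (Matrix.single i j 1) a b =
      ∑ q, F (a, q) i * star (F (b, q) j) := fun i j a b => by
    rw [channel_single_apply]
    refine Finset.sum_congr rfl fun q _ => ?_
    rw [hstar, Finset.sum_mul_sum]
    refine Finset.sum_congr rfl fun s _ => Finset.sum_congr rfl fun t _ => ?_
    rw [hw]
    ring
  have hC' : ∀ i j a b, channel (U.1.map star) (Y.map star) (Matrix.single i j 1) a b =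
      ∑ q, star (F (a, q) i) * F (b, q) j := fun i j a b => by
    rw [channel_single_apply]
    refine Finset.sum_congr rfl fun q _ => ?_
    rw [hstar, hF, Finset.sum_mul_sum]
    refine Finset.sum_congr rfl fun s _ => Finset.sum_congr rfl fun t _ => ?_
    simp only [Matrix.map_apply, hw, star_mul', star_star]
    ring
  ext ⟨a, a'⟩ ⟨b, b'⟩
  simp only [outputZ, bell, map_smul, map_sum, tensorMap_kronecker, Matrix.smul_apply,
    Matrix.sum_apply, Matrix.kroneckerMap_apply, hC, hC', Matrix.mul_apply, realign, realignAdj,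
    Matrix.of_apply, hP, Fintype.sum_prod_type, Finset.sum_mul_sum]
  congr 1
  calc _ = ∑ i, ∑ q, ∑ q', ∑ j, F (a, q) i * star (F (b, q) j) *
        (star (F (a', q') i) * F (b', q') j) := Finset.sum_congr rfl fun i _ => by
        rw [Finset.sum_comm]
        exact Finset.sum_congr rfl fun q _ => Finset.sum_comm
    _ = ∑ q, ∑ q', ∑ i, ∑ j, F (a, q) i * star (F (b, q) j) *
        (star (F (a', q') i) * F (b', q') j) := by
        rw [Finset.sum_comm]
        exact Finset.sum_congr rfl fun q _ => Finset.sum_comm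
    _ = _ := Finset.sum_congr rfl fun q _ => Finset.sum_congr rfl fun q' _ =>
        Finset.sum_congr rfl fun i _ => Finset.sum_congr rfl fun j _ => by ring

/-- The state of the environment, centred. -/
noncomputable def centredEnvironment (n : ℕ) (Y : Matrix (Fin l) (Fin l) ℂ) :
    Matrix (Fin n × Fin l) (Fin n × Fin l) ℂ :=
  (1 : Matrix (Fin n) (Fin n) ℂ) ⊗ₖ Y - (1 / (l : ℂ)) • 1

theorem isHermitian_centredEnvironment {Y : Matrix (Fin l) (Fin l) ℂ} (hY : IsStarProjection Y) :
    (centredEnvironment n Y).IsHermitian := by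
  have h : Yᴴ = Y := hY.isSelfAdjoint.star_eq
  rw [Matrix.IsHermitian, centredEnvironment, Matrix.conjTranspose_sub,
    Matrix.conjTranspose_kronecker, h, Matrix.conjTranspose_smul, Matrix.conjTranspose_one,
    Matrix.conjTranspose_one]
  simp

theorem centredEnvironment_mul_self {Y : Matrix (Fin l) (Fin l) ℂ} (hY : IsStarProjection Y) :
    centredEnvironment n Y * centredEnvironment n Y =
      (1 - 2 / (l : ℂ)) • centredEnvironment n Y + (1 / (l : ℂ) - 1 / (l : ℂ) ^ 2) • 1 := by
  have h : ((1 : Matrix (Fin n) (Fin n) ℂ) ⊗ₖ Y) * ((1 : Matrix (Fin n) (Fin n) ℂ) ⊗ₖ Y) =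
      (1 : Matrix (Fin n) (Fin n) ℂ) ⊗ₖ Y := by
    rw [← Matrix.mul_kronecker_mul, one_mul, hY.isIdempotentElem.eq]
  simp only [centredEnvironment, sub_mul, mul_sub, h, smul_mul_assoc, mul_smul_comm, one_mul,
    mul_one]
  module

theorem trace_centredEnvironment {Y : Matrix (Fin l) (Fin l) ℂ} (hY : IsStarProjection Y)
    (h1 : Y.rank = 1) : (centredEnvironment n Y).trace = 0 := by
  have hY0 : Y ≠ 0 := fun h => by simp [h] at h1
  have hl : (l : ℂ) ≠ 0 := fun h => by
    obtain rfl : l = 0 := by exact_mod_cast h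
    exact hY0 (Subsingleton.elim _ _)
  rw [centredEnvironment, Matrix.trace_sub, Matrix.trace_kronecker, trace_eq_one_of_exchange
    (mul_exchange_of_rank_eq_one h1) hY.isIdempotentElem.eq hY0, Matrix.trace_smul]
  simp
  field_simp
  simp

theorem interaction_eq (U : Matrix.unitaryGroup (Fin n × Fin l) ℂ)
    (Y : Matrix (Fin l) (Fin l) ℂ) :
    interaction U.1 Y = U.1 * centredEnvironment n Y * (U.1)ᴴ + (1 / (l : ℂ)) • 1 := by
  have hU : U.1 * (U.1)ᴴ = 1 := Matrix.mem_unitaryGroup_iff.1 U.2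
  rw [interaction, centredEnvironment, mul_sub, sub_mul, mul_smul_comm, mul_one, smul_mul_assoc,
    hU, sub_add_cancel]

theorem realign_add_smul_one (A : Matrix (Fin n × Fin l) (Fin n × Fin l) ℂ) (z : ℂ) :
    realign (A + z • 1) = realign A + z • realign 1 := by
  ext
  simp [realign]

theorem realignAdj_add_smul_one (A : Matrix (Fin n × Fin l) (Fin n × Fin l) ℂ) (z : ℂ) :
    realignAdj (A + z • 1) = realignAdj A + z • realignAdj 1 := by
  ext
  simp [realignAdj]

/-- The mean 1/k of the interaction contributes only multiples of the realigned identity, which the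
outer projections annihilate. -/
theorem rescaledQZQ_eq (c : ℝ) (hn : 0 < n) (U : Matrix.unitaryGroup (Fin n × Fin l) ℂ)
    {Y : Matrix (Fin l) (Fin l) ℂ} (hY : IsStarProjection Y) (h1 : Y.rank = 1) :
    rescaledQZQ c U Y = (1 - bell n) * (((c : ℂ) ^ 2 * n) •
      (realign (U.1 * centredEnvironment n Y * (U.1)ᴴ) *
        realignAdj (U.1 * centredEnvironment n Y * (U.1)ᴴ))) * (1 - bell n) := by
  have h0 : (n : ℂ) ≠ 0 := Nat.cast_ne_zero.2 hn.ne'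
  rw [rescaledQZQ, outputZ_eq U hY h1, interaction_eq, realign_add_smul_one,
    realignAdj_add_smul_one, mul_smul_comm, smul_mul_assoc, smul_smul, mul_smul_comm,
    smul_mul_assoc]
  congr 1
  · field_simp
  · have h2 : ∀ A : Matrix (Fin n × Fin n) (Fin l × Fin l) ℂ, (1 - bell n) *
        (A + (1 / (l : ℂ)) • realign 1) = (1 - bell n) * A := fun A => by
      rw [Matrix.mul_add, Matrix.mul_smul, bell_mul_realign_one hn, smul_zero, add_zero]
    have h3 : ∀ A : Matrix (Fin l × Fin l) (Fin n × Fin n) ℂ,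
        (A + (1 / (l : ℂ)) • realignAdj 1) * (1 - bell n) = A * (1 - bell n) := fun A => by
      rw [Matrix.add_mul, Matrix.smul_mul, realign_one_mul_bell hn, smul_zero, add_zero]
    rw [← Matrix.mul_assoc, h2, Matrix.mul_assoc, h3]
    simp only [Matrix.mul_assoc]

end Output
end RandomChannel

namespace RandomChannel

/-! ### Transfer of moments to the compressed output. -/

section Moments

theorem isHermitian_smul_realign_mul (c : ℝ) {n l : ℕ}
    {Q : Matrix (Fin n × Fin l) (Fin n × Fin l) ℂ} (hQ : Q.IsHermitian) :
    (((c : ℂ) ^ 2 * n) • (realign Q * realignAdj Q)).IsHermitian := by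
  rw [Matrix.IsHermitian, Matrix.conjTranspose_smul, ← realign_conjTranspose hQ,
    Matrix.conjTranspose_mul, Matrix.conjTranspose_conjTranspose]
  simp

theorem isHermitian_rescaledQZQ (c : ℝ) {n l : ℕ} (U : Matrix.unitaryGroup (Fin n × Fin l) ℂ)
    {Y : Matrix (Fin l) (Fin l) ℂ} (hY : IsStarProjection Y) (h1 : Y.rank = 1) :
    (rescaledQZQ c U Y).IsHermitian := by
  rcases Nat.eq_zero_or_pos n with rfl | hn
  · exact Subsingleton.elim _ _
  have hQ : (1 - bell n)ᴴ = 1 - bell n := (isStarProjection_bell hn).one_sub.isSelfAdjoint.star_eq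
  have h := Matrix.isHermitian_mul_mul_conjTranspose (1 - bell n) (isHermitian_smul_realign_mul c
    (isHermitian_conj U.1 (isHermitian_centredEnvironment (n := n) hY)))
  rwa [hQ, ← rescaledQZQ_eq c hn U hY h1] at h

-- The compression error p‖B‖^p is bounded through tr B^{2p}, of order n² when the moments converge;
-- its square root divided by n² leaves 1/n.
open scoped Matrix.Norms.L2Operator in
theorem norm_moment_sub_le (c : ℝ) {n l : ℕ} (hn : 0 < n)
    (U : Matrix.unitaryGroup (Fin n × Fin l) ℂ) {Y : Matrix (Fin l) (Fin l) ℂ}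
    (hY : IsStarProjection Y) (h1 : Y.rank = 1) {p : ℕ} (hp : 0 < p) :
    ‖1 / (n : ℂ) ^ 2 * (rescaledQZQ c U Y ^ p).trace -
      normTrace c p (U.1 * centredEnvironment n Y * (U.1)ᴴ)‖ ≤
      p * √(normTrace c (2 * p) (U.1 * centredEnvironment n Y * (U.1)ᴴ)).re * (1 / n) := by
  have hn' : (0 : ℝ) < n := Nat.cast_pos.2 hn
  rw [rescaledQZQ_eq c hn U hY h1, normTrace, normTrace]
  set B := ((c : ℂ) ^ 2 * n) • (realign (U.1 * centredEnvironment n Y * (U.1)ᴴ) *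
        realignAdj (U.1 * centredEnvironment n Y * (U.1)ᴴ)) with hBdef
  have hB : B.IsHermitian := isHermitian_smul_realign_mul c
    (isHermitian_conj U.1 (isHermitian_centredEnvironment (n := n) hY))
  have h2 := norm_trace_compression_pow_sub_le (bell_exchange n) (isStarProjection_bell hn) B p
  have h3 := norm_pow_le_trace hB hp
  have h4 : (1 / (n : ℂ) ^ 2 * (B ^ (2 * p)).trace).re = (B ^ (2 * p)).trace.re / (n : ℝ) ^ 2 := by
    rw [show (1 / (n : ℂ) ^ 2) = ((1 / (n : ℝ) ^ 2 : ℝ) : ℂ) by push_cast; rfl,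
      Complex.re_ofReal_mul]
    ring
  have h5 : ‖B‖ ^ p ≤ √(1 / (n : ℂ) ^ 2 * (B ^ (2 * p)).trace).re * n := by
    rw [h4, Real.sqrt_div' _ (by positivity), Real.sqrt_sq hn'.le, div_mul_cancel₀ _ hn'.ne']
    refine Real.le_sqrt_of_sq_le ?_
    rwa [← pow_mul, mul_comm p 2]
  rw [← mul_sub, norm_mul]
  have h6 : ‖1 / (n : ℂ) ^ 2‖ = 1 / (n : ℝ) ^ 2 := by simp
  rw [h6]
  calc _ ≤ 1 / (n : ℝ) ^ 2 * (p * (√(1 / (n : ℂ) ^ 2 * (B ^ (2 * p)).trace).re * n)) :=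
        mul_le_mul_of_nonneg_left (h2.trans (mul_le_mul_of_nonneg_left h5 (by positivity)))
          (by positivity)
    _ = _ := by field_simp

theorem tendsto_moment_of_tendsto_normTrace (c : ℝ) {k : ℕ → ℕ}
    (U : (n : ℕ) → Matrix.unitaryGroup (Fin n × Fin (k n)) ℂ)
    (Y : (n : ℕ) → Matrix (Fin (k n)) (Fin (k n)) ℂ)
    (hY : ∀ n, IsStarProjection (Y n) ∧ (Y n).rank = 1) (m : ℕ → ℝ)
    (h : ∀ p, Tendsto (fun n => normTrace c p
      ((U n).1 * centredEnvironment n (Y n) * ((U n).1)ᴴ)) atTop (𝓝 (m p : ℂ))) (p : ℕ) :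
    Tendsto (fun n : ℕ => 1 / (n : ℂ) ^ 2 * (rescaledQZQ c (U n) (Y n) ^ p).trace) atTop
      (𝓝 (m p : ℂ)) := by
  rcases Nat.eq_zero_or_pos p with rfl | hp
  · refine (h 0).congr fun n => ?_
    rw [normTrace, pow_zero, pow_zero]
  have h1 : Tendsto (fun n : ℕ => p * √(normTrace c (2 * p)
      ((U n).1 * centredEnvironment n (Y n) * ((U n).1)ᴴ)).re * (1 / (n : ℝ))) atTop (𝓝 0) := by
    have h2 := ((((Complex.continuous_re.tendsto _).comp (h (2 * p))).sqrt).const_mul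
      (p : ℝ)).mul (tendsto_one_div_atTop_nhds_zero_nat (𝕜 := ℝ))
    rwa [mul_zero] at h2
  have h3 := squeeze_zero_norm' ((eventually_gt_atTop 0).mono fun n hn =>
    norm_moment_sub_le c hn (U n) (hY n).1 (hY n).2 hp) h1
  simpa using h3.add (h p)

end Moments

/-! ### From convergence of moments to weak convergence. -/

section Weak

theorem integral_empiricalSpectralMeasure {d : Type*} [Fintype d] [DecidableEq d]
    {A : Matrix d d ℂ} (hA : A.IsHermitian) (f : ℝ → ℝ) :
    ∫ x, f x ∂(empiricalSpectralMeasure A) =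
      (Fintype.card d : ℝ)⁻¹ * ∑ i, f (hA.eigenvalues i) := by
  rw [empiricalSpectralMeasure, dif_pos hA, integral_smul_measure,
    integral_finsetSum_measure fun i _ => integrable_dirac enorm_lt_top]
  simp

theorem integrable_empiricalSpectralMeasure {d : Type*} [Fintype d] [DecidableEq d]
    (A : Matrix d d ℂ) (f : ℝ → ℝ) :
    Integrable f (empiricalSpectralMeasure A) := by
  rw [empiricalSpectralMeasure]
  split_ifs with hA
  · rcases isEmpty_or_nonempty d with hd | hd
    · simp
    refine Integrable.smul_measure ?_ (by simp)
    exact integrable_finsetSum_measure.2 fun i _ => integrable_dirac enorm_lt_top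
  · exact integrable_zero_measure

theorem ofReal_integral_pow_empiricalSpectralMeasure {d : Type*} [Fintype d] [DecidableEq d]
    {A : Matrix d d ℂ} (hA : A.IsHermitian) (p : ℕ) :
    ((∫ x, x ^ p ∂(empiricalSpectralMeasure A) : ℝ) : ℂ) =
      (Fintype.card d : ℂ)⁻¹ * (A ^ p).trace := by
  rw [integral_empiricalSpectralMeasure hA, trace_pow_eq_sum_eigenvalues hA]
  push_cast
  rfl

theorem abs_eval_le (P : Polynomial ℝ) {x : ℝ} (hx : 1 ≤ |x|) :
    |P.eval x| ≤ (∑ i ∈ Finset.range (P.natDegree + 1), |P.coeff i|) * |x| ^ P.natDegree := by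
  rw [Polynomial.eval_eq_sum_range, Finset.sum_mul]
  refine (Finset.abs_sum_le_sum_abs _ _).trans (Finset.sum_le_sum fun i hi => ?_)
  rw [abs_mul, abs_pow]
  exact mul_le_mul_of_nonneg_left (pow_le_pow_right₀ hx
    (Nat.lt_succ_iff.1 (Finset.mem_range.1 hi))) (abs_nonneg _)

/-- A bounded continuous function is approximated by a polynomial, with an error which is
uniformly small on an interval and of controlled growth outside. -/
theorem exists_polynomial_sub_le (f : ℝ →ᵇ ℝ) {K ε : ℝ} (hK : 0 ≤ K) (hε : 0 < ε) :
    ∃ (P : Polynomial ℝ) (j : ℕ) (a : ℝ), 0 ≤ a ∧ a * K ^ (2 * j) ≤ ε ∧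
      ∀ x, |f x - P.eval x| ≤ ε + a * x ^ (2 * j) := by
  -- The polynomial is chosen on an interval strictly larger than [-K, K]. Outside it the error is
  -- dominated by (x/L)^{2j} up to a constant, and on the support this is at most a multiple of
  -- (K/L)^{2j}, small for large j.
  set L := K + 1 with hL
  have hL0 : 0 < L := by linarith
  obtain ⟨P, hP⟩ := exists_polynomial_near_of_continuousOn (-L) L f f.continuous.continuousOn ε hε
  set S := ∑ i ∈ Finset.range (P.natDegree + 1), |P.coeff i| with hS
  have hS0 : 0 ≤ S := Finset.sum_nonneg fun i _ => abs_nonneg _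
  set C := (‖f‖ + S) * L ^ P.natDegree with hC
  have hC0 : 0 ≤ C := by positivity
  have hlim : Tendsto (fun j : ℕ => C * ((K / L) ^ 2) ^ j) atTop (𝓝 0) := by
    have h1 : K / L < 1 := (div_lt_one hL0).2 (by linarith)
    have h2 : 0 ≤ K / L := by positivity
    simpa using (tendsto_pow_atTop_nhds_zero_of_lt_one (r := (K / L) ^ 2) (by positivity)
      (pow_lt_one₀ h2 h1 two_ne_zero)).const_mul C
  obtain ⟨j, hj, hjN⟩ := ((hlim.eventually_le_const hε).and
    (eventually_ge_atTop P.natDegree)).exists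
  refine ⟨P, j, C / L ^ (2 * j), by positivity, ?_, fun x => ?_⟩
  · rw [← pow_mul, div_pow] at hj
    rwa [div_mul_eq_mul_div, ← mul_div_assoc']
  · have hx2 : 0 ≤ x ^ (2 * j) := by
      rw [pow_mul]
      positivity
    rcases le_or_gt |x| L with hx | hx
    · rw [abs_sub_comm]
      exact (hP x (abs_le.1 hx)).le.trans (le_add_of_nonneg_right (by positivity))
    · have h1 : 1 ≤ |x| := by linarith
      have h2 : |f x - P.eval x| ≤ (‖f‖ + S) * |x| ^ P.natDegree := by
        refine (abs_sub _ _).trans ?_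
        have h3 := abs_eval_le P h1
        have h4 := f.norm_coe_le_norm x
        rw [Real.norm_eq_abs] at h4
        have h5 : ‖f‖ ≤ ‖f‖ * |x| ^ P.natDegree :=
          le_mul_of_one_le_right (norm_nonneg _) (one_le_pow₀ h1)
        rw [add_mul]
        linarith
      have h6 : x ^ (2 * j) = |x| ^ (2 * j) := by rw [pow_mul, pow_mul, sq_abs]
      have h7 : |x| ^ P.natDegree * L ^ (2 * j) ≤ L ^ P.natDegree * |x| ^ (2 * j) := by
        obtain ⟨t, ht⟩ := Nat.exists_eq_add_of_le (show P.natDegree ≤ 2 * j by omega)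
        rw [ht, pow_add, pow_add]
        have := pow_le_pow_left₀ hL0.le hx.le t
        calc |x| ^ P.natDegree * (L ^ P.natDegree * L ^ t) ≤
            |x| ^ P.natDegree * (L ^ P.natDegree * |x| ^ t) := by gcongr
          _ = _ := by ring
      refine h2.trans ((?_ : _ ≤ C / L ^ (2 * j) * x ^ (2 * j)).trans
        (le_add_of_nonneg_left hε.le))
      rw [h6, div_mul_eq_mul_div, le_div_iff₀ (by positivity), hC, mul_assoc, mul_assoc]
      exact mul_le_mul_of_nonneg_left h7 (by positivity)

/-- Convergence of all moments to those of a compactly supported probability measure implies weak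
convergence. -/
theorem convergesWeakly_of_tendsto_moments {μ : ℕ → Measure ℝ} {ν : Measure ℝ}
    [IsProbabilityMeasure ν] (hμ : ∀ n, ∀ f : ℝ → ℝ, Continuous f → Integrable f (μ n))
    (hν : ∀ f : ℝ → ℝ, Continuous f → Integrable f ν) {K : ℝ} (hK : 0 ≤ K)
    (hsupp : ∀ᵐ x ∂ν, |x| ≤ K)
    (h : ∀ p : ℕ, Tendsto (fun n => ∫ x, x ^ p ∂(μ n)) atTop (𝓝 (∫ x, x ^ p ∂ν))) :
    ConvergesWeakly μ ν := by
  have hpoly : ∀ P : Polynomial ℝ,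
      Tendsto (fun n => ∫ x, P.eval x ∂(μ n)) atTop (𝓝 (∫ x, P.eval x ∂ν)) := fun P => by
    simp only [Polynomial.eval_eq_sum_range]
    have h1 : ∀ ρ : Measure ℝ, (∀ f : ℝ → ℝ, Continuous f → Integrable f ρ) →
        ∫ x, ∑ i ∈ Finset.range (P.natDegree + 1), P.coeff i * x ^ i ∂ρ =
        ∑ i ∈ Finset.range (P.natDegree + 1), P.coeff i * ∫ x, x ^ i ∂ρ := fun ρ hρ => by
      rw [integral_finsetSum _ fun i _ => hρ _ (by fun_prop)]
      exact Finset.sum_congr rfl fun i _ => integral_const_mul _ _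
    rw [h1 ν hν]
    simp only [h1 _ (hμ _)]
    exact tendsto_finsetSum _ fun i _ => (h i).const_mul _
  intro f
  rw [Metric.tendsto_atTop']
  intro ε hε
  obtain ⟨P, j, a, ha, haK, hP⟩ := exists_polynomial_sub_le f hK (show 0 < ε / 8 by positivity)
  have hbound : ∀ ρ : Measure ℝ, (∀ f : ℝ → ℝ, Continuous f → Integrable f ρ) →
      |∫ x, f x ∂ρ - ∫ x, P.eval x ∂ρ| ≤ ε / 8 * ∫ x, x ^ 0 ∂ρ + a * ∫ x, x ^ (2 * j) ∂ρ :=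
    fun ρ hρ => by
      rw [← integral_sub (hρ _ f.continuous) (hρ _ P.continuous), ← integral_const_mul,
        ← integral_const_mul, ← integral_add ((hρ _ (by fun_prop)).const_mul _)
        ((hρ _ (by fun_prop)).const_mul _)]
      refine (abs_integral_le_integral_abs).trans (integral_mono
        (hρ _ (f.continuous.sub P.continuous)).abs (hρ _ (by fun_prop)) fun x => ?_)
      simpa using hP x
  have hνj : a * ∫ x, x ^ (2 * j) ∂ν ≤ ε / 8 := by
    refine (mul_le_mul_of_nonneg_left ?_ ha).trans haK
    have h1 : ∫ x, x ^ (2 * j) ∂ν ≤ ∫ _, K ^ (2 * j) ∂ν := by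
      refine integral_mono_ae (hν _ (by fun_prop)) (integrable_const _) (hsupp.mono fun x hx => ?_)
      change x ^ (2 * j) ≤ K ^ (2 * j)
      rw [pow_mul, ← sq_abs, ← pow_mul]
      exact pow_le_pow_left₀ (abs_nonneg x) hx _
    simpa using h1
  have hν0 : ∫ x, x ^ 0 ∂ν = 1 := by simp
  have hG : Tendsto (fun n => ε / 8 * ∫ x, x ^ 0 ∂(μ n) + a * ∫ x, x ^ (2 * j) ∂(μ n)) atTop
      (𝓝 (ε / 8 * ∫ x, x ^ 0 ∂ν + a * ∫ x, x ^ (2 * j) ∂ν)) :=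
    ((h 0).const_mul _).add ((h _).const_mul _)
  -- The approximation error under `μ n` is controlled by its moments 0 and 2j, which converge to
  -- those of ν. Thus no tightness has to be known in advance.
  have hlt : ε / 8 * ∫ x, x ^ 0 ∂ν + a * ∫ x, x ^ (2 * j) ∂ν < 3 * ε / 8 := by
    rw [hν0]
    linarith
  have h1 := hbound ν hν
  have h2 := Metric.tendsto_nhds.1 (hpoly P) (ε / 8) (by positivity)
  obtain ⟨N, hN⟩ := ((hG.eventually_lt_const hlt).and h2).exists_forall_of_atTop
  refine ⟨N, fun n hn => ?_⟩
  obtain ⟨h3, h4⟩ := hN n hn.le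
  have h5 := hbound (μ n) (hμ n)
  rw [Real.dist_eq] at h4 ⊢
  have e1 := abs_le.1 h1
  have e2 := abs_lt.1 h4
  have e3 := abs_le.1 h5
  rw [abs_lt]
  constructor <;> linarith [e1.1, e1.2, e2.1, e2.2, e3.1, e3.2]

end Weak
end RandomChannel

namespace RandomChannel

/-! ### Support of the limit law and conclusion. -/

section MarchenkoPastur

variable {r : ℝ}

theorem isProbabilityMeasure_marchenkoPastur (hr : 0 < r) :
    IsProbabilityMeasure (marchenkoPastur r) := by
  have h := integral_pow_marchenkoPastur hr 0
  simp only [pow_zero, mpSeq_zero, integral_const, smul_eq_mul, mul_one] at h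
  exact ⟨(ENNReal.toReal_eq_one_iff _).1 h⟩

theorem ae_abs_le_marchenkoPastur (hr : 0 < r) :
    ∀ᵐ x ∂(marchenkoPastur r), |x| ≤ 1 + r + 2 * √r := by
  rw [marchenkoPastur_eq, ae_add_measure_iff]
  constructor
  · refine Measure.ae_smul_measure ?_ _
    refine (ae_dirac_iff (measurableSet_le measurable_abs measurable_const)).2 ?_
    rw [abs_zero]
    positivity
  · rw [ae_withDensity_iff (measurable_mpDensity r).ennreal_ofReal]
    refine ae_of_all _ fun x hx => ?_
    have h : x ∈ Set.Icc (1 + r - 2 * √r) (1 + r + 2 * √r) := by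
      by_contra h
      exact hx (by rw [mpDensity, Set.indicator_of_notMem h, ENNReal.ofReal_zero])
    rw [abs_of_nonneg ((mp_lo_nonneg hr).trans h.1)]
    exact h.2

end MarchenkoPastur

theorem haarModel {Ω : Type*} [MeasurableSpace Ω] {P : Measure Ω} [IsProbabilityMeasure P]
    {c : ℝ} (hc : 0 < c) {k : ℕ → ℕ}
    (hk : Tendsto (fun n => (k n : ℝ) / (n : ℝ)) atTop (𝓝 c))
    {Y : (n : ℕ) → Matrix (Fin (k n)) (Fin (k n)) ℂ}
    (hY : ∀ n, IsStarProjection (Y n) ∧ (Y n).rank = 1)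
    {U : (n : ℕ) → Ω → Matrix.unitaryGroup (Fin n × Fin (k n)) ℂ}
    (hU : ∀ n, IsHaarUnitary (U n) P) :
    HaarModel c k (fun n => P.map (U n)) fun n => centredEnvironment n (Y n) where
  pos := hc
  tendsto := hk
  isProbability n := Measure.isProbabilityMeasure_map (hU n).measurable.aemeasurable
  invariant n := (hU n).isHaarMeasure.toIsMulLeftInvariant
  mul_self n := centredEnvironment_mul_self (hY n).1
  trace_eq n := trace_centredEnvironment (hY n).1 (hY n).2
  isHermitian n := isHermitian_centredEnvironment (hY n).1

theorem ae_tendsto_moment {Ω : Type*} [MeasurableSpace Ω] {P : Measure Ω}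
    [IsProbabilityMeasure P] {c : ℝ} (hc : 0 < c) {k : ℕ → ℕ}
    (hk : Tendsto (fun n => (k n : ℝ) / (n : ℝ)) atTop (𝓝 c))
    {Y : (n : ℕ) → Matrix (Fin (k n)) (Fin (k n)) ℂ}
    (hY : ∀ n, IsStarProjection (Y n) ∧ (Y n).rank = 1)
    {U : (n : ℕ) → Ω → Matrix.unitaryGroup (Fin n × Fin (k n)) ℂ}
    (hU : ∀ n, IsHaarUnitary (U n) P) :
    ∀ᵐ ω ∂P, ∀ p : ℕ, Tendsto
      (fun n : ℕ => 1 / (n : ℂ) ^ 2 * (rescaledQZQ c (U n ω) (Y n) ^ p).trace) atTop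
      (𝓝 ((∫ x, x ^ p ∂(marchenkoPastur (c ^ 2)) : ℝ) : ℂ)) := by
  have h : ∀ᵐ ω ∂P, ∀ p, Tendsto (fun n => normTrace c p
      ((U n ω).1 * centredEnvironment n (Y n) * ((U n ω).1)ᴴ)) atTop
      (𝓝 (mpSeq (c ^ 2) p : ℂ)) :=
    ae_all_iff.2 ((haarModel hc hk hY hU).ae_tendsto_normTrace (fun n => (hU n).measurable)
      (mpSeq (c ^ 2)) (mpSeq_zero _) (mpSeq_succ _))
  filter_upwards [h] with ω hω p
  rw [integral_pow_marchenkoPastur (pow_pos hc 2)]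
  exact tendsto_moment_of_tendsto_normTrace c (fun n => U n ω) Y hY _ hω p

end RandomChannel

theorem mainTheorem2 {Ω : Type*} [MeasurableSpace Ω] (P : Measure Ω) [IsProbabilityMeasure P]
    (c : ℝ) (hc : 0 < c) (k : ℕ → ℕ)
    (hk : Tendsto (fun n => (k n : ℝ) / (n : ℝ)) atTop (𝓝 c))
    (Y : (n : ℕ) → Matrix (Fin (k n)) (Fin (k n)) ℂ)
    (hY : ∀ n, IsStarProjection (Y n) ∧ (Y n).rank = 1)
    (U : (n : ℕ) → Ω → Matrix.unitaryGroup (Fin n × Fin (k n)) ℂ)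
    (hU : ∀ n, RandomChannel.IsHaarUnitary (U n) P) :
    ∀ᵐ ω ∂P,
      RandomChannel.ConvergesWeakly
        (fun n => RandomChannel.empiricalSpectralMeasure
          (RandomChannel.rescaledQZQ c (U n ω) (Y n)))
        (RandomChannel.marchenkoPastur (c ^ 2)) ∧
      ∀ p : ℕ, Tendsto
        (fun n : ℕ => 1 / (n : ℂ) ^ 2 * (RandomChannel.rescaledQZQ c (U n ω) (Y n) ^ p).trace)
        atTop (𝓝 ((∫ x, x ^ p ∂(RandomChannel.marchenkoPastur (c ^ 2)) : ℝ) : ℂ)) := by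
  have hc2 : 0 < c ^ 2 := pow_pos hc 2
  have := RandomChannel.isProbabilityMeasure_marchenkoPastur hc2
  filter_upwards [RandomChannel.ae_tendsto_moment hc hk hY hU] with ω hω
  refine ⟨RandomChannel.convergesWeakly_of_tendsto_moments
    (fun n f _ => RandomChannel.integrable_empiricalSpectralMeasure _ f)
    (fun f hf => RandomChannel.integrable_marchenkoPastur hc2 hf)
    (by positivity) (RandomChannel.ae_abs_le_marchenkoPastur hc2) fun p => ?_, hω⟩
  refine (((Complex.continuous_re.tendsto _).comp (hω p)).congr fun n => ?_)
  have h := RandomChannel.ofReal_integral_pow_empiricalSpectralMeasure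
    (RandomChannel.isHermitian_rescaledQZQ c (U n ω) (hY n).1 (hY n).2) p
  rw [← Complex.ofReal_re (∫ x, x ^ p ∂_), h, Function.comp_apply, Fintype.card_prod,
    Fintype.card_fin, Nat.cast_mul, sq, one_div]
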